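/- Let $d\ge 1$ be an integer and $\rho>0$. Let $\Delta f(z)=\sum_{x\in\mathbb Z^d:\,|x-z|=1}[f(x)-f(z)]$ be the discrete Laplacian, let $\mathcal M_1(\mathbb Z^d)$ be the set of probability measures on $\mathbb Z^d$, and let $\langle\cdot,\cdot\rangle$ be the inner product $\langle f,h\rangle=\sum_{z\in\mathbb Z^d}f(z)h(z)$. For $\sigma>0$ and $\gamma\in[0,1+2/d)\setminus\{1\}$ define $$\chi^{\mathrm{DE}}(\sigma)=\inf_{p\in\mathcal M_1(\mathbb Z^d)}\Big\{-\langle\Delta\sqrt p,\sqrt p\rangle-\sigma\langle p,\log p\rangle\Big\},\qquad \chi^{\mathrm{DB}}_\gamma(\sigma)=\inf_{p\in\mathcal M_1(\mathbb Z^d)}\Big\{-\langle\Delta\sqrt p,\sqrt p\rangle+\frac{\sigma}{1-\gamma}\langle p^\gamma-p,1\rangle\Big\},$$ $$\chi^{\mathrm{AB}}(\sigma)=\inf_{g\in H^1(\mathbb R^d),\,\|g\|_2=1}\Big\{\int_{\mathbb R^d}|\nabla g|^2-\sigma\int_{\mathbb R^d}g^2\log g^2\Big\},\qquad \chi^{\mathrm{B}}_\gamma(\sigma)=\inf_{g\in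 H^1(\mathbb R^d),\,\|g\|_2=1}\Big\{\int_{\mathbb R^d}|\nabla g|^2+\frac{\sigma}{1-\gamma}\int_{\mathbb R^d}(g^{2\gamma}-g^2)\Big\},$$ where $g$ is real-valued, $g^{2\gamma}=(g^2)^\gamma$, $0\log 0=0$, an expression in braces may take the value $+\infty$, and for $\gamma=0$ we read $0^0=0$, so that $\int g^{2\gamma}$ is the Lebesgue measure of $\{g\ne0\}$ and $\langle p^\gamma,1\rangle$ is the number of points of $\{p\neq 0\}$. Then $\chi^{\mathrm{AB}}(\rho)$, $\chi^{\mathrm B}_\gamma(\rho)$ and, for all $\kappa>0$, $\chi^{\mathrm{DE}}(\rho/\kappa)$, $\chi^{\mathrm{DB}}_\gamma(\rho/\kappa)$ are finite. As $\kappa\to\infty$, $$\kappa\,\chi^{\mathrm{DE}}\Big(\frac{\rho}{\kappa}\Big)=\chi^{\mathrm{AB}}(\rho)+\rho\,\frac d2\log\kappa+o(1),$$ and for every $\gamma\in[0,1+2/d)\setminus\{1\}$, with $\nu=\frac{1-\gamma}{2+d(1-\gamma)}$, $$\kappa^{1-d\nu}\,\chi^{\mathrm{DB}}_\gamma\Big(\frac{\rho}{\kappa}\Big)=\chi^{\mathrm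 B}_\gamma(\rho)+\rho\,\frac{1-\kappa^{-d\nu}}{1-\gamma}+o(1).$$ -/

import Mathlib

open MeasureTheory Filter Topology
open scoped ENNReal ContDiff

noncomputable section

namespace VarConv

/-- The real power `x ^ γ` of `x ≥ 0`, with the convention `0 ^ 0 = 0`.  It is the usual power for
`γ > 0`, and the indicator of `x ≠ 0` for `γ = 0`; so `∫ (g²)^0` is the volume of `{g ≠ 0}` and
`∑ p^0` is the cardinality of `{p ≠ 0}`. -/
def pow0 (x γ : ℝ) : ℝ := if x = 0 then 0 else x ^ γ

/-- The extended integral `∫ f⁺ - ∫ f⁻` with values in `[-∞, ∞]`. -/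
def extIntegral {α : Type*} [MeasurableSpace α] (μ : Measure α) (f : α → ℝ) : EReal :=
  ((∫⁻ x, ENNReal.ofReal (f x) ∂μ : ℝ≥0∞) : EReal) -
    ((∫⁻ x, ENNReal.ofReal (-f x) ∂μ : ℝ≥0∞) : EReal)

/-- The extended sum `∑ f⁺ - ∑ f⁻` with values in `[-∞, ∞]`. -/
def extSum {α : Type*} (f : α → ℝ) : EReal :=
  ((∑' z, ENNReal.ofReal (f z) : ℝ≥0∞) : EReal) - ((∑' z, ENNReal.ofReal (-f z) : ℝ≥0∞) : EReal)

section Continuous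

variable {d : ℕ}

/-- `G` is the weak (distributional) gradient of `g` on `ℝ^d`. -/
def HasWeakGradient (g : EuclideanSpace ℝ (Fin d) → ℝ)
    (G : EuclideanSpace ℝ (Fin d) → EuclideanSpace ℝ (Fin d)) : Prop :=
  ∀ φ : EuclideanSpace ℝ (Fin d) → ℝ, ContDiff ℝ ∞ φ → HasCompactSupport φ →
    ∀ i : Fin d, ∫ x, g x * fderiv ℝ φ x (EuclideanSpace.single i 1) = -∫ x, G x i * φ x

/-- `g ∈ H¹(ℝ^d)` with weak gradient `G`, and `g` has `L²`-norm one. -/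
structure IsUnitH1 (g : EuclideanSpace ℝ (Fin d) → ℝ)
    (G : EuclideanSpace ℝ (Fin d) → EuclideanSpace ℝ (Fin d)) : Prop where
  memLp : MemLp g 2 volume
  memLp_grad : MemLp G 2 volume
  weakGradient : HasWeakGradient g G
  norm_eq_one : eLpNorm g 2 volume = 1

variable (d)

/-- `χ^B_γ(ρ) = inf { ∫ |∇g|² + ρ/(1-γ) ∫ (g^{2γ} - g²) : g ∈ H¹(ℝ^d), ‖g‖₂ = 1 }`. -/
def chiB (γ ρ : ℝ) : EReal :=
  ⨅ (g : EuclideanSpace ℝ (Fin d) → ℝ)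
    (G : EuclideanSpace ℝ (Fin d) → EuclideanSpace ℝ (Fin d)) (_ : IsUnitH1 g G),
    ((∫ x, ‖G x‖ ^ 2 : ℝ) : EReal) +
      ((ρ / (1 - γ) : ℝ) : EReal) * extIntegral volume (fun x => pow0 (g x ^ 2) γ - g x ^ 2)

/-- `χ^AB(ρ) = inf { ∫ |∇g|² - ρ ∫ g² log g² : g ∈ H¹(ℝ^d), ‖g‖₂ = 1 }`. -/
def chiAB (ρ : ℝ) : EReal :=
  ⨅ (g : EuclideanSpace ℝ (Fin d) → ℝ)
    (G : EuclideanSpace ℝ (Fin d) → EuclideanSpace ℝ (Fin d)) (_ : IsUnitH1 g G),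
    ((∫ x, ‖G x‖ ^ 2 : ℝ) : EReal) -
      (ρ : EReal) * extIntegral volume (fun x => g x ^ 2 * Real.log (g x ^ 2))

end Continuous

section Discrete

variable {d : ℕ}

/-- The lattice Laplacian on `ℤ^d`: the sum of `f(x) - f(z)` over the `2d` nearest neighbours `x`
of `z`. -/
def latticeLaplacian (f : (Fin d → ℤ) → ℝ) (z : Fin d → ℤ) : ℝ :=
  ∑ i : Fin d, ((f (z + Pi.single i 1) - f z) + (f (z - Pi.single i 1) - f z))

/-- `-⟨Δ √p, √p⟩` for a probability measure `p` on `ℤ^d` (the series converges absolutely). -/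
def dirichletEnergy (p : PMF (Fin d → ℤ)) : ℝ :=
  -∑' z, latticeLaplacian (fun x => √(p x).toReal) z * √(p z).toReal

variable (d)

/-- `χ^DE(ρ) = inf { -⟨Δ √p, √p⟩ - ρ ⟨p, log p⟩ : p a probability measure on ℤ^d }`. -/
def chiDE (ρ : ℝ) : EReal :=
  ⨅ p : PMF (Fin d → ℤ), (dirichletEnergy p : EReal) -
    (ρ : EReal) * extSum (fun z => (p z).toReal * Real.log (p z).toReal)

/-- `χ^DB_γ(ρ) = inf { -⟨Δ √p, √p⟩ + ρ/(1-γ) ⟨p^γ - p, 1⟩ : p a probability measure on ℤ^d }`. -/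
def chiDB (γ ρ : ℝ) : EReal :=
  ⨅ p : PMF (Fin d → ℤ), (dirichletEnergy p : EReal) +
    ((ρ / (1 - γ) : ℝ) : EReal) * extSum (fun z => pow0 (p z).toReal γ - (p z).toReal)

end Discrete

end VarConv

end

/-! Write p(z) = h^d u(z)² and regard u as a step function g of mesh h. Since w^γ is homogeneous and
log is additive, the lattice functional becomes h² times (squared L² difference quotients of g plus
∫ F(g²)), up to an explicit additive constant. The mesh is h = κ^(-1/2) for the entropy and h =
κ^(-1/(2+d(1-γ))) for the power (`IsSplitDensity.chiDE_eq`, `IsSplitDensity.chiDB_eq`). The constant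
produces the explicit κ-dependent terms exactly, so everything reduces to one fact: the infimum over
step functions tends to the infimum over H¹ as h → 0 (`IsSplitDensity.tendsto_sInf_meshValues`).

No minimiser and no compactness of minimising sequences is needed, because near-minimisers are
converted in both directions. Averaging over mesh cells turns an H¹ function into a step function
without increasing difference quotients (`increment_cellAvg_le`). Averaging a step function over
translated cubes gives an H¹ function whose gradient is bounded by the difference quotients
(`increment_cubeAvg_le`, `exists_weakGradient`). Both bounds have constant one, and both averages
move g in L² by at most a multiple of h times its slope.

For the potential, F = a - b. The part b has Lipschitz growth of order below 2/d and is controlled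
by a Gagliardo-Nirenberg moment bound (`exists_moment_bound`), which also yields coercivity
uniformly in h. Step functions have no gradient, so that bound is proved from `BoundedOrSlow`, a
property they share with H¹ functions. The part a governs small values, and its integral need not be
continuous in L² (for γ = 0 it sees the volume of the support). The remedy is to subtract a small ε
from the averaged function, cut at zero and renormalise. Little mass is lost because small values
weigh little compared with a. The integral of a hardly rises because wherever the truncated function
exceeds g, the average differs from g by more than ε (`IsSplitDensity.exists_truncation`,
`IsSplitDensity.exists_truncated_approx`). -/

noncomputable section
namespace VarConv

/-! ### Jensen and Minkowski inequalities for averages. -/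

section Averages

theorem enorm_integral_rpow_le {Y : Type*} [MeasurableSpace Y] {ν : Measure Y} [IsFiniteMeasure ν]
    {F : Y → ℝ} (hF : AEStronglyMeasurable F ν) {q : ℝ} (hq : 1 ≤ q) :
    ‖∫ y, F y ∂ν‖ₑ ^ q ≤ ν Set.univ ^ (q - 1) * ∫⁻ y, ‖F y‖ₑ ^ q ∂ν := by
  have hq0 : 0 < q := by linarith
  have h1 : ‖∫ y, F y ∂ν‖ₑ ≤ eLpNorm F 1 ν := by
    rw [eLpNorm_one_eq_lintegral_enorm]
    exact enorm_integral_le_lintegral_enorm F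
  have h2 := eLpNorm_le_eLpNorm_mul_rpow_measure_univ (p := 1) (q := ENNReal.ofReal q)
    (by rw [← ENNReal.ofReal_one]; exact ENNReal.ofReal_le_ofReal hq) hF
  have h3 := ENNReal.rpow_le_rpow (h1.trans h2) hq0.le
  refine h3.trans_eq ?_
  rw [ENNReal.mul_rpow_of_nonneg _ _ hq0.le, mul_comm, ← ENNReal.rpow_mul,
    eLpNorm_eq_lintegral_rpow_enorm_toReal (by simpa using hq0) (by simp), ← ENNReal.rpow_mul,
    ENNReal.toReal_ofReal hq0.le]
  congr 2
  · simp; field_simp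
  · rw [one_div, inv_mul_cancel₀ hq0.ne', ENNReal.rpow_one]

theorem eLpNorm_two_sq {α : Type*} [MeasurableSpace α] (μ : Measure α) {F : Type*}
    [NormedAddCommGroup F] (f : α → F) :
    eLpNorm f 2 μ ^ 2 = ∫⁻ x, ‖f x‖ₑ ^ 2 ∂μ := by
  have := eLpNorm_nnreal_pow_eq_lintegral (f := f) (μ := μ) (p := 2) (by norm_num)
  simp only [NNReal.coe_ofNat, ENNReal.coe_ofNat, ENNReal.rpow_ofNat] at this
  exact this

theorem enorm_sq_eq_ofReal (x : ℝ) : ‖x‖ₑ ^ 2 = ENNReal.ofReal (x ^ 2) := by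
  rw [← sq_abs, ENNReal.ofReal_pow (abs_nonneg x), Real.enorm_eq_ofReal_abs]

/-- A form of Minkowski's integral inequality. As the sections have a uniform L² bound,
Cauchy-Schwarz in y followed by Tonelli already gives it. -/
theorem eLpNorm_integral_comp_le {X Y : Type*} [MeasurableSpace X] [MeasurableSpace Y]
    {μ : Measure X} {ν : Measure Y} [IsFiniteMeasure ν] [SFinite μ]
    {K : X → Y → ℝ} (hK : Measurable (Function.uncurry K)) {C : ℝ≥0∞}
    (hC : ∀ᵐ y ∂ν, eLpNorm (fun x => K x y) 2 μ ≤ C) :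
    eLpNorm (fun x => ∫ y, K x y ∂ν) 2 μ ≤ ν Set.univ * C := by
  have h2 : eLpNorm (fun x => ∫ y, K x y ∂ν) 2 μ ^ 2 ≤ (ν Set.univ * C) ^ 2 := by
    rw [eLpNorm_two_sq]
    calc ∫⁻ x, ‖∫ y, K x y ∂ν‖ₑ ^ 2 ∂μ
        ≤ ∫⁻ x, ν Set.univ * ∫⁻ y, ‖K x y‖ₑ ^ 2 ∂ν ∂μ := by
          refine lintegral_mono fun x => ?_
          have := enorm_integral_rpow_le (ν := ν) (F := K x) (q := 2)
            (hK.comp measurable_prodMk_left).aestronglyMeasurable (by norm_num)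
          simpa [show (2 : ℝ) - 1 = 1 by norm_num] using this
      _ = ν Set.univ * ∫⁻ x, ∫⁻ y, ‖K x y‖ₑ ^ 2 ∂ν ∂μ :=
          lintegral_const_mul' _ _ (measure_ne_top _ _)
      _ = ν Set.univ * ∫⁻ y, ∫⁻ x, ‖K x y‖ₑ ^ 2 ∂μ ∂ν := by
          rw [lintegral_lintegral_swap]
          exact (hK.enorm.pow_const 2).aemeasurable
      _ ≤ ν Set.univ * ∫⁻ _, C ^ 2 ∂ν := by
          refine mul_le_mul_right ?_ _
          refine lintegral_mono_ae ?_
          filter_upwards [hC] with y hy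
          rw [← eLpNorm_two_sq]
          gcongr
      _ = (ν Set.univ * C) ^ 2 := by
          rw [lintegral_const]; ring
  exact (ENNReal.pow_le_pow_left_iff two_ne_zero).1 h2

end Averages


abbrev Euc (d : ℕ) := EuclideanSpace ℝ (Fin d)

/-- The `L²`-norm of the increment of `g` along `v`. -/
def increment {d : ℕ} (g : Euc d → ℝ) (v : Euc d) : ℝ≥0∞ :=
  eLpNorm (fun x => g (x + v) - g x) 2 volume

/-! ### Weak gradients and L² increments. -/

section Sobolev

variable {d : ℕ}

/-- The integral is the convolution of f with the reflected test function, evaluated at r • e; the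
derivative falls on the smooth factor. -/
theorem hasDerivAt_integral_mul_comp_sub {f φ : Euc d → ℝ} (hf : LocallyIntegrable f volume)
    (hφ : ContDiff ℝ 1 φ) (hφc : HasCompactSupport φ) (e : Euc d) (r : ℝ) :
    HasDerivAt (fun r : ℝ => ∫ x, f x * φ (x - r • e)) (-∫ x, f x * fderiv ℝ φ (x - r • e) e) r := by
  have hψ : ContDiff ℝ 1 (fun x => φ (-x)) := hφ.comp contDiff_neg
  have hψc : HasCompactSupport (fun x => φ (-x)) := hφc.comp_homeomorph (Homeomorph.neg (Euc d))
  have h1 := hψc.hasFDerivAt_convolution_right (ContinuousLinearMap.mul ℝ ℝ) hf hψ (r • e)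
  have h2 : HasDerivAt (fun r : ℝ => r • e) e r := by
    simpa using (hasDerivAt_id r).smul_const e
  have h3 := h1.comp_hasDerivAt r h2
  rw [convolution_precompR_apply _ hf (hψc.fderiv ℝ) (hψ.continuous_fderiv one_ne_zero)] at h3
  have e1 : (fun r : ℝ => ∫ x, f x * φ (x - r • e)) =
      convolution f (fun x => φ (-x)) (ContinuousLinearMap.mul ℝ ℝ) volume ∘ fun r => r • e := by
    ext s
    simp [convolution_def, neg_sub]
  have e2 : -∫ x, f x * fderiv ℝ φ (x - r • e) e =
      convolution f (fun a => (fderiv ℝ (fun x => φ (-x)) a) e)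
        (ContinuousLinearMap.mul ℝ ℝ) volume (r • e) := by
    rw [convolution_def, ← integral_neg]
    congr 1
    ext x
    have : fderiv ℝ (fun y => φ (-y)) (r • e - x) = -fderiv ℝ φ (-(r • e - x)) := by
      have hd : DifferentiableAt ℝ φ (-(r • e - x)) := (hφ.differentiable one_ne_zero) _
      have := (hd.hasFDerivAt.comp (r • e - x) (hasFDerivAt_id (r • e - x)).neg).fderiv
      simpa [Function.comp_def] using this
    simp [this, neg_sub]
  rw [e1, e2]
  exact h3

theorem inner_toLp {f g : Euc d → ℝ} (hf : MemLp f 2 volume) (hg : MemLp g 2 volume) :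
    inner ℝ (hf.toLp f) (hg.toLp g) = ∫ x, f x * g x := by
  rw [L2.inner_def]
  refine integral_congr_ae ?_
  filter_upwards [hf.coeFn_toLp, hg.coeFn_toLp] with x h1 h2
  rw [h1, h2]
  simp [mul_comm]

theorem memLp_comp_add {f : Euc d → ℝ} (hf : MemLp f 2 volume) (v : Euc d) :
    MemLp (fun x => f (x + v)) 2 volume :=
  hf.comp_measurePreserving (measurePreserving_add_right volume v)

theorem memLp_increment {f : Euc d → ℝ} (hf : MemLp f 2 volume) (v : Euc d) :
    MemLp (fun x => f (x + v) - f x) 2 volume :=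
  (memLp_comp_add hf v).sub hf

theorem integral_increment_mul {f φ : Euc d → ℝ} (hf : MemLp f 2 volume) (hφ : MemLp φ 2 volume)
    (v : Euc d) :
    ∫ x, (f (x + v) - f x) * φ x = (∫ x, f x * φ (x - v)) - ∫ x, f x * φ x := by
  have h1 : Integrable (fun x => f (x + v) * φ x) volume :=
    (memLp_comp_add hf v).integrable_mul hφ
  have h2 : Integrable (fun x => f x * φ x) volume := hf.integrable_mul hφ
  simp_rw [sub_mul]
  rw [integral_sub h1 h2]
  congr 1
  have := integral_add_right_eq_self (μ := (volume : Measure (Euc d)))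
    (fun x => f x * φ (x - v)) v
  simpa using this

/-- Duality: the inequality is closed in the test element and test functions are dense in L², so f
may be tested against itself. -/
theorem norm_toLp_le_of_forall_test {f : Euc d → ℝ} (hf : MemLp f 2 volume) {C : ℝ} (hC : 0 ≤ C)
    (h : ∀ φ : Euc d → ℝ, ContDiff ℝ ∞ φ → HasCompactSupport φ → ∀ hφ : MemLp φ 2 volume,
      |∫ x, f x * φ x| ≤ C * ‖hφ.toLp φ‖) :
    ‖hf.toLp f‖ ≤ C := by
  have key : ∀ u : Lp ℝ 2 (volume : Measure (Euc d)), |inner ℝ (hf.toLp f) u| ≤ C * ‖u‖ := by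
    have hcl : IsClosed {u : Lp ℝ 2 (volume : Measure (Euc d)) |
        |inner ℝ (hf.toLp f) u| ≤ C * ‖u‖} :=
      isClosed_le (by fun_prop) (by fun_prop)
    have hd := Lp.dense_hasCompactSupport_contDiff (E := Euc d) (F := ℝ)
      (μ := volume) (p := 2) (by simp)
    intro u
    refine hcl.closure_subset_iff.2 ?_ (hd u)
    rintro v ⟨φ, hvφ, hφc, hφ⟩
    have hφ2 : MemLp φ 2 volume := hφ.continuous.memLp_of_hasCompactSupport hφc
    have hv : v = hφ2.toLp φ := by
      apply Lp.ext
      exact hvφ.trans hφ2.coeFn_toLp.symm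
    simp only [Set.mem_ofPred_eq]
    rw [hv, inner_toLp]
    exact h φ hφ hφc hφ2
  have := key (hf.toLp f)
  rw [real_inner_self_eq_norm_mul_norm, abs_of_nonneg (by positivity)] at this
  rcases (norm_nonneg (hf.toLp f)).eq_or_lt with h0 | h0
  · rw [← h0]; exact hC
  · exact le_of_mul_le_mul_right this h0

/-- Tested against φ, the increment is the change over [0, t] of r ↦ ∫ g φ(· - r e). By the
definition of weak gradient its derivative is ∫ G_i φ(· - r e), which Cauchy-Schwarz bounds, and the
mean value inequality concludes. No smoothing of g is involved. -/
theorem increment_le_weakGradient {g : Euc d → ℝ} {G : Euc d → Euc d} (hg : MemLp g 2 volume)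
    (hG : MemLp G 2 volume) (hgG : HasWeakGradient g G) (i : Fin d) {t : ℝ} (ht : 0 ≤ t) :
    increment g (EuclideanSpace.single i t) ≤
      ENNReal.ofReal t * eLpNorm (fun x => G x i) 2 volume := by
  have hGi : MemLp (fun x => G x i) 2 volume := hG.eval_piLp i
  set e : Euc d := EuclideanSpace.single i 1 with he
  have hte : EuclideanSpace.single i t = t • e := by
    rw [he]; ext j; simp
  have hD := memLp_increment hg (t • e)
  have hgl : LocallyIntegrable g volume := hg.locallyIntegrable (by norm_num)
  have main : ‖hD.toLp _‖ ≤ t * ‖hGi.toLp _‖ := by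
    refine norm_toLp_le_of_forall_test hD (by positivity) ?_
    intro φ hφ hφc hφ2
    rw [integral_increment_mul hg hφ2]
    have hder : ∀ r : ℝ, HasDerivAt (fun r : ℝ => ∫ x, g x * φ (x - r • e))
        (∫ x, G x i * φ (x - r • e)) r := by
      intro r
      have h1 := hasDerivAt_integral_mul_comp_sub hgl (hφ.of_le (by simp)) hφc e r
      have h2 := hgG (fun x => φ (x - r • e)) (hφ.comp (contDiff_id.sub contDiff_const))
        (hφc.comp_homeomorph (Homeomorph.subRight (r • e))) i
      simp_rw [fderiv_comp_sub] at h2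
      rw [h2, neg_neg] at h1
      exact h1
    have hbd : ∀ r : ℝ, ‖∫ x, G x i * φ (x - r • e)‖ ≤ ‖hGi.toLp _‖ * ‖hφ2.toLp φ‖ := by
      intro r
      have hφr : MemLp (fun x => φ (x - r • e)) 2 volume := by
        simpa [sub_eq_add_neg] using memLp_comp_add hφ2 (-(r • e))
      rw [← inner_toLp hGi hφr]
      refine (norm_inner_le_norm _ _).trans_eq ?_
      congr 1
      rw [Lp.norm_toLp, Lp.norm_toLp]
      congr 1
      exact eLpNorm_comp_measurePreserving hφ2.1 (measurePreserving_sub_right volume (r • e))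
    have := Convex.norm_image_sub_le_of_norm_hasDerivWithin_le (x := 0) (y := t)
      (s := Set.univ) (fun r _ => (hder r).hasDerivWithinAt) (fun r _ => hbd r) convex_univ
      trivial trivial
    simp only [zero_smul, sub_zero, Real.norm_eq_abs, abs_of_nonneg ht] at this
    linarith
  rw [Lp.norm_toLp, Lp.norm_toLp] at main
  rw [hte, increment, ← ENNReal.ofReal_toReal hD.eLpNorm_ne_top,
    ← ENNReal.ofReal_toReal hGi.eLpNorm_ne_top, ← ENNReal.ofReal_mul ht]
  exact ENNReal.ofReal_le_ofReal main

/-- The difference quotients stay in a ball of radius k in L². Any weak limit as t → 0+ is a weak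
partial derivative, and it stays in the same ball, so the constant is not degraded. -/
theorem exists_weakPartial {f : Euc d → ℝ} (hf : MemLp f 2 volume) {h : ℝ} (hh : 0 < h)
    (i : Fin d) {k : ℝ} (hk : 0 ≤ k)
    (hD : ∀ t, 0 < t → t ≤ h →
      increment f (EuclideanSpace.single i t) ≤ ENNReal.ofReal (t * k)) :
    ∃ G : Euc d → ℝ, MemLp G 2 volume ∧ ∫ x, G x ^ 2 ≤ k ^ 2 ∧
      ∀ φ : Euc d → ℝ, ContDiff ℝ ∞ φ → HasCompactSupport φ →
        ∫ x, f x * fderiv ℝ φ x (EuclideanSpace.single i 1) = -∫ x, G x * φ x := by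
  set e : Euc d := EuclideanSpace.single i 1 with he
  have hte : ∀ t : ℝ, EuclideanSpace.single i t = t • e := fun t => by
    rw [he]; ext j; simp
  have hfl : LocallyIntegrable f volume := hf.locallyIntegrable (by norm_num)
  let q : ℝ → Lp ℝ 2 (volume : Measure (Euc d)) := fun t =>
    t⁻¹ • (memLp_increment hf (t • e)).toLp _
  have hq : ∀ t, 0 < t → t ≤ h → ‖q t‖ ≤ k := by
    intro t ht hth
    have h1 := hD t ht hth
    rw [hte, increment] at h1
    have h2 : ‖(memLp_increment hf (t • e)).toLp _‖ ≤ t * k := by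
      rw [Lp.norm_toLp]
      exact ENNReal.toReal_le_of_le_ofReal (by positivity) h1
    rw [norm_smul, norm_inv, Real.norm_of_nonneg ht.le, inv_mul_le_iff₀ ht]
    exact h2
  let Λ : ℝ → WeakDual ℝ (Lp ℝ 2 (volume : Measure (Euc d))) := fun t =>
    WeakDual.toStrongDual.symm (InnerProductSpace.toDual ℝ _ (q t))
  -- Weak-* compactness of the ball gives a limit along any ultrafilter finer than t → 0+, with no
  -- extraction of a subsequence.
  let U : Ultrafilter ℝ := Ultrafilter.of (𝓝[>] (0 : ℝ))
  have hU : (U : Filter ℝ) ≤ 𝓝[>] (0 : ℝ) := Ultrafilter.of_le _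
  have hcomp := WeakDual.isCompact_closedBall (𝕜 := ℝ)
    (0 : StrongDual ℝ (Lp ℝ 2 (volume : Measure (Euc d)))) k
  obtain ⟨Λ₀, hΛ₀, hlim⟩ := isCompact_iff_ultrafilter_le_nhds.1 hcomp (U.map Λ) (by
    rw [le_principal_iff]
    refine hU ?_
    filter_upwards [Ioc_mem_nhdsGT hh] with t ht
    simpa [Λ] using hq t ht.1 ht.2)
  let G' := (InnerProductSpace.toDual ℝ _).symm (WeakDual.toStrongDual Λ₀)
  have hG'k : ‖G'‖ ≤ k := by
    simpa [G'] using hΛ₀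
  refine ⟨G', Lp.memLp G', ?_, ?_⟩
  · have h1 : ∫ x, (G' x) ^ 2 = ‖G'‖ ^ 2 := by
      rw [← real_inner_self_eq_norm_sq, L2.inner_def]
      simp [sq]
    rw [h1]
    gcongr
  · intro φ hφ hφc
    have hφ2 : MemLp φ 2 volume := hφ.continuous.memLp_of_hasCompactSupport hφc
    have h1 : Tendsto (fun t => Λ t (hφ2.toLp φ)) U (𝓝 (Λ₀ (hφ2.toLp φ))) :=
      ((WeakDual.eval_continuous (hφ2.toLp φ)).tendsto Λ₀).comp hlim
    have h2 : Λ₀ (hφ2.toLp φ) = ∫ x, G' x * φ x := by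
      have : Λ₀ (hφ2.toLp φ) = inner ℝ G' (hφ2.toLp φ) := by
        simp [G']
      rw [this]
      have h3 := inner_toLp (Lp.memLp G') hφ2
      rwa [Lp.toLp_coeFn] at h3
    have h3 : ∀ t, Λ t (hφ2.toLp φ) =
        t⁻¹ * ((∫ x, f x * φ (x - t • e)) - ∫ x, f x * φ x) := by
      intro t
      rw [← integral_increment_mul hf hφ2, ← inner_toLp (memLp_increment hf (t • e)) hφ2,
        ← real_inner_smul_left]
      rfl
    have h4 := (hasDerivAt_integral_mul_comp_sub hfl (hφ.of_le (by simp)) hφc e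
      0).tendsto_slope_zero_right
    simp only [zero_add, zero_smul, sub_zero, smul_eq_mul] at h4
    have h5 := tendsto_nhds_unique h1 ((h4.mono_left hU).congr fun t => (h3 t).symm)
    rw [h2] at h5
    linarith

theorem exists_weakGradient {f : Euc d → ℝ} (hf : MemLp f 2 volume) {h : ℝ} (hh : 0 < h)
    {k : Fin d → ℝ} (hk : ∀ i, 0 ≤ k i)
    (hD : ∀ i, ∀ t, 0 < t → t ≤ h →
      increment f (EuclideanSpace.single i t) ≤ ENNReal.ofReal (t * k i)) :
    ∃ G : Euc d → Euc d, MemLp G 2 volume ∧ HasWeakGradient f G ∧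
      ∫ x, ‖G x‖ ^ 2 ≤ ∑ i, k i ^ 2 := by
  choose G hG hGk hGw using fun i => exists_weakPartial hf hh i (hk i) (hD i)
  refine ⟨fun x => WithLp.toLp 2 (fun i => G i x), MemLp.of_eval_piLp hG, ?_, ?_⟩
  · intro φ hφ hφc i
    exact hGw i φ hφ hφc
  · simp_rw [EuclideanSpace.norm_sq_eq, Real.norm_eq_abs, sq_abs]
    rw [integral_finsetSum _ fun i _ => (hG i).integrable_sq]
    exact Finset.sum_le_sum fun i _ => hGk i

end Sobolev

end VarConv
end

/-! ### Split potentials: stability of the energy under truncation. -/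

noncomputable section
namespace VarConv

/-- The density `a - b`, as a function of `w = g²`, splits into a bounded nondecreasing part `a`
and a part `b` with locally Lipschitz growth of order `1 + r`. -/
structure IsSplitDensity (a b : ℝ → ℝ) (r C A : ℝ) : Prop where
  a_meas : Measurable a
  b_meas : Measurable b
  a_zero : a 0 = 0
  a_mono : ∀ x y, 0 ≤ x → x ≤ y → a x ≤ a y
  a_le : ∀ x, 0 ≤ x → a x ≤ A
  a_scale : ∀ c x, 1 ≤ c → 0 ≤ x → a (c * x) ≤ c * a x
  a_small : (∀ x, 0 ≤ x → a x = 0) ∨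
    ∀ η : ℝ, 0 < η → ∃ ε > 0, ∀ x, 0 ≤ x → x ≤ ε → x ≤ η * a x
  b_zero : b 0 = 0
  b_lip : ∀ x y, 0 ≤ x → x ≤ y → |b y - b x| ≤ C * (y - x) * (1 + y ^ r)
  r_nonneg : 0 ≤ r
  C_nonneg : 0 ≤ C

namespace IsSplitDensity

variable {a b : ℝ → ℝ} {r C A : ℝ}

theorem a_nonneg (H : IsSplitDensity a b r C A) {x : ℝ} (hx : 0 ≤ x) : 0 ≤ a x := by
  rw [← H.a_zero]; exact H.a_mono 0 x le_rfl hx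

theorem A_nonneg (H : IsSplitDensity a b r C A) : 0 ≤ A :=
  (H.a_nonneg le_rfl).trans (H.a_le 0 le_rfl)

/-- Below height M the function b is Lipschitz with constant C(1 + M^r). Above it, y · y^r ≤ M^(r-s)
y^(1+s) because r < s. For large M the second term is thus a small multiple of the (1+s)-moments,
while the first is controlled by L¹ distance. -/
theorem abs_b_sub_le_of_le (H : IsSplitDensity a b r C A) {s M x y : ℝ} (hs : r < s) (hM : 1 ≤ M)
    (hx : 0 ≤ x) (hxy : x ≤ y) :
    |b y - b x| ≤ C * (1 + M ^ r) * |y - x| +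
      2 * C * M ^ (r - s) * (x ^ (1 + s) + y ^ (1 + s)) := by
  have hr := H.r_nonneg
  have hC := H.C_nonneg
  have hy : 0 ≤ y := hx.trans hxy
  have hlip := H.b_lip x y hx hxy
  rw [abs_of_nonneg (sub_nonneg.2 hxy)]
  have hxs : 0 ≤ x ^ (1 + s) := by positivity
  have hys : 0 ≤ y ^ (1 + s) := by positivity
  have hMr : 0 ≤ M ^ (r - s) := by positivity
  rcases le_or_gt y M with hyM | hyM
  · have h1 : y ^ r ≤ M ^ r := Real.rpow_le_rpow hy hyM hr
    have h2 : C * (y - x) * (1 + y ^ r) ≤ C * (1 + M ^ r) * (y - x) := by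
      have : C * (y - x) * (1 + y ^ r) ≤ C * (y - x) * (1 + M ^ r) :=
        mul_le_mul_of_nonneg_left (by linarith) (mul_nonneg hC (by linarith))
      linarith
    have : 0 ≤ 2 * C * M ^ (r - s) * (x ^ (1 + s) + y ^ (1 + s)) := by positivity
    linarith
  · have hy1 : 1 ≤ y := hM.trans hyM.le
    have hy0 : 0 < y := by linarith
    have h1 : 1 ≤ y ^ r := Real.one_le_rpow hy1 hr
    have h2 : y * y ^ r ≤ M ^ (r - s) * y ^ (1 + s) := by
      have e : y * y ^ r = y ^ (r - s) * y ^ (1 + s) := by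
        rw [← Real.rpow_add hy0, ← Real.rpow_one_add' hy (by linarith)]
        congr 1; ring
      rw [e]
      exact mul_le_mul_of_nonneg_right
        (Real.rpow_le_rpow_of_nonpos (by linarith) hyM.le (by linarith)) hys
    have h3 : C * (y - x) * (1 + y ^ r) ≤ C * (y * (2 * y ^ r)) := by
      rw [mul_assoc]
      refine mul_le_mul_of_nonneg_left ?_ hC
      exact mul_le_mul (by linarith) (by linarith) (by linarith) hy
    have h4 : C * (y * (2 * y ^ r)) ≤ 2 * C * (M ^ (r - s) * y ^ (1 + s)) := by
      have := mul_le_mul_of_nonneg_left h2 hC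
      linarith
    have h5 : 0 ≤ C * (1 + M ^ r) * (y - x) :=
      mul_nonneg (by positivity) (by linarith)
    have h6 : 0 ≤ 2 * C * M ^ (r - s) * x ^ (1 + s) := by positivity
    linarith

theorem abs_b_sub_le (H : IsSplitDensity a b r C A) {s M x y : ℝ} (hs : r < s) (hM : 1 ≤ M)
    (hx : 0 ≤ x) (hy : 0 ≤ y) :
    |b y - b x| ≤ C * (1 + M ^ r) * |y - x| +
      2 * C * M ^ (r - s) * (x ^ (1 + s) + y ^ (1 + s)) := by
  rcases le_total x y with h | h
  · exact H.abs_b_sub_le_of_le hs hM hx h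
  · have := H.abs_b_sub_le_of_le hs hM hy h
    rw [abs_sub_comm (b y), abs_sub_comm y, add_comm (x ^ (1 + s))]
    exact this

theorem abs_b_le (H : IsSplitDensity a b r C A) {s M x : ℝ} (hs : r < s) (hM : 1 ≤ M)
    (hx : 0 ≤ x) :
    |b x| ≤ C * (1 + M ^ r) * x + 2 * C * M ^ (r - s) * x ^ (1 + s) := by
  have h := H.abs_b_sub_le hs hM le_rfl hx
  have hr := H.r_nonneg
  rwa [H.b_zero, sub_zero, sub_zero, abs_of_nonneg hx, Real.zero_rpow (by linarith),
    zero_add] at h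

variable {α : Type*} [MeasurableSpace α] {μ : Measure α}

theorem integrable_b (H : IsSplitDensity a b r C A) {s : ℝ} (hs : r < s) {w : α → ℝ}
    (hw0 : ∀ x, 0 ≤ w x) (hw : Integrable w μ) (hws : Integrable (fun x => w x ^ (1 + s)) μ) :
    Integrable (fun x => b (w x)) μ := by
  refine Integrable.mono' ((hw.const_mul (C * (1 + (1 : ℝ) ^ r))).add
    (hws.const_mul (2 * C * (1 : ℝ) ^ (r - s))))
    (H.b_meas.comp_aemeasurable hw.aemeasurable).aestronglyMeasurable ?_
  exact Eventually.of_forall fun x => H.abs_b_le hs le_rfl (hw0 x)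

/-- The truncation level: small values of `w` are controlled by `a`, and cutting off at `ε` makes
`a` insensitive to `L²` perturbations. -/
theorem exists_truncation (H : IsSplitDensity a b r C A) {η : ℝ} (hη : 0 < η) :
    ∃ ε ≥ 0, ∃ P ≥ 0, (∀ x, 0 ≤ x → min x ε ^ 2 ≤ η * (a (x ^ 2) + x ^ 2)) ∧
      ∀ x y, 0 ≤ x → 0 ≤ y → a (max (y - ε) 0 ^ 2) ≤ a (x ^ 2) + P * (y - x) ^ 2 := by
  rcases H.a_small with h0 | hsm
  -- If a vanishes, no truncation is needed and ε = 0 works.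
  · refine ⟨0, le_rfl, 0, le_rfl, fun x hx => ?_, fun x y hx hy => ?_⟩
    · rw [min_eq_right hx, h0 _ (sq_nonneg x)]
      have : 0 ≤ η * x ^ 2 := by positivity
      simpa using this
    · rw [h0 _ (sq_nonneg _), h0 _ (sq_nonneg _)]; simp
  · obtain ⟨ε₀, hε₀, hε₀a⟩ := hsm η hη
    -- The level has ε² = η ε₀: when x² > ε₀ the cut-off part satisfies ε² ≤ η x², and otherwise the
    -- smallness of x² relative to a applies.
    have hε : 0 < √(η * ε₀) := Real.sqrt_pos.2 (by positivity)
    have hε2 : √(η * ε₀) ^ 2 = η * ε₀ := Real.sq_sqrt (by positivity)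
    have hA := H.A_nonneg
    refine ⟨√(η * ε₀), hε.le, A / (η * ε₀), by positivity, fun x hx => ?_, fun x y hx hy => ?_⟩
    · have ha := H.a_nonneg (sq_nonneg x)
      rcases le_or_gt (x ^ 2) ε₀ with h | h
      · have h1 := hε₀a _ (sq_nonneg x) h
        have h2 : min x √(η * ε₀) ^ 2 ≤ x ^ 2 :=
          pow_le_pow_left₀ (le_min hx hε.le) (min_le_left _ _) 2
        nlinarith [sq_nonneg x]
      · have h2 : min x √(η * ε₀) ^ 2 ≤ √(η * ε₀) ^ 2 :=
          pow_le_pow_left₀ (le_min hx hε.le) (min_le_right _ _) 2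
        rw [hε2] at h2
        nlinarith
    · have hmax : 0 ≤ max (y - √(η * ε₀)) 0 := le_max_right _ _
      -- Either the truncated value lies below x and monotonicity of a suffices, or y - x exceeds ε
      -- and the crude bound A is paid for by the quadratic term.
      rcases le_or_gt (y - √(η * ε₀)) x with h | h
      · have h1 : max (y - √(η * ε₀)) 0 ^ 2 ≤ x ^ 2 := pow_le_pow_left₀ hmax (max_le h hx) 2
        have h2 := H.a_mono _ _ (sq_nonneg _) h1
        have : 0 ≤ A / (η * ε₀) * (y - x) ^ 2 := by positivity
        linarith
      · have h1 : η * ε₀ ≤ (y - x) ^ 2 := by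
          rw [← hε2]; exact pow_le_pow_left₀ hε.le (by linarith) 2
        have h2 : A ≤ A / (η * ε₀) * (y - x) ^ 2 := by
          rw [div_mul_eq_mul_div, le_div_iff₀ (by positivity)]
          exact mul_le_mul_of_nonneg_left h1 hA
        have := H.a_le _ (sq_nonneg (max (y - √(η * ε₀)) 0))
        have := H.a_nonneg (sq_nonneg x)
        linarith

end IsSplitDensity

/-- The map t ↦ max (t - ε) 0 is 1-Lipschitz and moves x by exactly min x ε. -/
theorem sq_truncate_sub_le (x y ε : ℝ) :
    (max (y - ε) 0 - x) ^ 2 ≤ 2 * (y - x) ^ 2 + 2 * min x ε ^ 2 := by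
  have h1 : |max (y - ε) 0 - max (x - ε) 0| ≤ |y - x| := by
    have := abs_max_sub_max_le_abs (y - ε) (x - ε) 0
    simpa using this
  have h2 : max (x - ε) 0 = x - min x ε := by
    rcases le_total x ε with h | h
    · rw [min_eq_left h, max_eq_right (by linarith)]; ring
    · rw [min_eq_right h, max_eq_left (by linarith)]
  rw [h2] at h1
  have h3 := sq_le_sq.2 h1
  set u := max (y - ε) 0
  nlinarith [sq_nonneg ((u - (x - min x ε)) + min x ε)]

/-- Young's inequality for |y - x| |y + x| with weight τ. -/
theorem abs_sq_sub_sq_le {x y τ : ℝ} (hτ : 0 < τ) :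
    |y ^ 2 - x ^ 2| ≤ (y - x) ^ 2 / (2 * τ) + τ * (x ^ 2 + y ^ 2) := by
  have e : (y - x) ^ 2 / (2 * τ) + τ * (x ^ 2 + y ^ 2) =
    ((y - x) ^ 2 + 2 * τ ^ 2 * (x ^ 2 + y ^ 2)) / (2 * τ) := by field_simp
  rw [e, le_div_iff₀ (by positivity), ← abs_of_pos (show (0 : ℝ) < 2 * τ by positivity), ← abs_mul,
    abs_le]
  constructor <;>
  nlinarith [sq_nonneg ((y - x) - τ * (x + y)), sq_nonneg ((y - x) + τ * (x + y)),
    sq_nonneg (τ * (x - y))]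

set_option maxHeartbeats 2000000 in
/-- Two `L²`-close functions: after truncation and normalisation of the second one, its energy
density is at most that of the first one, up to a small error. -/
theorem IsSplitDensity.exists_truncated_approx {a b : ℝ → ℝ} {r C A s : ℝ}
    (H : IsSplitDensity a b r C A) (hs : r < s) {B η : ℝ} (hB : 0 ≤ B) (hη : 0 < η) :
    ∃ δ > 0, ∀ {α : Type} [MeasurableSpace α] (μ : Measure α) (g g' : α → ℝ),
      Measurable g → Measurable g' → (∀ x, 0 ≤ g x) → (∀ x, 0 ≤ g' x) →
      Integrable (fun x => g x ^ 2) μ → ∫ x, g x ^ 2 ∂μ = 1 →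
      Integrable (fun x => g' x ^ 2) μ → ∫ x, g' x ^ 2 ∂μ ≤ 1 →
      Integrable (fun x => (g x ^ 2) ^ (1 + s)) μ → ∫ x, (g x ^ 2) ^ (1 + s) ∂μ ≤ B →
      Integrable (fun x => (g' x ^ 2) ^ (1 + s)) μ → ∫ x, (g' x ^ 2) ^ (1 + s) ∂μ ≤ B →
      Integrable (fun x => a (g x ^ 2)) μ → ∫ x, a (g x ^ 2) ∂μ ≤ B →
      ∫ x, (g' x - g x) ^ 2 ∂μ ≤ δ →
      ∃ ε c : ℝ, 0 ≤ ε ∧ 1 ≤ c ∧ c ^ 2 ≤ 1 + η ∧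
        Integrable (fun x => (c * max (g' x - ε) 0) ^ 2) μ ∧
        ∫ x, (c * max (g' x - ε) 0) ^ 2 ∂μ = 1 ∧
        Integrable (fun x => a ((c * max (g' x - ε) 0) ^ 2)) μ ∧
        ∫ x, a ((c * max (g' x - ε) 0) ^ 2) ∂μ - ∫ x, b ((c * max (g' x - ε) 0) ^ 2) ∂μ ≤
          ∫ x, a (g x ^ 2) ∂μ - ∫ x, b (g x ^ 2) ∂μ + η := by
  have hr := H.r_nonneg
  have hC := H.C_nonneg
  have h1s : 0 < 1 + s := by linarith
  set T : ℝ := 2 * C * (B + 2 ^ (1 + s) * B) with hT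
  have hT0 : 0 ≤ T := by positivity
  obtain ⟨M, hM1, hM⟩ : ∃ M : ℝ, 1 ≤ M ∧ T * M ^ (r - s) ≤ η / 4 := by
    have h1 : Tendsto (fun M : ℝ => T * M ^ (-(s - r))) atTop (𝓝 (T * 0)) :=
      (tendsto_rpow_neg_atTop (by linarith : 0 < s - r)).const_mul T
    rw [mul_zero] at h1
    obtain ⟨M, h2, h3⟩ := ((h1.eventually (gt_mem_nhds (show 0 < η / 4 by positivity))).and
      (eventually_ge_atTop (1 : ℝ))).exists
    refine ⟨M, h3, ?_⟩
    rw [neg_sub] at h2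
    exact h2.le
  set L : ℝ := C * (1 + M ^ r) with hL
  have hL0 : 0 ≤ L := by positivity
  -- ζ will bound both the lost mass and the L¹ distance of the squares, so that c² ≤ 1 + 2ζ. The
  -- last three constraints pay for c² itself, for the Lipschitz part of b, and for the growth of ∫
  -- a under scaling.
  obtain ⟨ζ, hζ0, hζ1, hζη, hζL, hζB⟩ : ∃ ζ : ℝ, 0 < ζ ∧ ζ ≤ 1 / 2 ∧ 2 * ζ ≤ η ∧
      L * (2 * ζ) ≤ η / 4 ∧ 2 * ζ * B ≤ η / 8 := by
    refine ⟨min (1 / 2) (min (η / 2) (min (η / (8 * (L + 1))) (η / (16 * (B + 1))))),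
      by positivity, min_le_left _ _, ?_, ?_, ?_⟩
    · have := (min_le_right (1 / 2) (min (η / 2) (min (η / (8 * (L + 1)))
        (η / (16 * (B + 1)))))).trans (min_le_left _ _)
      linarith
    · have := (min_le_right (1 / 2) (min (η / 2) (min (η / (8 * (L + 1)))
        (η / (16 * (B + 1)))))).trans ((min_le_right _ _).trans (min_le_left _ _))
      rw [le_div_iff₀ (by positivity)] at this
      set z := min (1 / 2) (min (η / 2) (min (η / (8 * (L + 1))) (η / (16 * (B + 1)))))
      have : 0 < z := by positivity
      nlinarith
    · have := (min_le_right (1 / 2) (min (η / 2) (min (η / (8 * (L + 1)))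
        (η / (16 * (B + 1)))))).trans ((min_le_right _ _).trans (min_le_right _ _))
      rw [le_div_iff₀ (by positivity)] at this
      set z := min (1 / 2) (min (η / 2) (min (η / (8 * (L + 1))) (η / (16 * (B + 1)))))
      have : 0 < z := by positivity
      nlinarith
  -- Since ∫ a ≤ B and ∫ g² = 1, this parameter leaves at most ζ²/16 for the squared cut-off part.
  obtain ⟨ε, hε, P, hP, htr1, htr2⟩ := H.exists_truncation
    (η := ζ ^ 2 / (16 * (B + 1))) (by positivity)
  refine ⟨min (ζ ^ 2 / 16) (η / (16 * (P + 1))), by positivity, ?_⟩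
  intro α _ μ g g' hgm hg'm hg0 hg'0 hgi hg1 hg'i hg'1 hgs hgsB hg's hg'sB hag hagB hδ
  have hδ1 := hδ.trans (min_le_left _ _)
  have hδ2 := hδ.trans (min_le_right _ _)
  set f : α → ℝ := fun x => max (g' x - ε) 0 with hf
  have hfm : Measurable f := (hg'm.sub_const ε).max measurable_const
  have hf0 : ∀ x, 0 ≤ f x := fun x => le_max_right _ _
  have hfg' : ∀ x, f x ≤ g' x := fun x => max_le (by linarith) (hg'0 x)
  have hfsq : ∀ x, f x ^ 2 ≤ g' x ^ 2 := fun x => pow_le_pow_left₀ (hf0 x) (hfg' x) 2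
  have hfi : Integrable (fun x => f x ^ 2) μ :=
    hg'i.mono' (hfm.pow_const 2).aestronglyMeasurable
      (Eventually.of_forall fun x => by rw [Real.norm_of_nonneg (sq_nonneg _)]; exact hfsq x)
  have hfle : ∫ x, f x ^ 2 ∂μ ≤ 1 := (integral_mono hfi hg'i hfsq).trans hg'1
  have hdi : Integrable (fun x => (g' x - g x) ^ 2) μ := by
    refine ((hg'i.const_mul 2).add (hgi.const_mul 2)).mono'
      ((hg'm.sub hgm).pow_const 2).aestronglyMeasurable (Eventually.of_forall fun x => ?_)
    rw [Real.norm_of_nonneg (sq_nonneg _)]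
    simp only [Pi.add_apply]
    nlinarith [sq_nonneg (g' x + g x)]
  have hσpt : ∀ x, (f x - g x) ^ 2 ≤ 2 * (g' x - g x) ^ 2 +
      2 * (ζ ^ 2 / (16 * (B + 1)) * (a (g x ^ 2) + g x ^ 2)) := fun x =>
    (sq_truncate_sub_le (g x) (g' x) ε).trans (by linarith [htr1 (g x) (hg0 x)])
  have hσi : Integrable (fun x => (f x - g x) ^ 2) μ := by
    refine ((hfi.const_mul 2).add (hgi.const_mul 2)).mono'
      ((hfm.sub hgm).pow_const 2).aestronglyMeasurable (Eventually.of_forall fun x => ?_)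
    rw [Real.norm_of_nonneg (sq_nonneg _)]
    simp only [Pi.add_apply]
    nlinarith [sq_nonneg (f x + g x)]
  have hagg : Integrable (fun x => a (g x ^ 2) + g x ^ 2) μ := hag.add hgi
  have hgf : Integrable (fun x => g x ^ 2 + f x ^ 2) μ := hgi.add hfi
  have hσ : ∫ x, (f x - g x) ^ 2 ∂μ ≤ ζ ^ 2 / 4 := by
    have h1 := integral_mono hσi ((hdi.const_mul 2).add
      ((hagg.const_mul (ζ ^ 2 / (16 * (B + 1)))).const_mul 2)) hσpt
    have h2 : ∫ x, (2 * (g' x - g x) ^ 2 +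
      2 * (ζ ^ 2 / (16 * (B + 1)) * (a (g x ^ 2) + g x ^ 2))) ∂μ =
      2 * ∫ x, (g' x - g x) ^ 2 ∂μ +
        2 * (ζ ^ 2 / (16 * (B + 1)) * (∫ x, a (g x ^ 2) ∂μ + 1)) := by
      rw [integral_add (hdi.const_mul 2)
        ((hagg.const_mul (ζ ^ 2 / (16 * (B + 1)))).const_mul 2),
        integral_const_mul, integral_const_mul, integral_const_mul, integral_add hag hgi, hg1]
    have h3 : ζ ^ 2 / (16 * (B + 1)) * (∫ x, a (g x ^ 2) ∂μ + 1) ≤ ζ ^ 2 / 16 := by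
      rw [div_mul_eq_mul_div, div_le_div_iff₀ (by positivity) (by norm_num)]
      nlinarith [sq_nonneg ζ]
    have h4 := h1.trans_eq h2
    linarith
  have hDi : Integrable (fun x => |f x ^ 2 - g x ^ 2|) μ := (hfi.sub hgi).abs
  -- Young's weight ζ/4 balances the terms: the squared distance ζ²/4 contributes ζ/2, and the
  -- masses, both at most one, contribute ζ/2.
  have hD : ∫ x, |f x ^ 2 - g x ^ 2| ∂μ ≤ ζ := by
    have h1 := integral_mono hDi ((hσi.div_const (2 * (ζ / 4))).add
      (hgf.const_mul (ζ / 4)))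
      (fun x => abs_sq_sub_sq_le (x := g x) (y := f x) (show 0 < ζ / 4 by positivity))
    have h2 : ∫ x, ((f x - g x) ^ 2 / (2 * (ζ / 4)) + ζ / 4 * (g x ^ 2 + f x ^ 2)) ∂μ =
        (∫ x, (f x - g x) ^ 2 ∂μ) / (2 * (ζ / 4)) + ζ / 4 * (1 + ∫ x, f x ^ 2 ∂μ) := by
      rw [integral_add (hσi.div_const (2 * (ζ / 4))) (hgf.const_mul (ζ / 4)),
        integral_div, integral_const_mul, integral_add hgi hfi, hg1]
    have h3 : (∫ x, (f x - g x) ^ 2 ∂μ) / (2 * (ζ / 4)) ≤ ζ / 2 := by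
      rw [div_le_iff₀ (by positivity)]; nlinarith
    have h4 := h1.trans_eq h2
    nlinarith
  set m : ℝ := ∫ x, f x ^ 2 ∂μ with hm
  have hmζ : 1 - ζ ≤ m := by
    have h1 := (abs_integral_le_integral_abs (μ := μ) (f := fun x => f x ^ 2 - g x ^ 2)).trans hD
    rw [integral_sub hfi hgi, hg1] at h1
    linarith [(abs_le.1 h1).1]
  have hm0 : 0 < m := by linarith
  set c : ℝ := √(m⁻¹) with hc
  have hc2 : c ^ 2 = m⁻¹ := Real.sq_sqrt (by positivity)
  have hc21 : 1 ≤ c ^ 2 := by rw [hc2]; exact (one_le_inv₀ hm0).2 hfle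
  have hc1 : 1 ≤ c := by rw [hc]; exact Real.one_le_sqrt.2 (by rwa [← hc2])
  have hc2ζ : c ^ 2 ≤ 1 + 2 * ζ := by
    rw [hc2, inv_le_iff_one_le_mul₀ hm0]
    nlinarith
  have hcsq : ∀ x, (c * f x) ^ 2 = c ^ 2 * f x ^ 2 := fun x => mul_pow _ _ _
  have hFi : Integrable (fun x => (c * f x) ^ 2) μ := by
    simp_rw [hcsq]; exact hfi.const_mul _
  have hF1 : ∫ x, (c * f x) ^ 2 ∂μ = 1 := by
    simp_rw [hcsq]; rw [integral_const_mul, hc2]; exact inv_mul_cancel₀ hm0.ne'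
  -- Only an upper bound for a is required. Sublinearity of a under scaling handles c, and the
  -- truncation handles the discrepancy between g' and g.
  have hapt : ∀ x, a ((c * f x) ^ 2) ≤ c ^ 2 * (a (g x ^ 2) + P * (g' x - g x) ^ 2) := by
    intro x
    rw [hcsq]
    refine (H.a_scale _ _ hc21 (sq_nonneg _)).trans ?_
    exact mul_le_mul_of_nonneg_left (htr2 _ _ (hg0 x) (hg'0 x)) (by positivity)
  have habd : Integrable (fun x => c ^ 2 * (a (g x ^ 2) + P * (g' x - g x) ^ 2)) μ :=
    (hag.add (hdi.const_mul P)).const_mul _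
  have hai : Integrable (fun x => a ((c * f x) ^ 2)) μ := by
    refine habd.mono' (H.a_meas.comp ((hfm.const_mul c).pow_const 2)).aestronglyMeasurable
      (Eventually.of_forall fun x => ?_)
    rw [Real.norm_of_nonneg (H.a_nonneg (sq_nonneg _))]
    exact hapt x
  have hale : ∫ x, a ((c * f x) ^ 2) ∂μ ≤ ∫ x, a (g x ^ 2) ∂μ + η / 4 := by
    have h1 := integral_mono hai habd hapt
    rw [integral_const_mul, integral_add hag (hdi.const_mul P), integral_const_mul] at h1
    have h2 : P * ∫ x, (g' x - g x) ^ 2 ∂μ ≤ η / 16 := by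
      have h3 := mul_le_mul_of_nonneg_left hδ2 hP
      refine h3.trans ?_
      rw [mul_div_assoc', div_le_div_iff₀ (by positivity) (by norm_num)]
      nlinarith
    have h0 : 0 ≤ ∫ x, a (g x ^ 2) ∂μ := integral_nonneg fun x => H.a_nonneg (sq_nonneg _)
    have h0' : 0 ≤ P * ∫ x, (g' x - g x) ^ 2 ∂μ :=
      mul_nonneg hP (integral_nonneg fun x => sq_nonneg _)
    nlinarith
  have hFs : Integrable (fun x => ((c * f x) ^ 2) ^ (1 + s)) μ := by
    refine (hg's.const_mul ((c ^ 2) ^ (1 + s))).mono'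
      (((hfm.const_mul c).pow_const 2).pow_const _).aestronglyMeasurable
      (Eventually.of_forall fun x => ?_)
    rw [Real.norm_of_nonneg (by positivity), hcsq, Real.mul_rpow (by positivity) (by positivity)]
    have := Real.rpow_le_rpow (sq_nonneg _) (hfsq x) h1s.le
    gcongr
  have hFsB : ∫ x, ((c * f x) ^ 2) ^ (1 + s) ∂μ ≤ 2 ^ (1 + s) * B := by
    have h1 : ∀ x, ((c * f x) ^ 2) ^ (1 + s) ≤ 2 ^ (1 + s) * (g' x ^ 2) ^ (1 + s) := fun x => by
      rw [hcsq, Real.mul_rpow (by positivity) (by positivity)]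
      have h2 := Real.rpow_le_rpow (sq_nonneg _) (hfsq x) h1s.le
      have h3 := Real.rpow_le_rpow (sq_nonneg c) (show c ^ 2 ≤ 2 by linarith) h1s.le
      gcongr
    have h2 := integral_mono hFs (hg's.const_mul _) h1
    rw [integral_const_mul] at h2
    exact h2.trans (by gcongr)
  have hbg := H.integrable_b hs (fun x => sq_nonneg (g x)) hgi hgs
  have hbF := H.integrable_b hs (fun x => sq_nonneg (c * f x)) hFi hFs
  have hΔ : ∫ x, |(c * f x) ^ 2 - g x ^ 2| ∂μ ≤ 2 * ζ := by
    have h1 : ∀ x, |(c * f x) ^ 2 - g x ^ 2| ≤ (c ^ 2 - 1) * f x ^ 2 + |f x ^ 2 - g x ^ 2| := by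
      intro x
      rw [hcsq]
      have e : c ^ 2 * f x ^ 2 - g x ^ 2 = (c ^ 2 - 1) * f x ^ 2 + (f x ^ 2 - g x ^ 2) := by ring
      rw [e]
      refine (abs_add_le _ _).trans_eq ?_
      rw [abs_of_nonneg (mul_nonneg (by linarith) (sq_nonneg (f x)))]
    have h2 := integral_mono (hFi.sub hgi).abs ((hfi.const_mul (c ^ 2 - 1)).add hDi) h1
    simp only [Pi.add_apply] at h2
    rw [integral_add (hfi.const_mul (c ^ 2 - 1)) hDi, integral_const_mul] at h2
    have h3 : (c ^ 2 - 1) * m = 1 - m := by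
      rw [hc2, sub_mul, inv_mul_cancel₀ hm0.ne', one_mul]
    simp only [Pi.sub_apply] at h2
    rw [← hm, h3] at h2
    linarith
  have hble : |∫ x, b ((c * f x) ^ 2) ∂μ - ∫ x, b (g x ^ 2) ∂μ| ≤ η / 2 := by
    rw [← integral_sub hbF hbg]
    refine abs_integral_le_integral_abs.trans ?_
    have hgF : Integrable (fun x => (g x ^ 2) ^ (1 + s) + ((c * f x) ^ 2) ^ (1 + s)) μ :=
      hgs.add hFs
    have hΔi : Integrable (fun x => |(c * f x) ^ 2 - g x ^ 2|) μ := (hFi.sub hgi).abs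
    have h1 := integral_mono (hbF.sub hbg).abs ((hΔi.const_mul L).add
      (hgF.const_mul (2 * C * M ^ (r - s))))
      (fun x => H.abs_b_sub_le hs hM1 (sq_nonneg (g x)) (sq_nonneg (c * f x)))
    have h2 : ∫ x, (L * |(c * f x) ^ 2 - g x ^ 2| + 2 * C * M ^ (r - s) *
        ((g x ^ 2) ^ (1 + s) + ((c * f x) ^ 2) ^ (1 + s))) ∂μ =
        L * (∫ x, |(c * f x) ^ 2 - g x ^ 2| ∂μ) + 2 * C * M ^ (r - s) *
          (∫ x, (g x ^ 2) ^ (1 + s) ∂μ + ∫ x, ((c * f x) ^ 2) ^ (1 + s) ∂μ) := by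
      rw [integral_add (hΔi.const_mul L) (hgF.const_mul (2 * C * M ^ (r - s))),
        integral_const_mul, integral_const_mul, integral_add hgs hFs]
    refine (h1.trans_eq h2).trans ?_
    have h3 : L * (∫ x, |(c * f x) ^ 2 - g x ^ 2| ∂μ) ≤ η / 4 :=
      (mul_le_mul_of_nonneg_left hΔ hL0).trans hζL
    have h4 : 2 * C * M ^ (r - s) *
        (∫ x, (g x ^ 2) ^ (1 + s) ∂μ + ∫ x, ((c * f x) ^ 2) ^ (1 + s) ∂μ) ≤ T * M ^ (r - s) := by
      have : 2 * C * M ^ (r - s) * (B + 2 ^ (1 + s) * B) = T * M ^ (r - s) := by rw [hT]; ring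
      rw [← this]
      gcongr
    linarith
  refine ⟨ε, c, hε, hc1, by linarith, hFi, hF1, hai, ?_⟩
  have := (abs_le.1 hble).1
  linarith

/-- The Lipschitz part is dominated by any bound on a higher moment. -/
theorem IsSplitDensity.exists_abs_integral_b_le {a b : ℝ → ℝ} {r C A s : ℝ}
    (H : IsSplitDensity a b r C A) (hs : r < s) (N : ℝ) :
    ∃ C' : ℝ, 0 ≤ C' ∧ ∀ {α : Type} [MeasurableSpace α] (μ : Measure α) (w : α → ℝ) (K : ℝ),
      0 ≤ K → (∀ x, 0 ≤ w x) → Integrable w μ → ∫ x, w x ∂μ = 1 →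
      Integrable (fun x => w x ^ (1 + s)) μ → ∫ x, w x ^ (1 + s) ∂μ ≤ N * (1 + K) →
      |∫ x, b (w x) ∂μ| ≤ C' + K / 2 := by
  have hC := H.C_nonneg
  -- M is chosen so that the moment term costs at most (1 + K)/2; this is the source of the K/2.
  obtain ⟨M, hM1, hM⟩ : ∃ M : ℝ, 1 ≤ M ∧ 2 * C * N * M ^ (r - s) ≤ 1 / 2 := by
    have h1 : Tendsto (fun M : ℝ => 2 * C * N * M ^ (-(s - r))) atTop (𝓝 (2 * C * N * 0)) :=
      (tendsto_rpow_neg_atTop (by linarith : 0 < s - r)).const_mul _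
    rw [mul_zero] at h1
    obtain ⟨M, h2, h3⟩ := ((h1.eventually (gt_mem_nhds (show (0 : ℝ) < 1 / 2 by norm_num))).and
      (eventually_ge_atTop (1 : ℝ))).exists
    refine ⟨M, h3, ?_⟩
    rw [neg_sub] at h2
    exact h2.le
  refine ⟨C * (1 + M ^ r) + 1 / 2, by positivity, ?_⟩
  intro α _ μ w K hK hw0 hw hw1 hws hwN
  refine abs_integral_le_integral_abs.trans ?_
  have h1 := integral_mono (H.integrable_b hs hw0 hw hws).abs
    ((hw.const_mul (C * (1 + M ^ r))).add (hws.const_mul (2 * C * M ^ (r - s))))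
    (fun x => H.abs_b_le hs hM1 (hw0 x))
  simp only [Pi.add_apply] at h1
  rw [integral_add (hw.const_mul _) (hws.const_mul _), integral_const_mul, integral_const_mul,
    hw1] at h1
  refine h1.trans ?_
  have h2 : 2 * C * M ^ (r - s) * ∫ x, w x ^ (1 + s) ∂μ ≤ 2 * C * M ^ (r - s) * (N * (1 + K)) := by
    gcongr
  nlinarith

end VarConv
end

noncomputable section
namespace VarConv

/-! ### Calculus of L² increments. -/

section Increment

variable {d : ℕ}

theorem increment_add_le {g : Euc d → ℝ} (hg : AEStronglyMeasurable g volume) (v w : Euc d) :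
    increment g (v + w) ≤ increment g v + increment g w := by
  have hsh : ∀ u : Euc d, AEStronglyMeasurable (fun x => g (x + u)) volume := fun u =>
    hg.comp_measurePreserving (measurePreserving_add_right volume u)
  have e : (fun x => g (x + (v + w)) - g x) =
      (fun x => g (x + v + w) - g (x + v)) + fun x => g (x + v) - g x := by
    ext x; simp [add_assoc]
  rw [increment, e, add_comm (increment g v)]
  refine (eLpNorm_add_le ?_ ((hsh v).sub hg) (by norm_num)).trans_eq ?_
  · have := ((hsh w).sub hg).comp_measurePreserving (measurePreserving_add_right volume v)
    exact this
  · congr 1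
    exact eLpNorm_comp_measurePreserving (g := fun x => g (x + w) - g x) ((hsh w).sub hg)
      (measurePreserving_add_right volume v)

theorem increment_neg {g : Euc d → ℝ} (hg : AEStronglyMeasurable g volume) (v : Euc d) :
    increment g (-v) = increment g v := by
  have hsh : AEStronglyMeasurable (fun x => g (x + v)) volume :=
    hg.comp_measurePreserving (measurePreserving_add_right volume v)
  have h := eLpNorm_comp_measurePreserving (p := 2) (hsh.sub hg)
    (measurePreserving_add_right volume (-v))
  rw [increment, increment]
  change _ = eLpNorm ((fun x => g (x + v)) - g) 2 volume
  rw [← h]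
  refine eLpNorm_congr_norm_ae (Eventually.of_forall fun x => ?_)
  simp [norm_sub_rev]

theorem increment_zero (g : Euc d → ℝ) : increment g 0 = 0 := by
  simp [increment]

theorem increment_mono {f g : Euc d → ℝ} (h : ∀ x y, |f x - f y| ≤ |g x - g y|) (v : Euc d) :
    increment f v ≤ increment g v :=
  eLpNorm_mono fun x => by simpa using h (x + v) x

theorem increment_const_mul (c : ℝ) (g : Euc d → ℝ) (v : Euc d) :
    increment (fun x => c * g x) v = ‖c‖ₑ * increment g v := by
  rw [increment, increment, ← eLpNorm_const_smul]
  congr 1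
  ext x; simp [mul_sub]

theorem increment_congr_ae {f g : Euc d → ℝ} (h : f =ᵐ[volume] g) (v : Euc d) :
    increment f v = increment g v := by
  refine eLpNorm_congr_ae ?_
  have h2 := (measurePreserving_add_right volume v).quasiMeasurePreserving.ae_eq_comp h
  filter_upwards [h, h2] with x hx hx2
  simp only [Function.comp_apply] at hx2
  rw [hx, hx2]

/-- Increments of `g` over distances at most `ℓ` (in the sup norm) are at most `ℓ * k`. -/
def SlowAt (g : Euc d → ℝ) (ℓ k : ℝ) : Prop :=
  ∀ w : Euc d, (∀ i, |w i| ≤ ℓ) → increment g w ≤ ENNReal.ofReal (ℓ * k)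

/-- Move along the coordinate axes one after the other; negative steps cost as much as positive
ones. -/
theorem slowAt_of_coord {g : Euc d → ℝ} (hg : AEStronglyMeasurable g volume) {ℓ : ℝ}
    (hℓ : 0 ≤ ℓ) {k : Fin d → ℝ} (hk : ∀ i, 0 ≤ k i)
    (h : ∀ i s, 0 ≤ s → s ≤ ℓ →
      increment g (EuclideanSpace.single i s) ≤ ENNReal.ofReal (ℓ * k i)) :
    SlowAt g ℓ (∑ i, k i) := by
  intro w hw
  have hsum : ∀ S : Finset (Fin d), increment g (∑ i ∈ S, EuclideanSpace.single i (w i)) ≤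
      ∑ i ∈ S, ENNReal.ofReal (ℓ * k i) := by
    intro S
    induction S using Finset.induction_on with
    | empty => simp [increment_zero]
    | insert i S hi ih =>
      rw [Finset.sum_insert hi, Finset.sum_insert hi]
      refine (increment_add_le hg _ _).trans (add_le_add ?_ ih)
      rcases le_total 0 (w i) with h0 | h0
      · exact h i _ h0 ((le_abs_self _).trans (hw i))
      · have := h i (-w i) (by linarith) ((neg_le_abs _).trans (hw i))
        rwa [← increment_neg hg, show -EuclideanSpace.single i (-w i) =
          (EuclideanSpace.single i (w i) : Euc d) by ext j; simp; split_ifs <;> simp] at this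
  have hw' : w = ∑ i, EuclideanSpace.single i (w i) := by
    ext j; simp [Finset.sum_apply]
  rw [hw']
  refine (hsum Finset.univ).trans_eq ?_
  rw [Finset.mul_sum, ENNReal.ofReal_sum_of_nonneg fun i _ => mul_nonneg hℓ (hk i)]

end Increment

/-! ### Cubes, mesh points and mesh cells. -/

section Cube

variable {d : ℕ}

theorem volume_pi_set (I : Fin d → Set ℝ) :
    volume {x : Euc d | ∀ i, x i ∈ I i} = ∏ i, volume (I i) := by
  have h := (EuclideanSpace.volume_preserving_symm_measurableEquiv_toLp (Fin d)).measure_preimage_equiv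
    (Set.univ.pi I)
  rw [volume_pi_pi] at h
  rw [← h]
  congr 1
  ext x
  simp

/-- The half-open cube `[0, h)^d`. -/
def cube (d : ℕ) (h : ℝ) : Set (Euc d) := {x | ∀ i, x i ∈ Set.Ico 0 h}

theorem measurableSet_coord (I : Fin d → Set ℝ) (hI : ∀ i, MeasurableSet (I i)) :
    MeasurableSet {x : Euc d | ∀ i, x i ∈ I i} := by
  rw [Set.ofPred_forall]
  exact MeasurableSet.iInter fun i => (by fun_prop : Measurable fun x : Euc d => x i) (hI i)

theorem measurableSet_cube (h : ℝ) : MeasurableSet (cube d h) :=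
  measurableSet_coord _ fun _ => measurableSet_Ico

theorem volume_cube (h : ℝ) : volume (cube d h) = ENNReal.ofReal h ^ d := by
  rw [cube, volume_pi_set]
  simp

/-- The uniform probability measure on the cube `[0, h)^d`. -/
def cubeMeasure (d : ℕ) (h : ℝ) : Measure (Euc d) :=
  (ENNReal.ofReal h ^ d)⁻¹ • volume.restrict (cube d h)

theorem isProbabilityMeasure_cubeMeasure {h : ℝ} (hh : 0 < h) :
    IsProbabilityMeasure (cubeMeasure d h) := by
  constructor
  rw [cubeMeasure, Measure.smul_apply, Measure.restrict_apply_univ, volume_cube, smul_eq_mul]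
  exact ENNReal.inv_mul_cancel (by simp [hh]) (by simp)

/-- The lattice point `h z`. -/
def meshPoint (h : ℝ) (z : Fin d → ℤ) : Euc d := WithLp.toLp 2 fun i => h * z i

/-- The index of the mesh cell containing `x`. -/
def meshIndex (h : ℝ) (x : Euc d) : Fin d → ℤ := fun i => ⌊x i / h⌋

theorem measurable_meshIndex (h : ℝ) : Measurable (meshIndex h : Euc d → Fin d → ℤ) :=
  measurable_pi_lambda _ fun i => Int.measurable_floor.comp (by fun_prop)

theorem meshIndex_eq_iff {h : ℝ} (hh : 0 < h) (x : Euc d) (z : Fin d → ℤ) :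
    meshIndex h x = z ↔ x - meshPoint h z ∈ cube d h := by
  simp only [funext_iff, meshIndex, cube, Set.mem_ofPred_eq, Int.floor_eq_iff, meshPoint]
  refine forall_congr' fun i => ?_
  simp only [PiLp.sub_apply, Set.mem_Ico]
  rw [le_div_iff₀ hh, div_lt_iff₀ hh]
  constructor <;> rintro ⟨h1, h2⟩ <;> constructor <;> linarith

theorem meshIndex_meshPoint_add {h : ℝ} (hh : 0 < h) (z : Fin d → ℤ) {y : Euc d}
    (hy : y ∈ cube d h) : meshIndex h (meshPoint h z + y) = z := by
  rw [meshIndex_eq_iff hh]; simpa using hy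

theorem meshIndex_add_single {h : ℝ} (hh : 0 < h) (x : Euc d) (i : Fin d) :
    meshIndex h (x + EuclideanSpace.single i h) = meshIndex h x + Pi.single i 1 := by
  ext j
  simp only [meshIndex, PiLp.add_apply, PiLp.single_apply, Pi.add_apply, Pi.single_apply]
  split_ifs with hj
  · rw [add_div, div_self hh.ne', Int.floor_add_one]
  · simp

theorem meshPoint_add_single (h : ℝ) (z : Fin d → ℤ) (i : Fin d) :
    meshPoint h (z + Pi.single i 1) = meshPoint h z + EuclideanSpace.single i h := by
  ext j
  simp only [meshPoint, PiLp.add_apply, PiLp.single_apply, Pi.add_apply, Pi.single_apply]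
  split_ifs <;> simp [mul_add]

theorem lintegral_eq_tsum_cells {h : ℝ} (hh : 0 < h) (F : Euc d → ℝ≥0∞) :
    ∫⁻ x, F x = ∑' z : Fin d → ℤ, ∫⁻ y in cube d h, F (meshPoint h z + y) := by
  have hU : (⋃ z : Fin d → ℤ, meshIndex (d := d) h ⁻¹' {z}) = Set.univ := by
    ext x; simp
  rw [← setLIntegral_univ, ← hU, lintegral_iUnion]
  · refine tsum_congr fun z => ?_
    have h1 := (measurePreserving_add_left (volume : Measure (Euc d))
      (meshPoint h z)).setLIntegral_comp_preimage_emb (measurableEmbedding_addLeft _) F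
      (meshIndex h ⁻¹' {z})
    rw [← h1]
    congr 2
    ext y
    simp [meshIndex_eq_iff hh]
  · exact fun z => measurable_meshIndex h (measurableSet_singleton z)
  · intro z z' hzz
    exact Disjoint.preimage _ (by simpa using hzz)

end Cube

/-! ### Averages over cells and over moving cubes. -/

section Average

variable {d : ℕ}

theorem lintegral_cubeMeasure (h : ℝ) (F : Euc d → ℝ≥0∞) :
    ∫⁻ y, F y ∂(cubeMeasure d h) = (ENNReal.ofReal h ^ d)⁻¹ * ∫⁻ y in cube d h, F y := by
  rw [cubeMeasure, lintegral_smul_measure, smul_eq_mul]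

/-- `y ↦ θ x y` samples points so that the average over `x` and `y` is Lebesgue measure. -/
def IsSampling (h : ℝ) (θ : Euc d → Euc d → Euc d) : Prop :=
  Measurable (Function.uncurry θ) ∧
    ∀ F : Euc d → ℝ≥0∞, Measurable F → ∫⁻ x, ∫⁻ y, F (θ x y) ∂(cubeMeasure d h) = ∫⁻ x, F x

/-- The average of `g` over sampled points. -/
def sampleAvg (h : ℝ) (θ : Euc d → Euc d → Euc d) (g : Euc d → ℝ) (x : Euc d) : ℝ :=
  ∫ y, g (θ x y) ∂(cubeMeasure d h)

theorem measurable_sampleAvg {h : ℝ} (hh : 0 < h) {θ : Euc d → Euc d → Euc d}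
    (hθ : IsSampling h θ) {g : Euc d → ℝ} (hg : Measurable g) :
    Measurable (sampleAvg h θ g) := by
  have := isProbabilityMeasure_cubeMeasure (d := d) hh
  exact ((hg.comp hθ.1).stronglyMeasurable.integral_prod_right' (ν := cubeMeasure d h)).measurable

theorem sampleAvg_nonneg {h : ℝ} {θ : Euc d → Euc d → Euc d} {g : Euc d → ℝ}
    (hg : ∀ x, 0 ≤ g x) (x : Euc d) : 0 ≤ sampleAvg h θ g x :=
  integral_nonneg fun _ => hg _

theorem enorm_sampleAvg_rpow_le {h : ℝ} (hh : 0 < h) {θ : Euc d → Euc d → Euc d}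
    (hθ : Measurable (Function.uncurry θ)) {g : Euc d → ℝ} (hg : Measurable g) {q : ℝ}
    (hq : 1 ≤ q) (x : Euc d) :
    ‖sampleAvg h θ g x‖ₑ ^ q ≤ ∫⁻ y, ‖g (θ x y)‖ₑ ^ q ∂(cubeMeasure d h) := by
  have := isProbabilityMeasure_cubeMeasure (d := d) hh
  have h1 := enorm_integral_rpow_le (ν := cubeMeasure d h) (F := fun y => g (θ x y))
    (hg.comp (hθ.comp measurable_prodMk_left)).aestronglyMeasurable hq
  simpa [sampleAvg] using h1

theorem lintegral_sampleAvg_rpow_le {h : ℝ} (hh : 0 < h) {θ : Euc d → Euc d → Euc d}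
    (hθ : IsSampling h θ) {g : Euc d → ℝ} (hg : Measurable g) {q : ℝ} (hq : 1 ≤ q) :
    ∫⁻ x, ‖sampleAvg h θ g x‖ₑ ^ q ≤ ∫⁻ x, ‖g x‖ₑ ^ q := by
  rw [← hθ.2 _ (hg.enorm.pow_const q)]
  exact lintegral_mono fun x => enorm_sampleAvg_rpow_le hh hθ.1 hg hq x

theorem eLpNorm_sampleAvg_le {h : ℝ} (hh : 0 < h) {θ : Euc d → Euc d → Euc d}
    (hθ : IsSampling h θ) {g : Euc d → ℝ} (hg : Measurable g) :
    eLpNorm (sampleAvg h θ g) 2 volume ≤ eLpNorm g 2 volume := by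
  have := lintegral_sampleAvg_rpow_le hh hθ hg (q := 2) (by norm_num)
  simp only [ENNReal.rpow_ofNat] at this
  rw [← eLpNorm_two_sq, ← eLpNorm_two_sq] at this
  exact (ENNReal.pow_le_pow_left_iff two_ne_zero).1 this

theorem eLpNorm_sampleAvg_sub_sq_le {h : ℝ} (hh : 0 < h) {θ : Euc d → Euc d → Euc d}
    {g : Euc d → ℝ}
    (hint : ∀ x, Integrable (fun y => g (θ x y)) (cubeMeasure d h)) :
    eLpNorm (fun x => sampleAvg h θ g x - g x) 2 volume ^ 2 ≤
      ∫⁻ x, ∫⁻ y, ‖g (θ x y) - g x‖ₑ ^ 2 ∂(cubeMeasure d h) := by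
  have := isProbabilityMeasure_cubeMeasure (d := d) hh
  rw [eLpNorm_two_sq]
  refine lintegral_mono fun x => ?_
  have h1 := enorm_integral_rpow_le (ν := cubeMeasure d h) (F := fun y => g (θ x y) - g x)
    ((hint x).sub (integrable_const _)).aestronglyMeasurable (q := 2) (by norm_num)
  rw [integral_sub (hint x) (integrable_const _), integral_const] at h1
  simpa [sampleAvg] using h1

theorem integrable_cubeMeasure {h : ℝ} (hh : 0 < h) {F : Euc d → ℝ} (hF : MemLp F 2 volume) :
    Integrable F (cubeMeasure d h) := by
  have : IsFiniteMeasure (volume.restrict (cube d h)) := ⟨by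
    rw [Measure.restrict_apply_univ, volume_cube]; exact ENNReal.pow_lt_top ENNReal.ofReal_lt_top⟩
  refine Integrable.smul_measure ?_ (by simp [hh])
  exact (hF.restrict _).integrable (by norm_num)

/-- Sampling a uniform point of the mesh cell of `x`. -/
def cellSample (h : ℝ) (x y : Euc d) : Euc d := meshPoint h (meshIndex h x) + y

/-- Sampling a uniform point of the cube with upper corner `x`. -/
def cubeSample (x y : Euc d) : Euc d := x - y

/-- On a fixed cell the inner average does not depend on x, so the outer integral only contributes
the volume h^d, which cancels the normalisation. -/
theorem isSampling_cellSample {h : ℝ} (hh : 0 < h) :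
    IsSampling (d := d) h (cellSample h) := by
  have := isProbabilityMeasure_cubeMeasure (d := d) hh
  refine ⟨?_, fun F hF => ?_⟩
  · exact (((measurable_of_countable (meshPoint h)).comp (measurable_meshIndex h)).comp
      measurable_fst).add measurable_snd
  · rw [lintegral_eq_tsum_cells hh, lintegral_eq_tsum_cells hh]
    refine tsum_congr fun z => ?_
    have h1 : ∀ x ∈ cube d h, ∫⁻ y, F (cellSample h (meshPoint h z + x) y) ∂(cubeMeasure d h) =
        ∫⁻ y, F (meshPoint h z + y) ∂(cubeMeasure d h) := fun x hx => by
      simp only [cellSample, meshIndex_meshPoint_add hh z hx]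
    rw [setLIntegral_congr_fun (measurableSet_cube h) h1, setLIntegral_const, volume_cube,
      lintegral_cubeMeasure, mul_comm, ← mul_assoc,
      ENNReal.mul_inv_cancel (by simp [hh]) (by simp), one_mul]

theorem isSampling_cubeSample {h : ℝ} (hh : 0 < h) :
    IsSampling (d := d) h cubeSample := by
  have := isProbabilityMeasure_cubeMeasure (d := d) hh
  have hm : Measurable (Function.uncurry (cubeSample (d := d))) := measurable_fst.sub measurable_snd
  refine ⟨hm, fun F hF => ?_⟩
  have hFm : Measurable (Function.uncurry fun x y : Euc d => F (cubeSample x y)) := hF.comp hm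
  rw [lintegral_lintegral_swap hFm.aemeasurable]
  have h1 : ∀ y : Euc d, ∫⁻ x, F (cubeSample x y) = ∫⁻ x, F x := fun y =>
    lintegral_sub_right_eq_self F y
  simp_rw [h1]
  simp

theorem integrable_cellSample {h : ℝ} (hh : 0 < h) {g : Euc d → ℝ} (hg : MemLp g 2 volume)
    (x : Euc d) : Integrable (fun y => g (cellSample h x y)) (cubeMeasure d h) :=
  integrable_cubeMeasure hh (hg.comp_measurePreserving (measurePreserving_add_left volume _))

theorem integrable_cubeSample {h : ℝ} (hh : 0 < h) {g : Euc d → ℝ} (hg : MemLp g 2 volume)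
    (x : Euc d) : Integrable (fun y => g (cubeSample x y)) (cubeMeasure d h) :=
  integrable_cubeMeasure hh
    (hg.comp_measurePreserving (Measure.measurePreserving_sub_left volume x))

theorem lintegral_increment_sq (g : Euc d → ℝ) (w : Euc d) :
    ∫⁻ x, ‖g (x + w) - g x‖ₑ ^ 2 = increment g w ^ 2 := by
  rw [increment, eLpNorm_two_sq]

theorem eLpNorm_cubeAvg_sub_le {h k : ℝ} (hh : 0 < h) {g : Euc d → ℝ} (hgm : Measurable g)
    (hg : MemLp g 2 volume) (hs : SlowAt g h k) :
    eLpNorm (fun x => sampleAvg h cubeSample g x - g x) 2 volume ≤ ENNReal.ofReal (h * k) := by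
  have := isProbabilityMeasure_cubeMeasure (d := d) hh
  have h1 := eLpNorm_sampleAvg_sub_sq_le hh
    (integrable_cubeSample hh hg)
  refine (ENNReal.pow_le_pow_left_iff two_ne_zero).1 (h1.trans ?_)
  rw [lintegral_lintegral_swap]
  · have h2 : ∀ y ∈ cube d h, ∫⁻ x, ‖g (cubeSample x y) - g x‖ₑ ^ 2 ≤
        ENNReal.ofReal (h * k) ^ 2 := by
      intro y hy
      have h3 : ∀ x, g (cubeSample x y) = g (x + -y) := fun x => by
        rw [cubeSample, sub_eq_add_neg]
      simp_rw [h3]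
      rw [lintegral_increment_sq]
      have := hs (-y) fun i => by
        have := hy i
        simp only [PiLp.neg_apply, abs_neg]
        rw [abs_of_nonneg this.1]; exact this.2.le
      gcongr
    rw [lintegral_cubeMeasure]
    refine (mul_le_mul_right (setLIntegral_mono' (measurableSet_cube h) h2) _).trans_eq ?_
    rw [setLIntegral_const, volume_cube, mul_comm (ENNReal.ofReal (h * k) ^ 2), ← mul_assoc,
      ENNReal.inv_mul_cancel (by simp [hh]) (by simp), one_mul]
  · exact (((hgm.comp (isSampling_cubeSample hh).1).sub (hgm.comp measurable_fst)).enorm.pow_const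
      2).aemeasurable

/-- The displacement from x to its sampled point ranges over a cube depending on x, but always
inside (-h, h)^d. Enlarging to that fixed cube, of volume (2h)^d, permits Tonelli and costs the
factor 2^d. -/
theorem eLpNorm_cellAvg_sub_le {h k : ℝ} (hh : 0 < h) {g : Euc d → ℝ} (hgm : Measurable g)
    (hg : MemLp g 2 volume) (hs : SlowAt g h k) :
    eLpNorm (fun x => sampleAvg h (cellSample h) g x - g x) 2 volume ^ 2 ≤
      2 ^ d * ENNReal.ofReal (h * k) ^ 2 := by
  have := isProbabilityMeasure_cubeMeasure (d := d) hh
  refine (eLpNorm_sampleAvg_sub_sq_le hh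
    (integrable_cellSample hh hg)).trans ?_
  set Q : Set (Euc d) := {w | ∀ i, w i ∈ Set.Ioo (-h) h} with hQ
  have hQm : MeasurableSet Q := measurableSet_coord _ fun _ => measurableSet_Ioo
  have h1 : ∀ x, ∫⁻ y, ‖g (cellSample h x y) - g x‖ₑ ^ 2 ∂(cubeMeasure d h) ≤
      (ENNReal.ofReal h ^ d)⁻¹ * ∫⁻ w in Q, ‖g (x + w) - g x‖ₑ ^ 2 := by
    intro x
    rw [lintegral_cubeMeasure]
    refine mul_le_mul_right ?_ _
    set c : Euc d := meshPoint h (meshIndex h x) - x with hc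
    have hcx : -c ∈ cube d h := by
      rw [hc, neg_sub, ← meshIndex_eq_iff hh]
    have h2 := (measurePreserving_add_left (volume : Measure (Euc d))
      c).setLIntegral_comp_preimage_emb (measurableEmbedding_addLeft _)
      (fun w => ‖g (x + w) - g x‖ₑ ^ 2) Q
    rw [← h2]
    have h3 : ∀ y, cellSample h x y = x + (c + y) := fun y => by
      rw [cellSample, hc]; abel
    simp_rw [h3]
    refine lintegral_mono_set fun y hy i => ?_
    have h4 := hy i
    have h5 := hcx i
    simp only [PiLp.neg_apply, PiLp.add_apply, Set.mem_Ico, Set.mem_Ioo] at *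
    constructor <;> linarith
  refine (lintegral_mono h1).trans ?_
  rw [lintegral_const_mul', lintegral_lintegral_swap]
  · have h2 : ∀ w ∈ Q, ∫⁻ x, ‖g (x + w) - g x‖ₑ ^ 2 ≤ ENNReal.ofReal (h * k) ^ 2 := by
      intro w hw
      rw [lintegral_increment_sq]
      have := hs w fun i => (abs_lt.2 (hw i)).le
      gcongr
    refine (mul_le_mul_right (setLIntegral_mono' hQm h2) _).trans_eq ?_
    have h3 : volume Q = 2 ^ d * ENNReal.ofReal h ^ d := by
      rw [hQ, volume_pi_set]
      simp only [Real.volume_Ioo, Finset.prod_const, Finset.card_univ, Fintype.card_fin]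
      rw [← mul_pow, sub_neg_eq_add, ← two_mul, ENNReal.ofReal_mul (by norm_num)]
      simp
    rw [setLIntegral_const, h3, mul_comm (ENNReal.ofReal (h * k) ^ 2), ← mul_assoc,
      mul_comm (2 ^ d : ℝ≥0∞), ← mul_assoc,
      ENNReal.inv_mul_cancel (by simp [hh]) (by simp), one_mul]
  · refine Measurable.aemeasurable ?_
    have : Measurable fun p : Euc d × Euc d => g (p.1 + p.2) - g p.1 :=
      (hgm.comp (measurable_fst.add measurable_snd)).sub (hgm.comp measurable_fst)
    exact this.enorm.pow_const 2
  · simp [hh]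

/-- Translation by one mesh step commutes with cell averaging, and averaging contracts L². -/
theorem increment_cellAvg_le {h : ℝ} (hh : 0 < h) {g : Euc d → ℝ} (hgm : Measurable g)
    (hg : MemLp g 2 volume) (i : Fin d) :
    increment (sampleAvg h (cellSample h) g) (EuclideanSpace.single i h) ≤
      increment g (EuclideanSpace.single i h) := by
  set e : Euc d := EuclideanSpace.single i h with he
  have hge : Measurable fun x => g (x + e) - g x := (hgm.comp (measurable_add_const e)).sub hgm
  have h1 : (fun x => sampleAvg h (cellSample h) g (x + e) - sampleAvg h (cellSample h) g x) =
      sampleAvg h (cellSample h) (fun x => g (x + e) - g x) := by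
    ext x
    have h2 : ∀ y, cellSample h (x + e) y = cellSample h x y + e := fun y => by
      rw [cellSample, cellSample, he, meshIndex_add_single hh, meshPoint_add_single]; abel
    have h3 := integrable_cellSample hh hg (x + e)
    simp only [sampleAvg]
    simp_rw [h2] at h3 ⊢
    rw [← integral_sub h3 (integrable_cellSample hh hg x)]
  rw [increment, h1]
  exact eLpNorm_sampleAvg_le hh (isSampling_cellSample hh) hge

theorem setIntegral_comp_add {g : Euc d → ℝ} (v : Euc d) (R : Set (Euc d)) :
    ∫ y in (fun y => y + v) ⁻¹' R, g (y + v) = ∫ y in R, g y :=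
  (measurePreserving_add_right volume v).setIntegral_preimage_emb
    (measurableEmbedding_addRight v) g R

/-- Two cubes shifted by t ≤ h overlap, and the overlap cancels. What remains are two slabs of
thickness t that differ by a translation by h, so the difference is an integral of h-increments over
a fraction t/h of the cube. Hence the increments are linear in t, which is what makes the average
weakly differentiable. -/
theorem increment_cubeAvg_le {h t : ℝ} (hh : 0 < h) (ht : 0 < t) (hth : t ≤ h) {g : Euc d → ℝ}
    (hgm : Measurable g) (hg : MemLp g 2 volume) (i : Fin d) :
    increment (sampleAvg h cubeSample g) (EuclideanSpace.single i t) ≤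
      ENNReal.ofReal (t / h) * increment g (EuclideanSpace.single i h) := by
  set e : Euc d := EuclideanSpace.single i t with he
  set e' : Euc d := EuclideanSpace.single i (h - t) with he'
  have hee : e + e' = EuclideanSpace.single i h := by
    ext j; simp only [he, he', PiLp.add_apply, PiLp.single_apply]; split_ifs <;> ring
  set R : Set (Euc d) := cube d h ∩ {y | y i < t} with hR
  have hcoord : Measurable fun y : Euc d => y i := by fun_prop
  have hRi : MeasurableSet {y : Euc d | y i < t} := hcoord measurableSet_Iio
  have hPi : MeasurableSet {y : Euc d | y i < h - t} := hcoord measurableSet_Iio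
  have hRP : (fun y => y + e) ⁻¹' (cube d h \ {y | y i < t}) = cube d h ∩ {y | y i < h - t} := by
    ext y
    simp only [Set.mem_preimage, Set.mem_sdiff, Set.mem_inter_iff, cube, Set.mem_ofPred_eq, not_lt,
      Set.mem_Ico, he, PiLp.add_apply, PiLp.single_apply]
    constructor
    · rintro ⟨h1, h2⟩
      have h3 := h1 i
      simp only [if_true] at h2 h3
      refine ⟨fun j => ?_, by linarith⟩
      rcases eq_or_ne j i with rfl | hj
      · constructor <;> linarith
      · simpa [hj] using h1 j
    · rintro ⟨h1, h2⟩
      have h3 := h1 i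
      refine ⟨fun j => ?_, by simp only [if_true]; linarith⟩
      rcases eq_or_ne j i with rfl | hj
      · simp only [if_true]; constructor <;> linarith
      · simpa [hj] using h1 j
  have hPR : (fun y => y + e') ⁻¹' (cube d h \ {y | y i < h - t}) = R := by
    ext y
    simp only [hR, Set.mem_preimage, Set.mem_sdiff, Set.mem_inter_iff, cube, Set.mem_ofPred_eq,
      not_lt, Set.mem_Ico, he', PiLp.add_apply, PiLp.single_apply]
    constructor
    · rintro ⟨h1, h2⟩
      have h3 := h1 i
      simp only [if_true] at h2 h3
      refine ⟨fun j => ?_, by linarith⟩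
      rcases eq_or_ne j i with rfl | hj
      · constructor <;> linarith
      · simpa [hj] using h1 j
    · rintro ⟨h1, h2⟩
      have h3 := h1 i
      refine ⟨fun j => ?_, by simp only [if_true]; linarith⟩
      rcases eq_or_ne j i with rfl | hj
      · simp only [if_true]; constructor <;> linarith
      · simpa [hj] using h1 j
  have hfin : IsFiniteMeasure (volume.restrict (cube d h)) := ⟨by
    rw [Measure.restrict_apply_univ, volume_cube]; exact ENNReal.pow_lt_top ENNReal.ofReal_lt_top⟩
  have hRfin : IsFiniteMeasure (volume.restrict R) :=
    isFiniteMeasure_of_le _ (Measure.restrict_mono Set.inter_subset_left le_rfl)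
  have hInt : ∀ x : Euc d, IntegrableOn (fun y => g (x - y)) (cube d h) := fun x =>
    ((hg.comp_measurePreserving (Measure.measurePreserving_sub_left volume x)).restrict
      _).integrable (by norm_num)
  -- Each cube integral is split into its slab and the common part; `hRP` and `hPR` match the common
  -- parts and the slabs under translation.
  have key : ∀ x, (∫ y in cube d h, g (x + e - y)) - ∫ y in cube d h, g (x - y) =
      ∫ y in R, (g (x + e - y) - g (x - (y + e'))) := by
    intro x
    rw [← integral_inter_add_sdiff hRi (hInt (x + e)), ← integral_inter_add_sdiff hPi (hInt x),
      ← setIntegral_comp_add (g := fun y => g (x + e - y)) e (cube d h \ _), hRP,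
      ← setIntegral_comp_add (g := fun y => g (x - y)) e' (cube d h \ _), hPR, integral_sub]
    · have : ∀ y, x + e - (y + e) = x - y := fun y => by abel
      simp_rw [this]
      ring
    · exact (hInt (x + e)).mono_set Set.inter_subset_left
    · have := (hInt (x - e')).mono_set (Set.inter_subset_left (s := cube d h) (t := {y | y i < t}))
      refine this.congr (Eventually.of_forall fun y => ?_)
      simp only
      congr 1; abel
  have hvol : volume R = ENNReal.ofReal (t / h) * ENNReal.ofReal h ^ d := by
    have : R = {y : Euc d | ∀ j, y j ∈ if j = i then Set.Ico 0 t else Set.Ico 0 h} := by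
      ext y
      simp only [hR, Set.mem_inter_iff, cube, Set.mem_ofPred_eq]
      constructor
      · rintro ⟨h1, h2⟩ j
        split_ifs with hj
        · subst hj; exact ⟨(h1 j).1, h2⟩
        · exact h1 j
      · intro h1
        have h3 := h1 i
        simp only [if_true, Set.mem_Ico] at h3
        refine ⟨fun j => ?_, h3.2⟩
        rcases eq_or_ne j i with rfl | hj
        · exact ⟨h3.1, h3.2.trans_le hth⟩
        · simpa [hj] using h1 j
    rw [this, volume_pi_set]
    have h4 : ∀ j : Fin d, volume (if j = i then Set.Ico 0 t else Set.Ico 0 h) =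
        (if j = i then ENNReal.ofReal (t / h) else 1) * ENNReal.ofReal h := fun j => by
      split_ifs
      · rw [← ENNReal.ofReal_mul (by positivity), div_mul_cancel₀ _ hh.ne']; simp
      · simp
    simp_rw [h4]
    rw [Finset.prod_mul_distrib]
    simp
  have hS : ∀ x, sampleAvg h cubeSample g (x + e) - sampleAvg h cubeSample g x =
      ((ENNReal.ofReal h ^ d)⁻¹).toReal * ∫ y in R, (g (x + e - y) - g (x - (y + e'))) := by
    intro x
    rw [← key, mul_sub]
    simp only [sampleAvg, cubeSample, cubeMeasure, integral_smul_measure, smul_eq_mul]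
  rw [increment]
  simp_rw [hS]
  have h5 : eLpNorm (fun x => ∫ y in R, (g (x + e - y) - g (x - (y + e')))) 2 volume ≤
      volume.restrict R Set.univ * increment g (EuclideanSpace.single i h) := by
    refine eLpNorm_integral_comp_le ?_ (Eventually.of_forall fun y => le_of_eq ?_)
    · refine (hgm.comp ?_).sub (hgm.comp ?_)
      · exact (measurable_fst.add_const e).sub measurable_snd
      · exact measurable_fst.sub (measurable_snd.add_const e')
    · have h6 := eLpNorm_comp_measurePreserving (p := 2)
        (g := fun x => g (x + (e + e')) - g x)
        (((hgm.comp (measurable_add_const (e + e'))).sub hgm).aestronglyMeasurable)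
        (measurePreserving_sub_right volume (y + e'))
      rw [increment, ← hee, ← h6]
      congr 1
      ext x
      simp only [Function.comp_apply]
      congr 2; abel
  have h7 := eLpNorm_const_smul (p := 2) (μ := (volume : Measure (Euc d)))
    (((ENNReal.ofReal h ^ d)⁻¹).toReal)
    (fun x => ∫ y in R, (g (x + e - y) - g (x - (y + e'))))
  change eLpNorm (((ENNReal.ofReal h ^ d)⁻¹).toReal •
    fun x => ∫ y in R, (g (x + e - y) - g (x - (y + e')))) 2 volume ≤ _
  rw [h7]
  refine (mul_le_mul_right h5 _).trans_eq ?_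
  rw [Measure.restrict_apply_univ, hvol, Real.enorm_of_nonneg ENNReal.toReal_nonneg,
    ENNReal.ofReal_toReal (by simp [hh]), ← mul_assoc, mul_comm (ENNReal.ofReal (t / h)),
    ← mul_assoc, ENNReal.inv_mul_cancel (by simp [hh]) (by simp), one_mul]

end Average

end VarConv
end

noncomputable section
namespace VarConv

/-! ### A moment bound valid for H¹ functions and step functions alike. -/

section GagliardoNirenberg

variable {d : ℕ}

theorem abs_cellAvg_le {ℓ : ℝ} (hℓ : 0 < ℓ) {g : Euc d → ℝ} (hgm : Measurable g)
    (hg1 : eLpNorm g 2 volume ≤ 1) (x : Euc d) :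
    |sampleAvg ℓ (cellSample ℓ) g x| ≤ (√(ℓ ^ d))⁻¹ := by
  have h1 := enorm_sampleAvg_rpow_le hℓ (isSampling_cellSample hℓ).1 hgm (q := 2) (by norm_num) x
  simp only [ENNReal.rpow_ofNat] at h1
  rw [lintegral_cubeMeasure] at h1
  have h2 : ∫⁻ y in cube d ℓ, ‖g (cellSample ℓ x y)‖ₑ ^ 2 ≤ 1 := by
    calc ∫⁻ y in cube d ℓ, ‖g (cellSample ℓ x y)‖ₑ ^ 2
        ≤ ∫⁻ y, ‖g (meshPoint ℓ (meshIndex ℓ x) + y)‖ₑ ^ 2 := setLIntegral_le_lintegral _ _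
      _ = ∫⁻ y, ‖g y‖ₑ ^ 2 :=
          lintegral_add_left_eq_self (fun y => ‖g y‖ₑ ^ 2) _
      _ = eLpNorm g 2 volume ^ 2 := (eLpNorm_two_sq _ _).symm
      _ ≤ 1 := pow_le_one₀ zero_le hg1
  have h3 := h1.trans (mul_le_mul_right h2 _)
  rw [mul_one, enorm_sq_eq_ofReal, ← ENNReal.ofReal_pow hℓ.le,
    ← ENNReal.ofReal_inv_of_pos (by positivity),
    ENNReal.ofReal_le_ofReal_iff (by positivity)] at h3
  have h4 := Real.abs_le_sqrt h3
  rwa [Real.sqrt_inv] at h4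

/-- At every scale `ℓ`, `g` is either bounded by `ℓ^(-d/2)` or varies slowly. -/
def BoundedOrSlow (g : Euc d → ℝ) (k : ℝ) : Prop :=
  ∀ ℓ : ℝ, 0 < ℓ → (∀ x, g x ≤ (√(ℓ ^ d))⁻¹) ∨ SlowAt g ℓ k

/-- Weak-type estimate. At a scale where cell averages are at most t/2, a point with g > t has g at
distance at least t/2 from its average, and Chebyshev bounds the measure of such points if g varies
slowly at that scale. -/
theorem volume_lt_le (hd : 1 ≤ d) {g : Euc d → ℝ} (hgm : Measurable g)
    (hg : MemLp g 2 volume) (hg1 : eLpNorm g 2 volume ≤ 1) {k : ℝ}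
    (hgk : BoundedOrSlow g k) {t : ℝ} (ht : 0 < t) :
    volume {x | t < g x} ≤ ENNReal.ofReal
      (2 ^ (d + 2) * (2 : ℝ) ^ (4 / (d : ℝ)) * k ^ 2 * t ^ (-2 - 4 / (d : ℝ))) := by
  have hd0 : (0 : ℝ) < d := by exact_mod_cast hd
  -- The scale for which ℓ^(-d/2) = t/2; if g is bounded by this value, the level set is empty.
  set ℓ : ℝ := (2 / t) ^ (2 / (d : ℝ)) with hℓdef
  have hℓ : 0 < ℓ := by positivity
  have hℓd : √(ℓ ^ d) = 2 / t := by
    rw [hℓdef, ← Real.rpow_natCast, ← Real.rpow_mul (by positivity), div_mul_cancel₀ _ hd0.ne',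
      Real.rpow_two, Real.sqrt_sq (by positivity)]
  rcases hgk ℓ hℓ with hb | hsl
  · have : {x | t < g x} = ∅ := by
      ext x
      have := hb x
      rw [hℓd, inv_div] at this
      simp only [Set.mem_ofPred_eq, Set.mem_empty_iff_false, iff_false, not_lt]
      linarith
    simp [this]
  · have h1 := eLpNorm_cellAvg_sub_le hℓ hgm hg hsl
    rw [eLpNorm_two_sq] at h1
    simp_rw [enorm_sq_eq_ofReal] at h1
    have hm : Measurable (sampleAvg ℓ (cellSample ℓ) g) :=
      measurable_sampleAvg hℓ (isSampling_cellSample hℓ) hgm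
    have hcheb := mul_meas_ge_le_lintegral (μ := (volume : Measure (Euc d)))
      (f := fun x => ENNReal.ofReal ((sampleAvg ℓ (cellSample ℓ) g x - g x) ^ 2))
      ((hm.sub hgm).pow_const 2).ennreal_ofReal (ENNReal.ofReal ((t / 2) ^ 2))
    have hsub : {x | t < g x} ⊆ {x | ENNReal.ofReal ((t / 2) ^ 2) ≤
        ENNReal.ofReal ((sampleAvg ℓ (cellSample ℓ) g x - g x) ^ 2)} := by
      intro x hx
      simp only [Set.mem_ofPred_eq] at hx ⊢
      refine ENNReal.ofReal_le_ofReal ?_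
      have h2 := abs_cellAvg_le hℓ hgm hg1 x
      rw [hℓd, inv_div] at h2
      have h3 := (abs_le.1 h2).2
      nlinarith
    have h4 : ENNReal.ofReal ((t / 2) ^ 2) * volume {x | t < g x} ≤
        2 ^ d * ENNReal.ofReal (ℓ * k) ^ 2 :=
      (mul_le_mul_right (measure_mono hsub) _).trans (hcheb.trans h1)
    have h5 : (2 : ℝ≥0∞) ^ d * ENNReal.ofReal (ℓ * k) ^ 2 ≤
        ENNReal.ofReal (2 ^ d * (ℓ * k) ^ 2) := by
      rw [ENNReal.ofReal_mul (show (0 : ℝ) ≤ 2 ^ d by positivity), ← sq_abs (ℓ * k), ENNReal.ofReal_pow (abs_nonneg _)]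
      gcongr
      · simp
      · exact le_abs_self _
    have h6 := h4.trans h5
    rw [mul_comm, ← ENNReal.le_div_iff_mul_le (Or.inl (ENNReal.ofReal_pos.2 (by positivity)).ne') (by simp),
      ← ENNReal.ofReal_div_of_pos (by positivity)] at h6
    refine h6.trans_eq ?_
    congr 1
    have h7 : ℓ ^ 2 = 2 ^ (4 / (d : ℝ)) * t ^ (-(4 / (d : ℝ))) := by
      have e : 2 / (d : ℝ) * ((2 : ℕ) : ℝ) = 4 / d := by push_cast; ring
      rw [hℓdef, ← Real.rpow_natCast, ← Real.rpow_mul (by positivity), e,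
        Real.div_rpow (by norm_num) ht.le, Real.rpow_neg ht.le, div_eq_mul_inv]
    have h8 : t ^ (-2 - 4 / (d : ℝ)) = t ^ (-(4 / (d : ℝ))) / t ^ 2 := by
      rw [sub_eq_add_neg, add_comm, Real.rpow_add ht, Real.rpow_neg ht.le 2, Real.rpow_two]
      rfl
    rw [h8, mul_pow, h7]
    field_simp
    ring

theorem volume_lt_le_of_eLpNorm {g : Euc d → ℝ} (hgm : Measurable g)
    (hg1 : eLpNorm g 2 volume ≤ 1) {t : ℝ} (ht : 0 < t) :
    volume {x | t < g x} ≤ ENNReal.ofReal (t ^ (-2 : ℝ)) := by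
  have hcheb := mul_meas_ge_le_lintegral (μ := (volume : Measure (Euc d)))
    (f := fun x => ‖g x‖ₑ ^ 2) (hgm.enorm.pow_const 2) (ENNReal.ofReal (t ^ 2))
  rw [← eLpNorm_two_sq] at hcheb
  have hsub : {x | t < g x} ⊆ {x | ENNReal.ofReal (t ^ 2) ≤ ‖g x‖ₑ ^ 2} := by
    intro x hx
    simp only [Set.mem_ofPred_eq] at hx ⊢
    rw [enorm_sq_eq_ofReal]
    exact ENNReal.ofReal_le_ofReal (pow_le_pow_left₀ ht.le hx.le 2)
  have h4 := (mul_le_mul_right (measure_mono hsub) _).trans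
    (hcheb.trans (pow_le_one₀ zero_le hg1))
  rw [mul_comm, ← ENNReal.le_div_iff_mul_le (Or.inl (ENNReal.ofReal_pos.2 (by positivity)).ne') (by simp), one_div,
    ← ENNReal.ofReal_inv_of_pos (by positivity)] at h4
  refine h4.trans_eq ?_
  rw [Real.rpow_neg ht.le, Real.rpow_two]

/-- Layer-cake formula with exponent 2(1+s): the level sets are bounded by t^(-2) for t ≤ 1 and by a
multiple of k² t^(-2-4/d) for t > 1. The integrals converge at 0 because s > 0 and at infinity
because s < 2/d. -/
theorem exists_moment_bound (hd : 1 ≤ d) {s : ℝ} (hs : 0 < s) (hsd : s < 2 / (d : ℝ)) :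
    ∃ N : ℝ, 0 ≤ N ∧ ∀ (g : Euc d → ℝ) (k : ℝ), Measurable g → (∀ x, 0 ≤ g x) →
      MemLp g 2 volume → eLpNorm g 2 volume ≤ 1 → BoundedOrSlow g k →
      Integrable (fun x => (g x ^ 2) ^ (1 + s)) volume ∧
        ∫ x, (g x ^ 2) ^ (1 + s) ≤ N * (1 + k ^ 2) := by
  have hd0 : (0 : ℝ) < d := by exact_mod_cast hd
  set p : ℝ := 2 * (1 + s) with hp
  set c : ℝ := 2 ^ (d + 2) * (2 : ℝ) ^ (4 / (d : ℝ)) with hc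
  have hi1 : IntegrableOn (fun t : ℝ => t ^ (2 * s - 1)) (Set.Ioc 0 1) := by
    have := intervalIntegral.intervalIntegrable_rpow' (a := 0) (b := 1)
      (show -1 < 2 * s - 1 by linarith)
    rwa [intervalIntegrable_iff_integrableOn_Ioc_of_le zero_le_one] at this
  have hexp : 2 * s - 1 - 4 / (d : ℝ) < -1 := by
    have : 4 / (d : ℝ) = 2 * (2 / d) := by ring
    linarith
  have hi2 : IntegrableOn (fun t : ℝ => t ^ (2 * s - 1 - 4 / (d : ℝ))) (Set.Ioi 1) :=
    integrableOn_Ioi_rpow_of_lt hexp one_pos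
  set I₁ := ∫ t in Set.Ioc (0 : ℝ) 1, t ^ (2 * s - 1) with hI₁
  set I₂ := ∫ t in Set.Ioi (1 : ℝ), t ^ (2 * s - 1 - 4 / (d : ℝ)) with hI₂
  have hI₁0 : 0 ≤ I₁ := setIntegral_nonneg measurableSet_Ioc fun t ht =>
    Real.rpow_nonneg ht.1.le _
  have hI₂0 : 0 ≤ I₂ := setIntegral_nonneg measurableSet_Ioi fun t ht =>
    Real.rpow_nonneg (zero_le_one.trans (le_of_lt ht)) _
  refine ⟨p * (I₁ + c * I₂), by positivity, ?_⟩
  intro g k hgm hg0 hg hg1 hgk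
  have hpow : ∀ x, (g x ^ 2) ^ (1 + s) = g x ^ p := fun x => by
    rw [hp, ← Real.rpow_two, ← Real.rpow_mul (hg0 x)]
  have hlay := lintegral_rpow_eq_lintegral_meas_lt_mul (μ := (volume : Measure (Euc d)))
    (Eventually.of_forall hg0) hgm.aemeasurable (p := p) (by positivity)
  have hb1 : ∫⁻ t in Set.Ioc (0 : ℝ) 1, volume {x | t < g x} * ENNReal.ofReal (t ^ (p - 1)) ≤
      ENNReal.ofReal I₁ := by
    rw [hI₁, ofReal_integral_eq_lintegral_ofReal hi1 ((ae_restrict_mem measurableSet_Ioc).mono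
      fun t ht => Real.rpow_nonneg ht.1.le _)]
    refine setLIntegral_mono' measurableSet_Ioc fun t ht => ?_
    refine (mul_le_mul_left (volume_lt_le_of_eLpNorm hgm hg1 ht.1) _).trans_eq ?_
    rw [← ENNReal.ofReal_mul (Real.rpow_nonneg ht.1.le _), ← Real.rpow_add ht.1]
    congr 2; rw [hp]; ring
  have hb2 : ∫⁻ t in Set.Ioi (1 : ℝ), volume {x | t < g x} * ENNReal.ofReal (t ^ (p - 1)) ≤
      ENNReal.ofReal (c * k ^ 2 * I₂) := by
    rw [hI₂, ← integral_const_mul, ofReal_integral_eq_lintegral_ofReal (hi2.const_mul _)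
      ((ae_restrict_mem measurableSet_Ioi).mono
      fun t ht => mul_nonneg (by positivity) (Real.rpow_nonneg (zero_le_one.trans (le_of_lt ht)) _))]
    refine setLIntegral_mono' measurableSet_Ioi fun t ht => ?_
    have ht0 : 0 < t := zero_lt_one.trans ht
    refine (mul_le_mul_left (volume_lt_le hd hgm hg hg1 hgk ht0) _).trans_eq ?_
    rw [← ENNReal.ofReal_mul (by positivity), mul_assoc (c * k ^ 2), ← Real.rpow_add ht0]
    congr 3; rw [hp]; ring
  have hbd : ∫⁻ x, ENNReal.ofReal (g x ^ p) ≤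
      ENNReal.ofReal (p * (I₁ + c * I₂) * (1 + k ^ 2)) := by
    rw [hlay, ← Set.Ioc_union_Ioi_eq_Ioi (zero_le_one' ℝ),
      lintegral_union measurableSet_Ioi (Set.Ioc_disjoint_Ioi le_rfl)]
    refine (mul_le_mul_right (add_le_add hb1 hb2) _).trans ?_
    rw [← ENNReal.ofReal_add hI₁0 (by positivity), ← ENNReal.ofReal_mul (by positivity)]
    refine ENNReal.ofReal_le_ofReal ?_
    rw [mul_assoc p (I₁ + c * I₂)]
    have h0 : 0 ≤ p := by positivity
    refine mul_le_mul_of_nonneg_left ?_ h0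
    have h1 : 0 ≤ c * I₂ := by positivity
    have h2 : 0 ≤ I₁ * k ^ 2 := by positivity
    nlinarith
  simp_rw [hpow]
  have hi : Integrable (fun x => g x ^ p) volume := by
    refine ⟨(hgm.pow_const p).aestronglyMeasurable, ?_⟩
    rw [hasFiniteIntegral_iff_ofReal (Eventually.of_forall fun x => Real.rpow_nonneg (hg0 x) p)]
    exact hbd.trans_lt ENNReal.ofReal_lt_top
  refine ⟨hi, ?_⟩
  rw [← ENNReal.ofReal_le_ofReal_iff (by positivity),
    ofReal_integral_eq_lintegral_ofReal hi (Eventually.of_forall fun x => Real.rpow_nonneg (hg0 x) p)]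
  exact hbd

end GagliardoNirenberg

end VarConv
end

noncomputable section
namespace VarConv

/-! ### Step functions: integrals as lattice sums, and slow variation. -/

section StepFunctions

variable {d : ℕ}

/-- The step function of mesh `h` with values `u`. -/
def stepFun (h : ℝ) (u : (Fin d → ℤ) → ℝ) (x : Euc d) : ℝ := u (meshIndex h x)

theorem measurable_stepFun (h : ℝ) (u : (Fin d → ℤ) → ℝ) : Measurable (stepFun h u) :=
  (measurable_of_countable u).comp (measurable_meshIndex h)

theorem map_meshIndex {h : ℝ} (hh : 0 < h) :
    Measure.map (meshIndex h) (volume : Measure (Euc d)) = ENNReal.ofReal h ^ d • Measure.count := by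
  refine Measure.ext_of_singleton fun z => ?_
  rw [Measure.map_apply (measurable_meshIndex h) (measurableSet_singleton z)]
  have h1 : meshIndex h ⁻¹' {z} = (fun x => x + -meshPoint h z) ⁻¹' cube d h := by
    ext x
    simp [meshIndex_eq_iff hh, sub_eq_add_neg]
  rw [h1, measure_preimage_add_right, volume_cube]
  simp

theorem lintegral_stepFun {h : ℝ} (hh : 0 < h) (F : (Fin d → ℤ) → ℝ≥0∞) :
    ∫⁻ x : Euc d, F (meshIndex h x) = ENNReal.ofReal h ^ d * ∑' z, F z := by
  rw [← lintegral_map (measurable_of_countable F) (measurable_meshIndex h), map_meshIndex hh,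
    lintegral_smul_measure, lintegral_count, smul_eq_mul]

theorem integrable_stepFun {h : ℝ} (hh : 0 < h) {v : (Fin d → ℤ) → ℝ} :
    Integrable (fun x : Euc d => v (meshIndex h x)) volume ↔ Summable v := by
  have h1 := integrable_map_measure (μ := (volume : Measure (Euc d))) (f := meshIndex h) (g := v)
    (measurable_of_countable v).aestronglyMeasurable (measurable_meshIndex h).aemeasurable
  rw [map_meshIndex hh, integrable_smul_measure (by simp [hh]) (by simp), integrable_count_iff,
    summable_norm_iff] at h1
  exact h1.symm

theorem integral_stepFun {h : ℝ} (hh : 0 < h) {v : (Fin d → ℤ) → ℝ} (hv : Summable v) :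
    ∫ x : Euc d, v (meshIndex h x) = h ^ d * ∑' z, v z := by
  have h1 := integral_map (μ := (volume : Measure (Euc d))) (φ := meshIndex h)
    (measurable_meshIndex h).aemeasurable (measurable_of_countable v).aestronglyMeasurable
  rw [← h1, map_meshIndex hh, integral_smul_measure, integral_countable]
  · simp [Measure.real, ENNReal.toReal_ofReal hh.le]
  · rw [integrable_count_iff]; exact hv.norm

theorem stepFun_add_single {h : ℝ} (hh : 0 < h) (u : (Fin d → ℤ) → ℝ) (i : Fin d) (x : Euc d) :
    stepFun h u (x + EuclideanSpace.single i h) = u (meshIndex h x + Pi.single i 1) := by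
  rw [stepFun, meshIndex_add_single hh]

theorem increment_stepFun_sq {h : ℝ} (hh : 0 < h) (u : (Fin d → ℤ) → ℝ) (i : Fin d) :
    increment (stepFun h u) (EuclideanSpace.single i h) ^ 2 =
      ENNReal.ofReal h ^ d * ∑' z, ENNReal.ofReal ((u (z + Pi.single i 1) - u z) ^ 2) := by
  rw [← lintegral_increment_sq, ← lintegral_stepFun hh]
  refine lintegral_congr fun x => ?_
  rw [stepFun_add_single hh, enorm_sq_eq_ofReal]
  rfl

/-- A shift by s ≤ h either leaves the cell index unchanged or raises it by one, as a full shift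
does; so the bound is pointwise. -/
theorem increment_stepFun_le_of_le {h s : ℝ} (hh : 0 < h) (hs : 0 ≤ s) (hsh : s ≤ h)
    (u : (Fin d → ℤ) → ℝ) (i : Fin d) :
    increment (stepFun h u) (EuclideanSpace.single i s) ≤
      increment (stepFun h u) (EuclideanSpace.single i h) := by
  refine eLpNorm_mono fun x => ?_
  rw [stepFun_add_single hh]
  have h1 : meshIndex h (x + EuclideanSpace.single i s) = meshIndex h x ∨
      meshIndex h (x + EuclideanSpace.single i s) = meshIndex h x + Pi.single i 1 := by
    have h2 : ⌊(x i + s) / h⌋ = ⌊x i / h⌋ ∨ ⌊(x i + s) / h⌋ = ⌊x i / h⌋ + 1 := by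
      have h3 : ⌊x i / h⌋ ≤ ⌊(x i + s) / h⌋ := Int.floor_le_floor (by gcongr; linarith)
      have h4 : ⌊(x i + s) / h⌋ ≤ ⌊x i / h⌋ + 1 := by
        rw [← Int.floor_add_one]
        refine Int.floor_le_floor ?_
        rw [← div_self hh.ne', ← add_div]
        gcongr
      omega
    refine h2.imp (fun h2 => ?_) fun h2 => ?_ <;>
    · ext j
      simp only [meshIndex, PiLp.add_apply, PiLp.single_apply, Pi.add_apply, Pi.single_apply]
      by_cases hj : j = i
      · subst hj; simpa using h2
      · simp [hj]
  rw [stepFun, stepFun]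
  rcases h1 with h1 | h1
  · rw [h1]; simp
  · rw [h1]

theorem increment_nsmul_le {g : Euc d → ℝ} (hg : AEStronglyMeasurable g volume) (v : Euc d)
    (n : ℕ) : increment g (n • v) ≤ n * increment g v := by
  induction n with
  | zero => simp [increment_zero]
  | succ n ih =>
    rw [succ_nsmul]
    refine (increment_add_le hg _ _).trans ?_
    push_cast
    rw [add_mul, one_mul]
    gcongr

/-- A step of length s consists of ⌊s/h⌋ mesh steps and a remainder that may cost one more. Because
h ≤ ℓ, the rounding at most doubles the bound. -/
theorem slowAt_stepFun {h ℓ : ℝ} (hh : 0 < h) (hℓ : h ≤ ℓ) {u : (Fin d → ℤ) → ℝ} {k : Fin d → ℝ}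
    (hk : ∀ i, 0 ≤ k i)
    (hu : ∀ i, increment (stepFun h u) (EuclideanSpace.single i h) ≤ ENNReal.ofReal (h * k i)) :
    SlowAt (stepFun h u) ℓ (2 * ∑ i, k i) := by
  have hm := (measurable_stepFun h u).aestronglyMeasurable (μ := (volume : Measure (Euc d)))
  rw [Finset.mul_sum]
  refine slowAt_of_coord hm (hh.le.trans hℓ) (fun i => by have := hk i; positivity) ?_
  intro i s hs hsℓ
  set n : ℕ := ⌊s / h⌋₊ with hn
  have hn1 : n * h ≤ s := by
    rw [← le_div_iff₀ hh]; exact Nat.floor_le (by positivity)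
  have hn2 : s ≤ n * h + h := by
    have := (Nat.lt_floor_add_one (s / h)).le
    rw [div_le_iff₀ hh] at this
    linarith
  have hsplit : (EuclideanSpace.single i s : Euc d) =
      n • EuclideanSpace.single i h + EuclideanSpace.single i (s - n * h) := by
    ext j
    simp only [PiLp.add_apply, PiLp.smul_apply, PiLp.single_apply]
    split_ifs <;> simp
  rw [hsplit]
  calc increment (stepFun h u) (n • EuclideanSpace.single i h + EuclideanSpace.single i (s - n * h))
      ≤ n * increment (stepFun h u) (EuclideanSpace.single i h) +
          increment (stepFun h u) (EuclideanSpace.single i h) :=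
        (increment_add_le hm _ _).trans (add_le_add (increment_nsmul_le hm _ _)
          (increment_stepFun_le_of_le hh (by linarith) (by linarith) u i))
    _ ≤ n * ENNReal.ofReal (h * k i) + ENNReal.ofReal (h * k i) := by
        have := hu i
        gcongr
    _ = ENNReal.ofReal ((n * h + h) * k i) := by
        have := hk i
        rw [add_mul, ENNReal.ofReal_add (by positivity) (by positivity), mul_assoc,
          ENNReal.ofReal_mul (by positivity : (0 : ℝ) ≤ n), ENNReal.ofReal_natCast]
    _ ≤ ENNReal.ofReal (ℓ * (2 * k i)) := by
        refine ENNReal.ofReal_le_ofReal ?_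
        have := hk i
        nlinarith

/-- A step function need not vary slowly below the mesh size, but there its height h^(-d/2) is
already at most ℓ^(-d/2). -/
theorem boundedOrSlow_stepFun {h : ℝ} (hh : 0 < h) {u : (Fin d → ℤ) → ℝ} {k : Fin d → ℝ}
    (hk : ∀ i, 0 ≤ k i) (hb : ∀ z, u z ≤ (√(h ^ d))⁻¹)
    (hu : ∀ i, increment (stepFun h u) (EuclideanSpace.single i h) ≤ ENNReal.ofReal (h * k i)) :
    BoundedOrSlow (stepFun h u) (2 * ∑ i, k i) := by
  intro ℓ hℓ
  rcases le_total h ℓ with h1 | h1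
  · exact Or.inr (slowAt_stepFun hh h1 hk hu)
  · refine Or.inl fun x => (hb _).trans ?_
    gcongr

theorem boundedOrSlow_of_increment {g : Euc d → ℝ} (hg : AEStronglyMeasurable g volume)
    {k : Fin d → ℝ} (hk : ∀ i, 0 ≤ k i)
    (h : ∀ i s, 0 ≤ s → increment g (EuclideanSpace.single i s) ≤ ENNReal.ofReal (s * k i)) :
    BoundedOrSlow g (∑ i, k i) := fun _ hℓ =>
  Or.inr (slowAt_of_coord hg hℓ.le hk fun i s hs hsℓ => (h i s hs).trans
    (ENNReal.ofReal_le_ofReal (mul_le_mul_of_nonneg_right hsℓ (hk i))))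

end StepFunctions

end VarConv
end

noncomputable section
namespace VarConv

/-! ### Conversion between H¹ functions and step functions. -/

section Comparison

variable {d : ℕ} {a b : ℝ → ℝ} {r C A : ℝ}

/-- The finite values of the continuous functional. -/
def contValues (d : ℕ) (a b : ℝ → ℝ) : Set ℝ :=
  {v | ∃ (g : Euc d → ℝ) (G : Euc d → Euc d), IsUnitH1 g G ∧
    Integrable (fun x => a (g x ^ 2)) volume ∧
    v = (∫ x, ‖G x‖ ^ 2) + ((∫ x, a (g x ^ 2)) - ∫ x, b (g x ^ 2))}

/-- The difference quotient of a step function in direction `i`, in `L²`-norm. -/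
def meshSlope (h : ℝ) (u : (Fin d → ℤ) → ℝ) (i : Fin d) : ℝ :=
  h⁻¹ * (increment (stepFun h u) (EuclideanSpace.single i h)).toReal

/-- The finite values of the functional on step functions of mesh `h`. -/
def meshValues (d : ℕ) (a b : ℝ → ℝ) (h : ℝ) : Set ℝ :=
  {v | ∃ u : (Fin d → ℤ) → ℝ, (∀ z, 0 ≤ u z) ∧
    Integrable (fun x : Euc d => stepFun h u x ^ 2) volume ∧
    ∫ x : Euc d, stepFun h u x ^ 2 = 1 ∧
    Integrable (fun x : Euc d => a (stepFun h u x ^ 2)) volume ∧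
    v = ∑ i, meshSlope h u i ^ 2 +
      ((∫ x : Euc d, a (stepFun h u x ^ 2)) - ∫ x : Euc d, b (stepFun h u x ^ 2))}

theorem memLp_two_of_integrable_sq {α : Type*} [MeasurableSpace α] {μ : Measure α} {g : α → ℝ}
    (hg : Measurable g) (h : Integrable (fun x => g x ^ 2) μ) : MemLp g 2 μ :=
  (memLp_two_iff_integrable_sq hg.aestronglyMeasurable).2 h

theorem eLpNorm_sq_eq_ofReal {α : Type*} [MeasurableSpace α] {μ : Measure α} {g : α → ℝ}
    (h : Integrable (fun x => g x ^ 2) μ) :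
    eLpNorm g 2 μ ^ 2 = ENNReal.ofReal (∫ x, g x ^ 2 ∂μ) := by
  rw [eLpNorm_two_sq, ofReal_integral_eq_lintegral_ofReal h
    (Eventually.of_forall fun x => sq_nonneg _)]
  simp_rw [enorm_sq_eq_ofReal]

theorem eLpNorm_eq_one_iff {α : Type*} [MeasurableSpace α] {μ : Measure α} {g : α → ℝ}
    (h : Integrable (fun x => g x ^ 2) μ) :
    eLpNorm g 2 μ = 1 ↔ ∫ x, g x ^ 2 ∂μ = 1 := by
  have h1 := eLpNorm_sq_eq_ofReal h
  constructor
  · intro h2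
    rw [h2, one_pow, eq_comm, ENNReal.ofReal_eq_one] at h1
    exact h1
  · intro h2
    have h1 : eLpNorm g 2 μ ^ 2 = 1 ^ 2 := by rw [h1, h2, ENNReal.ofReal_one, one_pow]
    exact le_antisymm ((ENNReal.pow_le_pow_left_iff two_ne_zero).1 h1.le)
      ((ENNReal.pow_le_pow_left_iff two_ne_zero).1 h1.ge)

/-- Takes s halfway between r and 2/d. The allowance 4dE covers both uses: k is ∑ k_i for H¹
functions and 2 ∑ k_i for step functions, with E = ∑ k_i². -/
theorem exists_exponent (hd : 1 ≤ d) (hr0 : 0 ≤ r) (hr : r < 2 / (d : ℝ)) :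
    ∃ s N : ℝ, r < s ∧ 0 ≤ N ∧ ∀ (g : Euc d → ℝ) (k E : ℝ), Measurable g → (∀ x, 0 ≤ g x) →
      Integrable (fun x => g x ^ 2) volume → ∫ x, g x ^ 2 = 1 → BoundedOrSlow g k →
      0 ≤ E → k ^ 2 ≤ 4 * d * E →
      Integrable (fun x => (g x ^ 2) ^ (1 + s)) volume ∧
        ∫ x, (g x ^ 2) ^ (1 + s) ≤ N * (1 + E) := by
  have hd0 : (1 : ℝ) ≤ d := by exact_mod_cast hd
  obtain ⟨N, hN, h⟩ := exists_moment_bound hd (s := (r + 2 / d) / 2) (by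
    have : 0 < 2 / (d : ℝ) := by positivity
    linarith) (by linarith)
  refine ⟨(r + 2 / d) / 2, N * (4 * d), by linarith, by positivity, ?_⟩
  intro g k E hgm hg0 hg hg1 hgk hE hkE
  obtain ⟨h1, h2⟩ := h g k hgm hg0 (memLp_two_of_integrable_sq hgm hg)
    ((eLpNorm_eq_one_iff hg).2 hg1).le hgk
  refine ⟨h1, h2.trans ?_⟩
  rw [mul_assoc]
  refine mul_le_mul_of_nonneg_left ?_ hN
  nlinarith

/-- Coercivity of the functional. -/
theorem IsSplitDensity.exists_coercive (H : IsSplitDensity a b r C A) (hd : 1 ≤ d)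
    (hr : r < 2 / (d : ℝ)) :
    ∃ C' : ℝ, 0 ≤ C' ∧ ∀ (g : Euc d → ℝ) (k E : ℝ), Measurable g → (∀ x, 0 ≤ g x) →
      Integrable (fun x => g x ^ 2) volume → ∫ x, g x ^ 2 = 1 → BoundedOrSlow g k →
      0 ≤ E → k ^ 2 ≤ 4 * d * E →
      Integrable (fun x => b (g x ^ 2)) volume ∧
      E / 2 + ∫ x, a (g x ^ 2) ≤ E + ((∫ x, a (g x ^ 2)) - ∫ x, b (g x ^ 2)) + C' := by
  obtain ⟨s, N, hrs, hN, h⟩ := exists_exponent (d := d) hd H.r_nonneg hr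
  obtain ⟨C', hC', h'⟩ := H.exists_abs_integral_b_le hrs N
  refine ⟨C', hC', ?_⟩
  intro g k E hgm hg0 hg hg1 hgk hE hkE
  obtain ⟨h1, h2⟩ := h g k E hgm hg0 hg hg1 hgk hE hkE
  refine ⟨H.integrable_b hrs (fun x => sq_nonneg (g x)) hg h1, ?_⟩
  have h3 := h' volume (fun x => g x ^ 2) E hE (fun x => sq_nonneg _) hg hg1 h1 h2
  have := (abs_le.1 h3).2
  linarith

/-- Averaging at a small scale, truncating and normalising nearly decreases the functional. -/
theorem IsSplitDensity.exists_truncated_avg (H : IsSplitDensity a b r C A) (hd : 1 ≤ d)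
    (hr : r < 2 / (d : ℝ)) (B : ℝ) {η : ℝ} (hη : 0 < η) :
    ∃ h₀ > 0, ∀ (h : ℝ) (θ : Euc d → Euc d → Euc d) (g : Euc d → ℝ) (k E : ℝ),
      0 < h → h < h₀ → IsSampling h θ → Measurable g → (∀ x, 0 ≤ g x) →
      Integrable (fun x => g x ^ 2) volume → ∫ x, g x ^ 2 = 1 → BoundedOrSlow g k →
      0 ≤ E → k ^ 2 ≤ 4 * d * E → Integrable (fun x => a (g x ^ 2)) volume →
      E + ((∫ x, a (g x ^ 2)) - ∫ x, b (g x ^ 2)) ≤ B →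
      eLpNorm (fun x => sampleAvg h θ g x - g x) 2 volume ^ 2 ≤
        2 ^ d * ENNReal.ofReal (h * k) ^ 2 →
      ∃ ε c : ℝ, 1 ≤ c ∧
        Integrable (fun x => (c * max (sampleAvg h θ g x - ε) 0) ^ 2) volume ∧
        ∫ x, (c * max (sampleAvg h θ g x - ε) 0) ^ 2 = 1 ∧
        Integrable (fun x => a ((c * max (sampleAvg h θ g x - ε) 0) ^ 2)) volume ∧
        c ^ 2 * E + ((∫ x, a ((c * max (sampleAvg h θ g x - ε) 0) ^ 2)) -
          ∫ x, b ((c * max (sampleAvg h θ g x - ε) 0) ^ 2)) ≤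
          E + ((∫ x, a (g x ^ 2)) - ∫ x, b (g x ^ 2)) + η := by
  obtain ⟨s, N, hrs, hN, hmom⟩ := exists_exponent (d := d) hd H.r_nonneg hr
  obtain ⟨C', hC', hcoer⟩ := H.exists_coercive hd hr
  have hs0 : 0 ≤ s := H.r_nonneg.trans hrs.le
  -- By coercivity, a value at most B forces E ≤ E₀ and ∫ a ≤ |B| + C'.
  set E₀ : ℝ := 2 * (|B| + C') with hE₀
  have hE₀0 : 0 ≤ E₀ := by positivity
  set B' : ℝ := N * (1 + E₀) + (|B| + C') with hB'
  -- The error is spent twice: times E ≤ E₀ when the energy is multiplied by c², and once in the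
  -- potential.
  have hη' : 0 < η / (E₀ + 1) := by positivity
  obtain ⟨δ, hδ, hcore⟩ := H.exists_truncated_approx hrs (B := B') (by positivity) hη'
  set K : ℝ := 2 ^ d * (4 * d * E₀) + 1 with hK
  have hK0 : 0 < K := by positivity
  refine ⟨√(δ / K), Real.sqrt_pos.2 (by positivity), ?_⟩
  intro h θ g k E hh hhh₀ hθ hgm hg0 hg hg1 hgk hE hkE hag hB hdist
  obtain ⟨hbg, hco⟩ := hcoer g k E hgm hg0 hg hg1 hgk hE hkE
  have ha0 : 0 ≤ ∫ x, a (g x ^ 2) := integral_nonneg fun x => H.a_nonneg (sq_nonneg _)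
  have hBabs := le_abs_self B
  have hEE₀ : E ≤ E₀ := by rw [hE₀]; linarith
  have haB : ∫ x, a (g x ^ 2) ≤ |B| + C' := by linarith
  obtain ⟨hgs, hgsN⟩ := hmom g k E hgm hg0 hg hg1 hgk hE hkE
  have hgsB : ∫ x, (g x ^ 2) ^ (1 + s) ≤ N * (1 + E₀) :=
    hgsN.trans (mul_le_mul_of_nonneg_left (by linarith) hN)
  set g' : Euc d → ℝ := sampleAvg h θ g with hg'
  have hg'm : Measurable g' := measurable_sampleAvg hh hθ hgm
  have hg'0 : ∀ x, 0 ≤ g' x := sampleAvg_nonneg hg0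
  have hmom' : ∀ q : ℝ, 0 ≤ q → Integrable (fun x => (g x ^ 2) ^ (1 + q)) volume →
      Integrable (fun x => (g' x ^ 2) ^ (1 + q)) volume ∧
      ∫ x, (g' x ^ 2) ^ (1 + q) ≤ ∫ x, (g x ^ 2) ^ (1 + q) := by
    intro q hq hi
    have hle := lintegral_sampleAvg_rpow_le hh hθ hgm (q := 2 * (1 + q)) (by linarith)
    have hpow : ∀ y : ℝ, ‖y‖ₑ ^ (2 * (1 + q)) = ENNReal.ofReal ((y ^ 2) ^ (1 + q)) := fun y => by
      rw [ENNReal.rpow_mul, ENNReal.rpow_ofNat, enorm_sq_eq_ofReal,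
        ENNReal.ofReal_rpow_of_nonneg (sq_nonneg _) (by linarith)]
    simp_rw [hpow] at hle
    have hnn : ∀ f : Euc d → ℝ, 0 ≤ᵐ[volume] fun x => (f x ^ 2) ^ (1 + q) := fun f =>
      Eventually.of_forall fun x => by positivity
    rw [← ofReal_integral_eq_lintegral_ofReal hi (hnn g)] at hle
    have hi' : Integrable (fun x => (g' x ^ 2) ^ (1 + q)) volume := by
      refine ⟨((hg'm.pow_const 2).pow_const _).aestronglyMeasurable, ?_⟩
      rw [hasFiniteIntegral_iff_ofReal (hnn g')]
      exact hle.trans_lt ENNReal.ofReal_lt_top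
    refine ⟨hi', ?_⟩
    rw [← ofReal_integral_eq_lintegral_ofReal hi' (hnn g'),
      ENNReal.ofReal_le_ofReal_iff (integral_nonneg_of_ae (hnn g))] at hle
    exact hle
  obtain ⟨hg's, hg'sle⟩ := hmom' s hs0 hgs
  -- The case q = 0 is the L² contraction.
  obtain ⟨hg'i, hg'1⟩ := hmom' 0 le_rfl (by simpa using hg)
  simp only [add_zero, Real.rpow_one] at hg'i hg'1
  rw [hg1] at hg'1
  have hdi : Integrable (fun x => (g' x - g x) ^ 2) volume :=
    ((memLp_two_of_integrable_sq hg'm hg'i).sub (memLp_two_of_integrable_sq hgm hg)).integrable_sq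
  have hδle : ∫ x, (g' x - g x) ^ 2 ≤ δ := by
    rw [eLpNorm_sq_eq_ofReal hdi] at hdist
    have h1 : (2 : ℝ≥0∞) ^ d * ENNReal.ofReal (h * k) ^ 2 ≤ ENNReal.ofReal (2 ^ d * (h * k) ^ 2) := by
      rw [ENNReal.ofReal_mul (show (0 : ℝ) ≤ 2 ^ d by positivity), ← sq_abs (h * k),
        ENNReal.ofReal_pow (abs_nonneg _)]
      gcongr
      · simp
      · exact le_abs_self _
    have h2 := hdist.trans h1
    rw [ENNReal.ofReal_le_ofReal_iff (by positivity)] at h2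
    refine h2.trans ?_
    have h3 : h ^ 2 ≤ δ / K := by
      have := pow_le_pow_left₀ hh.le hhh₀.le 2
      rwa [Real.sq_sqrt (by positivity)] at this
    have h4 : k ^ 2 ≤ 4 * d * E₀ := hkE.trans (by gcongr)
    calc 2 ^ d * (h * k) ^ 2 = h ^ 2 * (2 ^ d * k ^ 2) := by ring
      _ ≤ δ / K * K := by
        refine mul_le_mul h3 ?_ (by positivity) (by positivity)
        have : (2 : ℝ) ^ d * k ^ 2 ≤ 2 ^ d * (4 * d * E₀) := by gcongr
        linarith
      _ = δ := div_mul_cancel₀ _ hK0.ne'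
  have hBC : 0 ≤ |B| + C' := by positivity
  have hNE : 0 ≤ N * (1 + E₀) := by positivity
  obtain ⟨ε, c, hε, hc1, hc2, hfi, hf1, hai, hle⟩ := hcore volume g g' hgm hg'm hg0 hg'0 hg hg1
    hg'i hg'1 hgs (by linarith) hg's (by linarith) hag (by linarith) hδle
  refine ⟨ε, c, hc1, hfi, hf1, hai, ?_⟩
  have h5 : c ^ 2 * E ≤ E + η / (E₀ + 1) * E₀ := by
    have : η / (E₀ + 1) * E ≤ η / (E₀ + 1) * E₀ := mul_le_mul_of_nonneg_left hEE₀ hη'.le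
    nlinarith
  have h6 : η / (E₀ + 1) * E₀ + η / (E₀ + 1) = η := by field_simp
  linarith

/-- Uses the absolute value of a measurable version. Increments do not grow under absolute values,
so the slopes of g serve and no weak gradient of |g| has to be found. -/
theorem IsUnitH1.exists_representative {g : Euc d → ℝ} {G : Euc d → Euc d} (hg : IsUnitH1 g G) :
    ∃ g₀ : Euc d → ℝ, Measurable g₀ ∧ (∀ x, 0 ≤ g₀ x) ∧
      (∀ᵐ x, g₀ x ^ 2 = g x ^ 2) ∧ Integrable (fun x => g₀ x ^ 2) volume ∧ ∫ x, g₀ x ^ 2 = 1 ∧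
      ∃ k : Fin d → ℝ, (∀ i, 0 ≤ k i) ∧ ∑ i, k i ^ 2 = ∫ x, ‖G x‖ ^ 2 ∧
        ∀ i s, 0 ≤ s → increment g₀ (EuclideanSpace.single i s) ≤ ENNReal.ofReal (s * k i) := by
  have hm := hg.memLp.1
  set g₀ : Euc d → ℝ := fun x => |hm.mk g x| with hg₀
  have hg₀m : Measurable g₀ := hm.stronglyMeasurable_mk.measurable.abs
  have hae : ∀ᵐ x, g₀ x ^ 2 = g x ^ 2 := by
    filter_upwards [hm.ae_eq_mk] with x hx
    rw [hg₀, sq_abs, hx]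
  have hi : Integrable (fun x => g x ^ 2) volume := hg.memLp.integrable_sq
  have hi₀ : Integrable (fun x => g₀ x ^ 2) volume :=
    hi.congr (hae.mono fun x hx => hx.symm)
  refine ⟨g₀, hg₀m, fun x => abs_nonneg _, hae, hi₀, ?_, fun i =>
    (eLpNorm (fun x => G x i) 2 volume).toReal, fun _ => ENNReal.toReal_nonneg, ?_, ?_⟩
  · rw [integral_congr_ae hae, ← eLpNorm_eq_one_iff hi]
    exact hg.norm_eq_one
  · have hGi : ∀ i, MemLp (fun x => G x i) 2 volume := fun i => hg.memLp_grad.eval_piLp i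
    simp_rw [EuclideanSpace.norm_sq_eq, Real.norm_eq_abs, sq_abs]
    rw [integral_finsetSum _ fun i _ => (hGi i).integrable_sq]
    refine Finset.sum_congr rfl fun i _ => ?_
    rw [← ENNReal.toReal_pow, eLpNorm_sq_eq_ofReal (hGi i).integrable_sq,
      ENNReal.toReal_ofReal (integral_nonneg fun x => sq_nonneg _)]
  · intro i t hs
    have h1 := increment_le_weakGradient hg.memLp hg.memLp_grad hg.weakGradient i hs
    have h2 : increment g₀ (EuclideanSpace.single i t) ≤ increment g (EuclideanSpace.single i t) := by
      rw [increment_congr_ae hm.ae_eq_mk]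
      exact increment_mono (fun x y => abs_abs_sub_abs_le_abs_sub _ _) _
    refine (h2.trans h1).trans_eq ?_
    rw [ENNReal.ofReal_mul hs, ENNReal.ofReal_toReal
      (hg.memLp_grad.eval_piLp i).eLpNorm_ne_top]

theorem sq_sum_le_dim_mul (k : Fin d → ℝ) : (∑ i, k i) ^ 2 ≤ d * ∑ i, k i ^ 2 := by
  have := sq_sum_le_card_mul_sum_sq (s := Finset.univ) (f := k)
  simpa using this

theorem increment_truncated_le {g : Euc d → ℝ} {ε c : ℝ} (hc : 0 ≤ c) (v : Euc d) :
    increment (fun x => c * max (g x - ε) 0) v ≤ ENNReal.ofReal c * increment g v := by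
  rw [← Real.enorm_of_nonneg hc, ← increment_const_mul]
  refine increment_mono (fun x y => ?_) v
  rw [← mul_sub, ← mul_sub, abs_mul, abs_mul]
  refine mul_le_mul_of_nonneg_left ?_ (abs_nonneg c)
  have := abs_max_sub_max_le_abs (g x - ε) (g y - ε) 0
  simpa using this

theorem sum_sq_nonneg (k : Fin d → ℝ) : 0 ≤ ∑ i, k i ^ 2 :=
  Finset.sum_nonneg fun _ _ => sq_nonneg _

/-- The competitor is the truncated, normalised cell average. Each of its slopes is at most c k_i,
so the energy grows only by the factor c², already accounted for in `exists_truncated_avg`. -/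
theorem IsSplitDensity.exists_meshValue_le (H : IsSplitDensity a b r C A) (hd : 1 ≤ d)
    (hr : r < 2 / (d : ℝ)) (B : ℝ) {η : ℝ} (hη : 0 < η) :
    ∃ h₀ > 0, ∀ h, 0 < h → h < h₀ → ∀ v ∈ contValues d a b, v ≤ B →
      ∃ v' ∈ meshValues d a b h, v' ≤ v + η := by
  obtain ⟨h₀, hh₀, hmain⟩ := H.exists_truncated_avg hd hr B hη
  refine ⟨h₀, hh₀, ?_⟩
  rintro h hh hhh₀ v ⟨g, G, hgG, hag, rfl⟩ hvB
  obtain ⟨g₀, hg₀m, hg₀0, hae, hg₀i, hg₀1, k, hk0, hkG, hinc⟩ := hgG.exists_representative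
  have hbs := boundedOrSlow_of_increment hg₀m.aestronglyMeasurable hk0 hinc
  have hk2 := sq_sum_le_dim_mul k
  have hkn := sum_sq_nonneg k
  have hsl : SlowAt g₀ h (∑ i, k i) := slowAt_of_coord hg₀m.aestronglyMeasurable hh.le hk0
    fun i s hs hsh => (hinc i s hs).trans
      (ENNReal.ofReal_le_ofReal (mul_le_mul_of_nonneg_right hsh (hk0 i)))
  have hag₀ : (fun x => a (g x ^ 2)) =ᵐ[volume] fun x => a (g₀ x ^ 2) :=
    hae.mono fun x hx => by simp only [hx]
  have hbg₀ : (fun x => b (g x ^ 2)) =ᵐ[volume] fun x => b (g₀ x ^ 2) :=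
    hae.mono fun x hx => by simp only [hx]
  rw [integral_congr_ae hag₀, integral_congr_ae hbg₀, ← hkG] at hvB ⊢
  have hg₀2 := memLp_two_of_integrable_sq hg₀m hg₀i
  obtain ⟨ε, c, hc1, hfi, hf1, hai, hle⟩ := hmain h (cellSample h) g₀ (∑ i, k i) (∑ i, k i ^ 2) hh
    hhh₀ (isSampling_cellSample hh) hg₀m hg₀0 hg₀i hg₀1 hbs hkn
    (hk2.trans (by nlinarith [mul_nonneg (Nat.cast_nonneg (α := ℝ) d) hkn]))
    (hag.congr hag₀) hvB (eLpNorm_cellAvg_sub_le hh hg₀m hg₀2 hsl)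
  have hc0 : 0 ≤ c := by linarith
  set u : (Fin d → ℤ) → ℝ := fun z =>
    c * max ((∫ y, g₀ (meshPoint h z + y) ∂(cubeMeasure d h)) - ε) 0 with hu
  have hstep : stepFun h u = fun x => c * max (sampleAvg h (cellSample h) g₀ x - ε) 0 := rfl
  refine ⟨_, ⟨u, fun z => mul_nonneg hc0 (le_max_right _ _), hfi, hf1, hai, rfl⟩, ?_⟩
  refine le_trans ?_ hle
  rw [hstep, Finset.mul_sum]
  refine add_le_add (Finset.sum_le_sum fun i _ => ?_) le_rfl
  rw [← mul_pow]
  refine pow_le_pow_left₀ (mul_nonneg (by positivity) ENNReal.toReal_nonneg) ?_ 2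
  have h1 : increment (stepFun h u) (EuclideanSpace.single i h) ≤
      ENNReal.ofReal (c * (h * k i)) := by
    rw [hstep, ENNReal.ofReal_mul hc0]
    refine (increment_truncated_le hc0 _).trans (mul_le_mul_right ?_ _)
    exact (increment_cellAvg_le hh hg₀m hg₀2 i).trans (hinc i h hh.le)
  have h2 := ENNReal.toReal_le_of_le_ofReal
    (mul_nonneg hc0 (mul_nonneg hh.le (hk0 i))) h1
  rw [inv_mul_le_iff₀ hh]
  linarith

theorem stepFun_data {h : ℝ} (hh : 0 < h) {u : (Fin d → ℤ) → ℝ}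
    (hi : Integrable (fun x : Euc d => stepFun h u x ^ 2) volume)
    (h1 : ∫ x : Euc d, stepFun h u x ^ 2 = 1) :
    (∀ i, 0 ≤ meshSlope h u i) ∧
    (∀ i, increment (stepFun h u) (EuclideanSpace.single i h) =
      ENNReal.ofReal (h * meshSlope h u i)) ∧
    BoundedOrSlow (stepFun h u) (2 * ∑ i, meshSlope h u i) := by
  have h0 : ∀ i, 0 ≤ meshSlope h u i := fun i => mul_nonneg (by positivity) ENNReal.toReal_nonneg
  have hinc : ∀ i, increment (stepFun h u) (EuclideanSpace.single i h) =
      ENNReal.ofReal (h * meshSlope h u i) := fun i => by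
    rw [meshSlope, mul_inv_cancel_left₀ hh.ne', ENNReal.ofReal_toReal]
    exact (memLp_increment (memLp_two_of_integrable_sq (measurable_stepFun h u) hi)
      _).eLpNorm_ne_top
  -- Unit mass caps every value: one term of the sum gives h^d u(z)² ≤ 1.
  refine ⟨h0, hinc, boundedOrSlow_stepFun hh h0 (fun z => ?_) fun i => (hinc i).le⟩
  have hs : Summable fun z => u z ^ 2 := (integrable_stepFun (d := d) hh).1 hi
  have h2 := integral_stepFun (d := d) hh hs
  have h3 := h1.symm.trans h2
  have h4 := hs.le_tsum z fun _ _ => sq_nonneg _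
  rw [← Real.sqrt_inv]
  refine Real.le_sqrt_of_sq_le ?_
  rw [← one_div, le_div_iff₀ (by positivity), h3, mul_comm]
  gcongr

/-- The competitor is the truncated, normalised cube average. Its increments are at most t c k_i for
0 < t ≤ h, and such short increments suffice for a weak gradient with the same constants. -/
theorem IsSplitDensity.exists_contValue_le (H : IsSplitDensity a b r C A) (hd : 1 ≤ d)
    (hr : r < 2 / (d : ℝ)) (B : ℝ) {η : ℝ} (hη : 0 < η) :
    ∃ h₀ > 0, ∀ h, 0 < h → h < h₀ → ∀ v ∈ meshValues d a b h, v ≤ B →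
      ∃ v' ∈ contValues d a b, v' ≤ v + η := by
  obtain ⟨h₀, hh₀, hmain⟩ := H.exists_truncated_avg hd hr B hη
  refine ⟨h₀, hh₀, ?_⟩
  rintro h hh hhh₀ v ⟨u, hu0, hi, h1, ha, rfl⟩ hvB
  obtain ⟨hk0, hinc, hbs⟩ := stepFun_data hh hi h1
  set k := meshSlope h u with hk
  have hk2 := sq_sum_le_dim_mul k
  have hkn := sum_sq_nonneg k
  have hgm := measurable_stepFun (d := d) h u
  have hg2 := memLp_two_of_integrable_sq hgm hi
  have hsl := slowAt_stepFun hh le_rfl hk0 fun i => (hinc i).le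
  obtain ⟨ε, c, hc1, hfi, hf1, hai, hle⟩ := hmain h cubeSample (stepFun h u) (2 * ∑ i, k i)
    (∑ i, k i ^ 2) hh hhh₀ (isSampling_cubeSample hh) hgm (fun x => hu0 _) hi h1 hbs hkn
    (by rw [mul_pow]; linarith) ha hvB (by
      have := eLpNorm_cubeAvg_sub_le hh hgm hg2 hsl
      calc _ ≤ ENNReal.ofReal (h * (2 * ∑ i, k i)) ^ 2 := by gcongr
        _ ≤ _ := le_mul_of_one_le_left zero_le (one_le_pow₀ (by norm_num)))
  have hc0 : 0 ≤ c := by linarith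
  set f : Euc d → ℝ := fun x => c * max (sampleAvg h cubeSample (stepFun h u) x - ε) 0 with hf
  have hfm : Measurable f :=
    (((measurable_sampleAvg hh (isSampling_cubeSample hh) hgm).sub_const ε).max
      measurable_const).const_mul c
  have hf2 := memLp_two_of_integrable_sq hfm hfi
  obtain ⟨G, hG2, hGw, hGle⟩ := exists_weakGradient hf2 hh (k := fun i => c * k i)
    (fun i => mul_nonneg hc0 (hk0 i)) (by
      intro i t ht hth
      refine (increment_truncated_le hc0 _).trans ?_
      have h3 := increment_cubeAvg_le hh ht hth hgm hg2 i
      rw [hinc i, ← ENNReal.ofReal_mul (by positivity)] at h3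
      refine (mul_le_mul_right h3 _).trans_eq ?_
      rw [← ENNReal.ofReal_mul hc0]
      congr 1
      field_simp)
  refine ⟨_, ⟨f, G, ⟨hf2, hG2, hGw, (eLpNorm_eq_one_iff hfi).2 hf1⟩, hai, rfl⟩, ?_⟩
  refine le_trans (add_le_add (hGle.trans_eq ?_) le_rfl) hle
  simp_rw [mul_pow]
  rw [Finset.mul_sum]

end Comparison

end VarConv
end

noncomputable section
namespace VarConv

/-! ### Convergence of the mesh infima. -/

section Limit

variable {d : ℕ} {a b : ℝ → ℝ} {r C A : ℝ}

theorem hasWeakGradient_of_contDiff {g : Euc d → ℝ} (hg : ContDiff ℝ 1 g)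
    (hgc : HasCompactSupport g) :
    HasWeakGradient g fun x => WithLp.toLp 2 fun i => fderiv ℝ g x (EuclideanSpace.single i 1) := by
  intro φ hφ hφc i
  have hφ1 : ContDiff ℝ 1 φ := hφ.of_le (by simp)
  have hg' : Continuous fun x => fderiv ℝ g x (EuclideanSpace.single i 1) :=
    (hg.continuous_fderiv one_ne_zero).clm_apply continuous_const
  have hφ' : Continuous fun x => fderiv ℝ φ x (EuclideanSpace.single i 1) :=
    (hφ1.continuous_fderiv one_ne_zero).clm_apply continuous_const
  refine integral_mul_fderiv_eq_neg_fderiv_mul_of_integrable ?_ ?_ ?_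
    (fun x _ => (hg.differentiable one_ne_zero) x) (fun x _ => (hφ1.differentiable one_ne_zero) x)
  · exact (hg'.mul hφ.continuous).integrable_of_hasCompactSupport hφc.mul_left
  · exact (hg.continuous.mul hφ').integrable_of_hasCompactSupport hgc.mul_right
  · exact (hg.continuous.mul hφ.continuous).integrable_of_hasCompactSupport hgc.mul_right

theorem IsSplitDensity.contValues_nonempty (H : IsSplitDensity a b r C A) :
    (contValues d a b).Nonempty := by
  let f : ContDiffBump (0 : Euc d) := ⟨1, 2, one_pos, one_lt_two⟩
  have hfc : HasCompactSupport f := f.hasCompactSupport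
  have hf : ContDiff ℝ 1 f := f.contDiff
  have hf2 : Integrable (fun x => f x ^ 2) (volume : Measure (Euc d)) := by
    refine (hf.continuous.pow 2).integrable_of_hasCompactSupport ?_
    simp_rw [pow_two]
    exact hfc.mul_left
  have hpos : 0 < ∫ x, f x ^ 2 := by
    refine (hf.continuous.pow 2).integral_pos_of_hasCompactSupport_nonneg_nonzero ?_
      (fun x => sq_nonneg _) (x := 0) ?_
    · simp_rw [pow_two]
      exact hfc.mul_left
    · have : f 0 = 1 := f.one_of_mem_closedBall (by simp [f])
      rw [this]; norm_num
  set m := ∫ x, f x ^ 2 with hm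
  set g : Euc d → ℝ := fun x => √(m⁻¹) * f x with hgdef
  have hg : ContDiff ℝ 1 g := contDiff_const.mul hf
  have hgc : HasCompactSupport g := hfc.mul_left
  have hgsq : ∀ x, g x ^ 2 = m⁻¹ * f x ^ 2 := fun x => by
    rw [hgdef, mul_pow, Real.sq_sqrt (by positivity)]
  have hg2 : Integrable (fun x => g x ^ 2) volume := by
    simp_rw [hgsq]; exact hf2.const_mul _
  have hg1 : ∫ x, g x ^ 2 = 1 := by
    simp_rw [hgsq]; rw [integral_const_mul]; exact inv_mul_cancel₀ hpos.ne'
  have hag : Integrable (fun x => a (g x ^ 2)) volume := by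
    have hK : IsCompact (tsupport g) := hgc
    refine IntegrableOn.integrable_of_forall_notMem_eq_zero (s := tsupport g) ?_ fun x hx => ?_
    · have : IsFiniteMeasure (volume.restrict (tsupport g)) := ⟨by
        rw [Measure.restrict_apply_univ]; exact hK.measure_lt_top⟩
      refine Integrable.of_bound (H.a_meas.comp
        (hg.continuous.measurable.pow_const 2)).aestronglyMeasurable A (Eventually.of_forall fun x => ?_)
      rw [Real.norm_of_nonneg (H.a_nonneg (sq_nonneg _))]
      exact H.a_le _ (sq_nonneg _)
    · rw [image_eq_zero_of_notMem_tsupport hx]; simpa using H.a_zero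
  refine ⟨_, g, _, ⟨memLp_two_of_integrable_sq hg.continuous.measurable hg2,
    MemLp.of_eval_piLp fun i => ?_, hasWeakGradient_of_contDiff hg hgc,
    (eLpNorm_eq_one_iff hg2).2 hg1⟩, hag, rfl⟩
  exact ((hg.continuous_fderiv one_ne_zero).clm_apply
    continuous_const).memLp_of_hasCompactSupport (hgc.fderiv_apply ℝ _)

theorem IsSplitDensity.meshValues_nonempty (H : IsSplitDensity a b r C A) {h : ℝ} (hh : 0 < h) :
    (meshValues d a b h).Nonempty := by
  set u : (Fin d → ℤ) → ℝ := Pi.single 0 (√(h ^ d))⁻¹ with hu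
  have hu0 : ∀ z, z ≠ 0 → u z = 0 := fun z hz => by rw [hu, Pi.single_eq_of_ne hz]
  have hs : ∀ F : ℝ → ℝ, F 0 = 0 → Summable fun z => F (u z ^ 2) := fun F hF =>
    summable_of_ne_finset_zero (s := {0}) fun z hz => by
      rw [hu0 z (by simpa using hz)]; simpa using hF
  refine ⟨_, u, fun z => ?_, (integrable_stepFun hh).2 (hs id rfl), ?_,
    (integrable_stepFun hh (v := fun z => a (u z ^ 2))).2 (hs a H.a_zero), rfl⟩
  · by_cases hz : z = 0
    · rw [hz, hu, Pi.single_eq_same]; positivity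
    · rw [hu0 z hz]
  · have h1 := integral_stepFun (d := d) hh (hs id rfl)
    refine h1.trans ?_
    rw [tsum_eq_single 0 fun z hz => by rw [hu0 z hz]; simp]
    rw [hu, Pi.single_eq_same, id, inv_pow, Real.sq_sqrt (by positivity),
      mul_inv_cancel₀ (by positivity)]

/-- The coercivity constant does not see the mesh, so one bound serves all h. -/
theorem IsSplitDensity.exists_lower_bound (H : IsSplitDensity a b r C A) (hd : 1 ≤ d)
    (hr : r < 2 / (d : ℝ)) :
    ∃ C' : ℝ, (∀ v ∈ contValues d a b, -C' ≤ v) ∧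
      ∀ h, 0 < h → ∀ v ∈ meshValues d a b h, -C' ≤ v := by
  obtain ⟨C', hC', hco⟩ := H.exists_coercive hd hr
  refine ⟨C', ?_, ?_⟩
  · rintro v ⟨g, G, hgG, hag, rfl⟩
    obtain ⟨g₀, hg₀m, hg₀0, hae, hg₀i, hg₀1, k, hk0, hkG, hinc⟩ := hgG.exists_representative
    have hbs := boundedOrSlow_of_increment hg₀m.aestronglyMeasurable hk0 hinc
    have hk2 := sq_sum_le_dim_mul k
    have hkn := sum_sq_nonneg k
    have hag₀ : (fun x => a (g x ^ 2)) =ᵐ[volume] fun x => a (g₀ x ^ 2) :=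
      hae.mono fun x hx => by simp only [hx]
    have hbg₀ : (fun x => b (g x ^ 2)) =ᵐ[volume] fun x => b (g₀ x ^ 2) :=
      hae.mono fun x hx => by simp only [hx]
    rw [integral_congr_ae hag₀, integral_congr_ae hbg₀, ← hkG]
    have h1 := (hco g₀ _ _ hg₀m hg₀0 hg₀i hg₀1 hbs hkn
      (hk2.trans (by nlinarith [mul_nonneg (Nat.cast_nonneg (α := ℝ) d) hkn]))).2
    have ha0 : 0 ≤ ∫ x, a (g₀ x ^ 2) := integral_nonneg fun x => H.a_nonneg (sq_nonneg _)
    linarith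
  · rintro h hh v ⟨u, hu0, hi, h1, ha, rfl⟩
    obtain ⟨hk0, hinc, hbs⟩ := stepFun_data hh hi h1
    have hk2 := sq_sum_le_dim_mul (meshSlope h u)
    have hkn := sum_sq_nonneg (meshSlope h u)
    have h2 := (hco _ _ _ (measurable_stepFun h u) (fun x => hu0 _) hi h1 hbs hkn
      (by rw [mul_pow]; linarith)).2
    have ha0 : 0 ≤ ∫ x : Euc d, a (stepFun h u x ^ 2) :=
      integral_nonneg fun x => H.a_nonneg (sq_nonneg _)
    linarith

theorem IsSplitDensity.bddBelow_contValues (H : IsSplitDensity a b r C A) (hd : 1 ≤ d)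
    (hr : r < 2 / (d : ℝ)) : BddBelow (contValues d a b) :=
  let ⟨C', h, _⟩ := H.exists_lower_bound hd hr
  ⟨-C', fun v hv => h v hv⟩

theorem IsSplitDensity.bddBelow_meshValues (H : IsSplitDensity a b r C A) (hd : 1 ≤ d)
    (hr : r < 2 / (d : ℝ)) {h : ℝ} (hh : 0 < h) : BddBelow (meshValues d a b h) :=
  let ⟨C', _, h'⟩ := H.exists_lower_bound hd hr
  ⟨-C', fun v hv => h' h hh v hv⟩

/-- The infima on the mesh converge to the continuous infimum. -/
theorem IsSplitDensity.tendsto_sInf_meshValues (H : IsSplitDensity a b r C A) (hd : 1 ≤ d)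
    (hr : r < 2 / (d : ℝ)) :
    Tendsto (fun h => sInf (meshValues d a b h)) (𝓝[>] 0) (𝓝 (sInf (contValues d a b))) := by
  rw [Metric.tendsto_nhds]
  intro η hη
  set χ := sInf (contValues d a b) with hχ
  set η' := min (η / 8) 1 with hη'
  have hη'0 : 0 < η' := by positivity
  have hη'1 : η' ≤ 1 := min_le_right _ _
  have hη'2 : η' ≤ η / 8 := min_le_left _ _
  -- The comparisons are uniform only below a fixed level. Near-minimisers on the continuum lie
  -- below χ + 1; once the upper bound is known, those on the mesh lie below χ + 3η' ≤ χ + 3.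
  obtain ⟨h₁, hh₁, hU⟩ := H.exists_meshValue_le hd hr (χ + 1) hη'0
  obtain ⟨h₂, hh₂, hL⟩ := H.exists_contValue_le hd hr (χ + 3) hη'0
  filter_upwards [Ioo_mem_nhdsGT (show (0 : ℝ) < min h₁ h₂ by positivity)] with h hh
  have hcb := H.bddBelow_contValues hd hr
  have hmb := H.bddBelow_meshValues hd hr hh.1
  obtain ⟨v, hv, hvχ⟩ := exists_lt_of_csInf_lt H.contValues_nonempty
    (show sInf (contValues d a b) < χ + η' by linarith)
  obtain ⟨v', hv', hvv'⟩ := hU h hh.1 (hh.2.trans_le (min_le_left _ _)) v hv (by linarith)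
  have h1 : sInf (meshValues d a b h) ≤ χ + 2 * η' := (csInf_le hmb hv').trans (by linarith)
  obtain ⟨w, hw, hwX⟩ := exists_lt_of_csInf_lt (H.meshValues_nonempty hh.1)
    (show sInf (meshValues d a b h) < sInf (meshValues d a b h) + η' by linarith)
  obtain ⟨w', hw', hww'⟩ := hL h hh.1 (hh.2.trans_le (min_le_right _ _)) w hw (by linarith)
  have h2 : χ ≤ w' := csInf_le hcb hw'
  rw [Real.dist_eq, abs_lt]
  constructor <;> linarith

end Limit

end VarConv
end

noncomputable section
namespace VarConv

/-! ### The power and entropy potentials as split densities. -/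

section Densities

theorem pow0_nonneg {x : ℝ} (hx : 0 ≤ x) (γ : ℝ) : 0 ≤ pow0 x γ := by
  rw [pow0]; split_ifs <;> positivity

theorem pow0_of_pos {x : ℝ} (hx : 0 < x) (γ : ℝ) : pow0 x γ = x ^ γ := if_neg hx.ne'

theorem pow0_zero (γ : ℝ) : pow0 0 γ = 0 := if_pos rfl

theorem pow0_mono {x y γ : ℝ} (hγ : 0 ≤ γ) (hx : 0 ≤ x) (hxy : x ≤ y) : pow0 x γ ≤ pow0 y γ := by
  rcases hx.eq_or_lt with rfl | hx
  · rw [pow0_zero]; exact pow0_nonneg hxy γ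
  · rw [pow0_of_pos hx, pow0_of_pos (hx.trans_le hxy)]
    exact Real.rpow_le_rpow hx.le hxy hγ

theorem pow0_mul {c x γ : ℝ} (hc : 0 < c) (hx : 0 ≤ x) : pow0 (c * x) γ = c ^ γ * pow0 x γ := by
  rcases hx.eq_or_lt with rfl | hx
  · simp [pow0_zero]
  · rw [pow0_of_pos hx, pow0_of_pos (by positivity), Real.mul_rpow hc.le hx.le]

theorem measurable_pow0 (γ : ℝ) : Measurable fun x => pow0 x γ :=
  Measurable.ite (measurableSet_singleton 0) measurable_const (measurable_id.pow_const γ)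

/-- Cut at height 1: below it the power forms the bounded part a, above it w^γ is 1-Lipschitz, so b
has growth r = 0. Small w are dominated by a since w / w^γ = w^(1-γ) tends to 0, also for γ = 0. -/
theorem isSplitDensity_pow_lt_one {γ c : ℝ} (hγ : 0 ≤ γ) (hγ1 : γ < 1) (hc : 0 < c) :
    IsSplitDensity (fun w => c * pow0 (min w 1) γ) (fun w => c * (w - max w 1 ^ γ + 1)) 0 c c where
  a_meas := ((measurable_pow0 γ).comp (measurable_id.min measurable_const)).const_mul c
  b_meas := by fun_prop
  a_zero := by simp [pow0_zero]
  a_mono x y hx hxy := by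
    have := pow0_mono hγ (le_min hx zero_le_one) (min_le_min_right 1 hxy)
    gcongr
  a_le x hx := by
    have := pow0_mono hγ (le_min hx zero_le_one) (min_le_right x 1)
    rw [pow0_of_pos one_pos, Real.one_rpow] at this
    nlinarith
  a_scale t x ht hx := by
    have ht0 : 0 < t := by linarith
    have hm : 0 ≤ min x 1 := le_min hx zero_le_one
    have h1 : min (t * x) 1 ≤ t * min x 1 := by
      rw [mul_min_of_nonneg _ _ ht0.le, mul_one]
      exact min_le_min_left _ ht
    have h2 := pow0_mono hγ (le_min (by positivity) zero_le_one) h1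
    rw [pow0_mul ht0 hm] at h2
    have h3 : t ^ γ ≤ t := by
      simpa using Real.rpow_le_rpow_of_exponent_le ht hγ1.le
    have h4 := mul_le_mul_of_nonneg_right h3 (pow0_nonneg hm γ)
    have h5 := mul_le_mul_of_nonneg_left (h2.trans h4) hc.le
    linarith
  a_small := by
    right
    intro η hη
    have h1γ : 0 < 1 - γ := by linarith
    refine ⟨min 1 ((η * c) ^ (1 / (1 - γ))), by positivity, fun x hx hxε => ?_⟩
    rcases hx.eq_or_lt with rfl | hx
    · simp [pow0_zero]
    · have hx1 : x ≤ 1 := hxε.trans (min_le_left _ _)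
      rw [min_eq_left hx1, pow0_of_pos hx]
      have h1 : x ^ (1 - γ) ≤ η * c := by
        have := Real.rpow_le_rpow hx.le (hxε.trans (min_le_right _ _)) h1γ.le
        rwa [← Real.rpow_mul (by positivity), one_div, inv_mul_cancel₀ h1γ.ne',
          Real.rpow_one] at this
      have h2 : x = x ^ (1 - γ) * x ^ γ := by
        rw [← Real.rpow_add hx]; simp
      have h3 := mul_le_mul_of_nonneg_right h1 (Real.rpow_nonneg hx.le γ)
      linarith
  b_zero := by simp
  b_lip x y hx hxy := by
    have key : ∀ u v : ℝ, 1 ≤ u → u ≤ v → v ^ γ - u ^ γ ≤ v - u := by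
      intro u v hu huv
      have hu0 : 0 < u := by linarith
      have h1 : (v / u) ^ γ ≤ v / u := by
        simpa using Real.rpow_le_rpow_of_exponent_le ((one_le_div hu0).2 huv) hγ1.le
      have h2 : v ^ γ = u ^ γ * (v / u) ^ γ := by
        rw [← Real.mul_rpow hu0.le (div_nonneg (by linarith) hu0.le), mul_div_cancel₀ _ hu0.ne']
      have h3 : u ^ γ ≤ u := by
        simpa using Real.rpow_le_rpow_of_exponent_le hu hγ1.le
      have h4 : 0 ≤ v / u - 1 := sub_nonneg.2 ((one_le_div hu0).2 huv)
      calc v ^ γ - u ^ γ = u ^ γ * ((v / u) ^ γ - 1) := by rw [h2]; ring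
        _ ≤ u ^ γ * (v / u - 1) := by
            refine mul_le_mul_of_nonneg_left (by linarith) (by positivity)
        _ ≤ u * (v / u - 1) := mul_le_mul_of_nonneg_right h3 h4
        _ = v - u := by field_simp
    have hmax : max x 1 ≤ max y 1 := max_le_max_right _ hxy
    have h1 := key _ _ (le_max_right x 1) hmax
    have h2 : max y 1 - max x 1 ≤ y - x := by
      have := abs_max_sub_max_le_abs y x 1
      rw [abs_of_nonneg (sub_nonneg.2 hxy)] at this
      exact (le_abs_self _).trans this
    have h3 : max x 1 ^ γ ≤ max y 1 ^ γ := Real.rpow_le_rpow (zero_le_one.trans (le_max_right x 1)) hmax hγ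
    rw [← mul_sub, abs_mul, abs_of_pos hc, mul_assoc]
    refine mul_le_mul_of_nonneg_left ?_ hc.le
    rw [Real.rpow_zero, abs_le]
    constructor <;> nlinarith
  r_nonneg := le_rfl
  C_nonneg := hc.le

theorem split_pow_lt_one {γ c w : ℝ} :
    c * (pow0 w γ - w) = c * pow0 (min w 1) γ - c * (w - max w 1 ^ γ + 1) := by
  rcases le_total w 1 with h | h
  · rw [min_eq_left h, max_eq_right h, Real.one_rpow]; ring
  · rw [min_eq_right h, max_eq_left h, pow0_of_pos one_pos, Real.one_rpow,
      pow0_of_pos (by linarith)]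
    ring

/-- For γ > 1 there is no singular part at zero. The increment bound for w^γ is Bernoulli's
inequality, and the growth γ - 1 is what turns γ < 1 + 2/d into the subcriticality condition. -/
theorem isSplitDensity_pow_gt_one {γ c : ℝ} (hγ1 : 1 < γ) (hc : 0 < c) :
    IsSplitDensity (fun _ => 0) (fun w => c * (w ^ γ - w)) (γ - 1) (c * γ) 0 where
  a_meas := measurable_const
  b_meas := by fun_prop
  a_zero := rfl
  a_mono _ _ _ _ := le_rfl
  a_le _ _ := le_rfl
  a_scale _ _ _ _ := by simp
  a_small := Or.inl fun _ _ => rfl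
  b_zero := by rw [Real.zero_rpow (by linarith)]; simp
  b_lip x y hx hxy := by
    rcases (hx.trans hxy).eq_or_lt with h0 | hy
    · have : x = 0 := by linarith
      rw [← h0, this]; simp
    have h1 : y ^ γ - x ^ γ ≤ γ * y ^ (γ - 1) * (y - x) := by
      have h2 := one_add_mul_self_le_rpow_one_add (s := x / y - 1) (p := γ)
        (by have : 0 ≤ x / y := by positivity
            linarith) hγ1.le
      rw [add_sub_cancel, Real.div_rpow hx hy.le, le_div_iff₀ (by positivity)] at h2
      have h3 : y ^ γ = y ^ (γ - 1) * y := by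
        rw [← Real.rpow_add_one hy.ne']; simp
      have h4 : (1 + γ * (x / y - 1)) * y ^ γ = y ^ γ - γ * y ^ (γ - 1) * (y - x) := by
        rw [h3]; field_simp; ring
      linarith
    have h2 : x ^ γ ≤ y ^ γ := Real.rpow_le_rpow hx hxy (by linarith)
    rw [← mul_sub, abs_mul, abs_of_pos hc]
    have h3 : |y ^ γ - y - (x ^ γ - x)| ≤ γ * (y - x) * (1 + y ^ (γ - 1)) := by
      have : 0 ≤ y ^ (γ - 1) := by positivity
      have h4 : 0 ≤ γ * y ^ (γ - 1) * (y - x) :=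
        mul_nonneg (by positivity) (by linarith)
      rw [abs_le]
      constructor <;> nlinarith
    have := mul_le_mul_of_nonneg_left h3 hc.le
    linarith
  r_nonneg := by linarith
  C_nonneg := by positivity

/-- Tangent bounds for the convex function w log w, from log t ≤ t - 1 at t = y/x and t = x/y. -/
theorem mul_log_sub_bounds {x y : ℝ} (hx : 0 < x) (hxy : x ≤ y) :
    (y - x) * (1 + Real.log x) ≤ y * Real.log y - x * Real.log x ∧
      y * Real.log y - x * Real.log x ≤ (y - x) * (1 + Real.log y) := by
  have hy : 0 < y := hx.trans_le hxy
  have h1 := Real.log_le_sub_one_of_pos (div_pos hy hx)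
  have h2 := Real.log_le_sub_one_of_pos (div_pos hx hy)
  rw [Real.log_div hy.ne' hx.ne'] at h1
  rw [Real.log_div hx.ne' hy.ne'] at h2
  have h3 := mul_le_mul_of_nonneg_left h1 hx.le
  have h4 := mul_le_mul_of_nonneg_left h2 hy.le
  rw [mul_sub x, mul_sub x, mul_div_cancel₀ _ hx.ne'] at h3
  rw [mul_sub y, mul_sub y, mul_div_cancel₀ _ hy.ne'] at h4
  constructor <;> nlinarith

theorem negMulLog_mono {x y : ℝ} (hx : 0 ≤ x) (hxy : x ≤ y) (hy : y ≤ Real.exp (-1)) :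
    Real.negMulLog x ≤ Real.negMulLog y := by
  have he : Real.exp (-1) ≤ 1 := by
    rw [← Real.exp_zero]; exact Real.exp_le_exp.2 (by norm_num)
  rcases hx.eq_or_lt with rfl | hx
  · rw [Real.negMulLog_zero]; exact Real.negMulLog_nonneg hxy (hy.trans he)
  · have h1 := (mul_log_sub_bounds hx hxy).2
    have h2 : Real.log y ≤ -1 := by
      rw [← Real.log_exp (-1)]; exact Real.log_le_log (hx.trans_le hxy) hy
    rw [Real.negMulLog, Real.negMulLog]
    nlinarith

/-- Cut at 1/e, where -w log w is maximal: below it the function is increasing, hence admissible as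
a. Above it the derivative 1 + log w is dominated by a power; the choice 1/d is a convenient
exponent below 2/d. -/
theorem isSplitDensity_log {d : ℕ} (hd : 1 ≤ d) {ρ : ℝ} (hρ : 0 < ρ) :
    IsSplitDensity (fun w => ρ * Real.negMulLog (min w (Real.exp (-1))))
      (fun w => ρ * (Real.exp (-1) + max w (Real.exp (-1)) * Real.log (max w (Real.exp (-1)))))
      (1 / d) (ρ * (1 + d)) (ρ * Real.exp (-1)) := by
  have hd0 : (1 : ℝ) ≤ d := by exact_mod_cast hd
  set e := Real.exp (-1) with he
  have he0 : 0 < e := Real.exp_pos _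
  have hle : Real.log e = -1 := Real.log_exp _
  have he1 : e ≤ 1 := by
    rw [← Real.exp_zero]; exact Real.exp_le_exp.2 (by norm_num)
  have hne : Real.negMulLog e = e := by rw [Real.negMulLog, hle]; ring
  refine ⟨by fun_prop, ?_, ?_, ?_, ?_, ?_, ?_, ?_, ?_, by positivity, by positivity⟩
  · have : Measurable fun w : ℝ => max w e := measurable_id.max measurable_const
    exact ((this.mul (Real.measurable_log.comp this)).const_add e).const_mul ρ
  · simp [min_eq_left he0.le]
  · intro x y hx hxy
    exact mul_le_mul_of_nonneg_left
      (negMulLog_mono (le_min hx he0.le) (min_le_min_right e hxy) (min_le_right _ _)) hρ.le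
  · intro x hx
    refine mul_le_mul_of_nonneg_left ?_ hρ.le
    have := negMulLog_mono (le_min hx he0.le) (min_le_right x e) le_rfl
    rwa [hne] at this
  · intro t x ht hx
    have ht0 : 0 < t := by linarith
    have hm : 0 ≤ min x e := le_min hx he0.le
    suffices h : Real.negMulLog (min (t * x) e) ≤ t * Real.negMulLog (min x e) by
      have := mul_le_mul_of_nonneg_left h hρ.le
      linarith
    rcases hx.eq_or_lt with rfl | hx
    · simp [min_eq_left he0.le]
    have hm0 : 0 < min x e := lt_min hx he0
    have h1 : min (t * x) e ≤ t * min x e := by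
      rw [mul_min_of_nonneg _ _ ht0.le]
      exact min_le_min_left _ (by nlinarith)
    have h2 : min x e ≤ min (t * x) e := min_le_min_right e (by nlinarith)
    have h3 : Real.log (min x e) ≤ Real.log (min (t * x) e) := Real.log_le_log hm0 h2
    have h4 : Real.log (min x e) ≤ -1 := by
      rw [← hle]; exact Real.log_le_log hm0 (min_le_right _ _)
    have h5 : Real.log (min (t * x) e) ≤ -1 := by
      rw [← hle]; exact Real.log_le_log (hm0.trans_le h2) (min_le_right _ _)
    rw [Real.negMulLog, Real.negMulLog]
    nlinarith
  · right
    intro η hη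
    -- The maximum with 1 keeps x below 1/e, where the minimum in a is inactive; the other entry
    -- makes -ηρ log x at least 1.
    refine ⟨Real.exp (-(max 1 (1 / (η * ρ)))), Real.exp_pos _, fun x hx hxε => ?_⟩
    rcases hx.eq_or_lt with rfl | hx
    · simp [min_eq_left he0.le]
    have hxe : x ≤ e := hxε.trans (Real.exp_le_exp.2 (neg_le_neg (le_max_left _ _)))
    rw [min_eq_left hxe]
    have h1 : Real.log x ≤ -(1 / (η * ρ)) := by
      have := Real.log_le_log hx hxε
      rw [Real.log_exp] at this
      linarith [le_max_right 1 (1 / (η * ρ))]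
    have h2 : 1 ≤ η * ρ * (-Real.log x) := by
      have := mul_le_mul_of_nonneg_left (le_neg.2 h1) (show 0 ≤ η * ρ by positivity)
      rwa [mul_one_div_cancel (by positivity)] at this
    rw [Real.negMulLog]
    nlinarith
  · simp [max_eq_right he0.le, hle]
  · intro x y hx hxy
    rw [← mul_sub, abs_mul, abs_of_pos hρ, add_sub_add_left_eq_sub, mul_assoc, mul_assoc]
    refine mul_le_mul_of_nonneg_left ?_ hρ.le
    have hy0 : 0 ≤ y := hx.trans hxy
    have hyr : 0 ≤ y ^ (1 / (d : ℝ)) := by positivity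
    rcases le_total y e with hye | hye
    · rw [max_eq_right hye, max_eq_right (hxy.trans hye), sub_self, abs_zero]
      exact mul_nonneg (by positivity) (mul_nonneg (by linarith) (by linarith))
    · have hX : 0 < max x e := lt_max_of_lt_right he0
      have hXy : max x e ≤ y := max_le hxy hye
      obtain ⟨h1, h2⟩ := mul_log_sub_bounds hX hXy
      have h3 : -1 ≤ Real.log (max x e) := by
        rw [← hle]; exact Real.log_le_log he0 (le_max_right _ _)
      have h4 : 0 ≤ (y - max x e) * (1 + Real.log (max x e)) :=
        mul_nonneg (by linarith) (by linarith)
      have h5 : Real.log y ≤ d * y ^ (1 / (d : ℝ)) := by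
        have := Real.log_le_rpow_div hy0 (show 0 < 1 / (d : ℝ) by positivity)
        rwa [div_div_eq_mul_div, div_one, mul_comm] at this
      rw [max_eq_left hye, abs_of_nonneg (by linarith)]
      have h6 : (y - max x e) * (1 + Real.log y) ≤
          (y - x) * ((1 + d) * (1 + y ^ (1 / (d : ℝ)))) := by
        have h7 : Real.log (max x e) ≤ Real.log y := Real.log_le_log hX hXy
        refine mul_le_mul (by linarith [le_max_left x e]) ?_ (by linarith) (by linarith)
        nlinarith
      linarith

theorem split_log {ρ w : ℝ} :
    -ρ * (w * Real.log w) = ρ * Real.negMulLog (min w (Real.exp (-1))) -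
      ρ * (Real.exp (-1) + max w (Real.exp (-1)) * Real.log (max w (Real.exp (-1)))) := by
  rcases le_total w (Real.exp (-1)) with h | h
  · rw [min_eq_left h, max_eq_right h, Real.log_exp, Real.negMulLog]; ring
  · rw [min_eq_right h, max_eq_left h, Real.negMulLog, Real.log_exp]; ring

end Densities

end VarConv
end

noncomputable section
namespace VarConv

/-! ### Extended-valued integrals and infima. -/

section Extended

variable {α : Type*} [MeasurableSpace α] {μ : Measure α}

theorem eq_coe_of_forall_le {x : EReal} {S : Set ℝ} {c t : ℝ} (hS : S.Nonempty) (hc : 0 < c)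
    (h1 : ∀ v ∈ S, x ≤ ((c * v + t : ℝ) : EReal)) (h2 : ((c * sInf S + t : ℝ) : EReal) ≤ x) :
    x = ((c * sInf S + t : ℝ) : EReal) := by
  refine le_antisymm ?_ h2
  by_contra! hlt
  obtain ⟨y, hy1, hy2⟩ := EReal.lt_iff_exists_real_btwn.1 hlt
  rw [EReal.coe_lt_coe_iff] at hy1
  have h3 : sInf S < (y - t) / c := by rw [lt_div_iff₀ hc]; linarith
  obtain ⟨v, hv, hvy⟩ := exists_lt_of_csInf_lt hS h3
  rw [lt_div_iff₀ hc] at hvy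
  have h4 : ((c * v + t : ℝ) : EReal) ≤ y := EReal.coe_le_coe_iff.2 (by linarith)
  exact absurd ((h1 v hv).trans h4) (not_le.2 hy2)

theorem extSum_eq_extIntegral [MeasurableSingletonClass α] (f : α → ℝ) :
    extSum f = extIntegral Measure.count f := by
  rw [extSum, extIntegral, lintegral_count, lintegral_count]

theorem coe_toReal_ennreal {x : ℝ≥0∞} (hx : x ≠ ⊤) : ((x.toReal : ℝ) : EReal) = x := by
  lift x to NNReal using hx
  rfl

theorem extIntegral_eq_integral {f : α → ℝ} (hf : Integrable f μ) :
    extIntegral μ f = ((∫ x, f x ∂μ : ℝ) : EReal) := by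
  have h1 := hf.lintegral_lt_top.ne
  have h2 : ∫⁻ x, ENNReal.ofReal (-f x) ∂μ ≠ ⊤ := hf.neg.lintegral_lt_top.ne
  rw [extIntegral, integral_eq_lintegral_pos_part_sub_lintegral_neg_part hf, EReal.coe_sub,
    coe_toReal_ennreal h1, coe_toReal_ennreal h2]

theorem mul_extIntegral_eq {c : ℝ} (hc : c ≠ 0) {f a b : α → ℝ}
    (hf : ∀ x, c * f x = a x - b x) (ha : Integrable a μ) (hb : Integrable b μ) :
    (c : EReal) * extIntegral μ f = (((∫ x, a x ∂μ) - ∫ x, b x ∂μ : ℝ) : EReal) := by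
  have h1 : f = fun x => c⁻¹ * (a x - b x) := by
    funext x; rw [← hf, inv_mul_cancel_left₀ hc]
  have h2 : Integrable f μ := by rw [h1]; exact (ha.sub hb).const_mul _
  rw [extIntegral_eq_integral h2, ← EReal.coe_mul, ← integral_const_mul, ← integral_sub ha hb]
  simp_rw [hf]

theorem lintegral_ofReal_mul {c : ℝ} (hc : 0 < c) (f : α → ℝ) :
    ∫⁻ x, ENNReal.ofReal (c * f x) ∂μ = ENNReal.ofReal c * ∫⁻ x, ENNReal.ofReal (f x) ∂μ := by
  rw [← lintegral_const_mul' _ _ ENNReal.ofReal_ne_top]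
  simp_rw [ENNReal.ofReal_mul hc.le]

/-- Competitors for which a is not integrable cost +∞ and can be dropped from the infimum. When c <
0 it is the negative part of f that diverges, and the product is again +∞. -/
theorem mul_extIntegral_eq_top {c : ℝ} (hc : c ≠ 0) {f a b : α → ℝ}
    (hf : ∀ x, c * f x = a x - b x) (ham : AEStronglyMeasurable a μ) (ha0 : ∀ x, 0 ≤ a x)
    (ha : ¬ Integrable a μ) (hb : Integrable b μ) : (c : EReal) * extIntegral μ f = ⊤ := by
  have hpos : ∫⁻ x, ENNReal.ofReal (c * f x) ∂μ = ⊤ := by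
    by_contra h
    refine ha ⟨ham, ?_⟩
    rw [hasFiniteIntegral_iff_ofReal (Eventually.of_forall ha0)]
    calc ∫⁻ x, ENNReal.ofReal (a x) ∂μ
        ≤ ∫⁻ x, (ENNReal.ofReal (c * f x) + ENNReal.ofReal (b x)) ∂μ := by
          refine lintegral_mono fun x => ?_
          rw [show a x = c * f x + b x by rw [hf]; ring]
          exact ENNReal.ofReal_add_le
      _ = ∫⁻ x, ENNReal.ofReal (c * f x) ∂μ + ∫⁻ x, ENNReal.ofReal (b x) ∂μ :=
          lintegral_add_right' _ hb.aemeasurable.ennreal_ofReal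
      _ < ⊤ := ENNReal.add_lt_top.2 ⟨lt_top_iff_ne_top.2 h, hb.lintegral_lt_top⟩
  have hneg : ∫⁻ x, ENNReal.ofReal (-(c * f x)) ∂μ ≠ ⊤ := by
    refine ((lintegral_mono fun x => ENNReal.ofReal_le_ofReal ?_).trans_lt hb.lintegral_lt_top).ne
    rw [hf]; linarith [ha0 x]
  rcases hc.lt_or_gt with hc | hc
  · have h1 : ∀ x, c * f x = -c * -f x := fun x => by ring
    have h2 : ∀ x, -(c * f x) = -c * f x := fun x => by ring
    simp_rw [h1] at hpos
    simp_rw [h2] at hneg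
    rw [lintegral_ofReal_mul (neg_pos.2 hc), ENNReal.mul_eq_top] at hpos
    rw [lintegral_ofReal_mul (neg_pos.2 hc)] at hneg
    have h3 : ∫⁻ x, ENNReal.ofReal (-f x) ∂μ = ⊤ := by simpa [hc] using hpos
    rw [extIntegral, h3, EReal.coe_ennreal_top, EReal.sub_top, EReal.coe_mul_bot_of_neg hc]
  · have h2 : ∀ x, -(c * f x) = c * -f x := fun x => by ring
    simp_rw [h2] at hneg
    rw [lintegral_ofReal_mul hc, ENNReal.mul_eq_top] at hpos
    rw [lintegral_ofReal_mul hc] at hneg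
    have h3 : ∫⁻ x, ENNReal.ofReal (f x) ∂μ = ⊤ := by simpa [hc] using hpos
    have h4 : ∫⁻ x, ENNReal.ofReal (-f x) ∂μ ≠ ⊤ := by
      intro h4
      rw [h4, ENNReal.mul_top (by simpa using hc)] at hneg
      exact hneg rfl
    rw [extIntegral, h3, EReal.coe_ennreal_top, EReal.top_sub (by simpa using h4),
      EReal.coe_mul_top_of_pos hc]

end Extended

/-! ### The functionals in terms of their finite values. -/

section Values

variable {d : ℕ} {a b : ℝ → ℝ} {r C A : ℝ}

theorem IsSplitDensity.integrable_b_of_isUnitH1 (H : IsSplitDensity a b r C A) (hd : 1 ≤ d)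
    (hr : r < 2 / (d : ℝ)) {g : Euc d → ℝ} {G : Euc d → Euc d} (hg : IsUnitH1 g G) :
    Integrable (fun x => b (g x ^ 2)) volume := by
  obtain ⟨C', hC', hco⟩ := H.exists_coercive hd hr
  obtain ⟨g₀, hg₀m, hg₀0, hae, hg₀i, hg₀1, k, hk0, hkG, hinc⟩ := hg.exists_representative
  have hbs := boundedOrSlow_of_increment hg₀m.aestronglyMeasurable hk0 hinc
  have hk2 := sq_sum_le_dim_mul k
  have hkn := sum_sq_nonneg k
  refine (hco g₀ _ _ hg₀m hg₀0 hg₀i hg₀1 hbs hkn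
    (hk2.trans (by nlinarith [mul_nonneg (Nat.cast_nonneg (α := ℝ) d) hkn]))).1.congr ?_
  exact hae.mono fun x hx => by simp only [hx]

theorem IsSplitDensity.integrable_b_of_stepFun (H : IsSplitDensity a b r C A) (hd : 1 ≤ d)
    (hr : r < 2 / (d : ℝ)) {h : ℝ} (hh : 0 < h) {u : (Fin d → ℤ) → ℝ} (hu0 : ∀ z, 0 ≤ u z)
    (hi : Integrable (fun x : Euc d => stepFun h u x ^ 2) volume)
    (h1 : ∫ x : Euc d, stepFun h u x ^ 2 = 1) :
    Integrable (fun x : Euc d => b (stepFun h u x ^ 2)) volume := by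
  obtain ⟨C', hC', hco⟩ := H.exists_coercive hd hr
  obtain ⟨hk0, hinc, hbs⟩ := stepFun_data hh hi h1
  have hk2 := sq_sum_le_dim_mul (meshSlope h u)
  exact (hco _ _ _ (measurable_stepFun h u) (fun x => hu0 _) hi h1 hbs
    (sum_sq_nonneg (meshSlope h u)) (by rw [mul_pow]; linarith)).1

theorem IsSplitDensity.iInf_isUnitH1_eq (H : IsSplitDensity a b r C A) (hd : 1 ≤ d)
    (hr : r < 2 / (d : ℝ)) {c : ℝ} (hc : c ≠ 0) {f : ℝ → ℝ}
    (hf : ∀ w, 0 ≤ w → c * f w = a w - b w) :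
    ⨅ (g : EuclideanSpace ℝ (Fin d) → ℝ)
      (G : EuclideanSpace ℝ (Fin d) → EuclideanSpace ℝ (Fin d)) (_ : IsUnitH1 g G),
      ((∫ x, ‖G x‖ ^ 2 : ℝ) : EReal) + (c : EReal) * extIntegral volume (fun x => f (g x ^ 2)) =
    ((sInf (contValues d a b) : ℝ) : EReal) := by
  have key := eq_coe_of_forall_le (x := ⨅ (g : EuclideanSpace ℝ (Fin d) → ℝ)
      (G : EuclideanSpace ℝ (Fin d) → EuclideanSpace ℝ (Fin d)) (_ : IsUnitH1 g G),
      ((∫ x, ‖G x‖ ^ 2 : ℝ) : EReal) + (c : EReal) * extIntegral volume (fun x => f (g x ^ 2)))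
    (t := 0) (H.contValues_nonempty (d := d)) one_pos ?_ ?_
  · simpa using key
  · rintro v ⟨g, G, hg, ha, rfl⟩
    refine iInf_le_of_le g (iInf_le_of_le G (iInf_le_of_le hg ?_))
    rw [mul_extIntegral_eq hc (fun x => hf _ (sq_nonneg (g x))) ha
      (H.integrable_b_of_isUnitH1 hd hr hg), ← EReal.coe_add, one_mul, add_zero]
  · refine le_iInf fun g => le_iInf fun G => le_iInf fun hg => ?_
    by_cases ha : Integrable (fun x => a (g x ^ 2)) volume
    · rw [mul_extIntegral_eq hc (fun x => hf _ (sq_nonneg (g x))) ha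
        (H.integrable_b_of_isUnitH1 hd hr hg), ← EReal.coe_add, one_mul, add_zero,
        EReal.coe_le_coe_iff]
      exact csInf_le (H.bddBelow_contValues hd hr) ⟨g, G, hg, ha, rfl⟩
    · rw [mul_extIntegral_eq_top hc (fun x => hf _ (sq_nonneg (g x)))
        (H.a_meas.comp_aemeasurable (hg.memLp.1.aemeasurable.pow_const 2)).aestronglyMeasurable
        (fun x => H.a_nonneg (sq_nonneg _)) ha (H.integrable_b_of_isUnitH1 hd hr hg),
        EReal.coe_add_top]
      exact le_top

/-- Summation by parts: in each direction e, both sides equal 2 ∑ v(z)² - 2 ∑ v(z+e) v(z). Square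
summability justifies the shifts of index. -/
theorem tsum_latticeLaplacian_mul {v : (Fin d → ℤ) → ℝ} (hv : Summable fun z => v z ^ 2) :
    -∑' z, latticeLaplacian v z * v z =
      ∑ i : Fin d, ∑' z, (v (z + Pi.single i 1) - v z) ^ 2 := by
  have key : ∀ i : Fin d, ∃ P : ℝ,
      HasSum (fun z => ((v (z + Pi.single i 1) - v z) + (v (z - Pi.single i 1) - v z)) * v z)
        (-P) ∧ HasSum (fun z => (v (z + Pi.single i 1) - v z) ^ 2) P := by
    intro i
    set e : Fin d → ℤ := Pi.single i 1
    have h1 : HasSum (fun z => v (z + e) ^ 2) (∑' z, v z ^ 2) :=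
      ((Equiv.addRight e).hasSum_iff (f := fun z => v z ^ 2)).2 hv.hasSum
    have h2 : Summable fun z => v (z + e) * v z := by
      refine Summable.of_norm_bounded (h1.summable.add hv) fun z => ?_
      rw [Real.norm_eq_abs, abs_mul]
      nlinarith [sq_abs (v (z + e)), sq_abs (v z), sq_nonneg (|v (z + e)| - |v z|),
        sq_nonneg (v (z + e)), sq_nonneg (v z)]
    have h3 : HasSum (fun z => v (z - e) * v z) (∑' z, v (z + e) * v z) := by
      refine ((Equiv.addRight e).hasSum_iff (f := fun z => v (z - e) * v z)).1 ?_
      refine h2.hasSum.congr_fun ?_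
      intro z
      simp [mul_comm]
    refine ⟨2 * ∑' z, v z ^ 2 - 2 * ∑' z, v (z + e) * v z, ?_, ?_⟩
    · rw [neg_sub, two_mul (∑' z, v (z + e) * v z)]
      exact ((h2.hasSum.add h3).sub (hv.hasSum.mul_left 2)).congr_fun fun z => by ring
    · rw [two_mul (∑' z, v z ^ 2)]
      exact ((h1.add hv.hasSum).sub (h2.hasSum.mul_left 2)).congr_fun fun z => by ring
  choose P hP1 hP2 using key
  have h4 : HasSum (fun z => latticeLaplacian v z * v z) (∑ i, -P i) := by
    convert hasSum_sum (s := Finset.univ) fun i _ => hP1 i using 1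
    funext z
    rw [latticeLaplacian, Finset.sum_mul]
  rw [h4.tsum_eq, Finset.sum_neg_distrib, neg_neg]
  exact Finset.sum_congr rfl fun i _ => (hP2 i).tsum_eq.symm

theorem sq_mul_meshSlope_sq {h : ℝ} (hh : 0 < h) (u : (Fin d → ℤ) → ℝ) (i : Fin d)
    (hs : Summable fun z => (u (z + Pi.single i 1) - u z) ^ 2) :
    h ^ 2 * meshSlope h u i ^ 2 = h ^ d * ∑' z, (u (z + Pi.single i 1) - u z) ^ 2 := by
  rw [meshSlope, mul_pow, ← mul_assoc, ← mul_pow, mul_inv_cancel₀ hh.ne', one_pow, one_mul,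
    ← ENNReal.toReal_pow, increment_stepFun_sq hh,
    ← ENNReal.ofReal_tsum_of_nonneg (fun z => sq_nonneg _) hs, ENNReal.toReal_mul,
    ENNReal.toReal_pow, ENNReal.toReal_ofReal hh.le,
    ENNReal.toReal_ofReal (tsum_nonneg fun z => sq_nonneg _)]

end Values

end VarConv
end

noncomputable section
namespace VarConv

/-! ### Lattice probability measures as squared step functions. -/

section Lattice

variable {d : ℕ} {a b : ℝ → ℝ} {r C A : ℝ}

theorem summable_sub_sq {v : (Fin d → ℤ) → ℝ} (hv : Summable fun z => v z ^ 2) (e : Fin d → ℤ) :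
    Summable fun z => (v (z + e) - v z) ^ 2 := by
  have h1 : Summable fun z => v (z + e) ^ 2 :=
    ((Equiv.addRight e).summable_iff (f := fun z => v z ^ 2)).2 hv
  refine Summable.of_nonneg_of_le (fun z => sq_nonneg _) (fun z => ?_)
    ((h1.add hv).mul_left 2)
  nlinarith [sq_nonneg (v (z + e) + v z)]

/-- The lattice measure `p` is the square of the step function of mesh `h` with values `u`. -/
structure IsMeshDensity (h : ℝ) (p : PMF (Fin d → ℤ)) (u : (Fin d → ℤ) → ℝ) : Prop where
  nonneg : ∀ z, 0 ≤ u z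
  eq_mul_sq : ∀ z, (p z).toReal = h ^ d * u z ^ 2

namespace IsMeshDensity

variable {h : ℝ} {p : PMF (Fin d → ℤ)} {u : (Fin d → ℤ) → ℝ}

theorem hasSum_toReal (p : PMF (Fin d → ℤ)) : HasSum (fun z => (p z).toReal) 1 := by
  have h1 := ENNReal.hasSum_toReal p.tsum_coe_ne_top
  have h2 := ENNReal.tsum_toReal_eq p.apply_ne_top
  rwa [← h2, p.tsum_coe, ENNReal.toReal_one] at h1

theorem summable_sq (D : IsMeshDensity h p u) (hh : 0 < h) : Summable fun z => u z ^ 2 := by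
  have h1 := (hasSum_toReal p).summable.mul_left (h ^ d)⁻¹
  simp_rw [D.eq_mul_sq, inv_mul_cancel_left₀ (pow_pos hh d).ne'] at h1
  exact h1

theorem integrable_sq (D : IsMeshDensity h p u) (hh : 0 < h) :
    Integrable (fun x : Euc d => stepFun h u x ^ 2) volume :=
  (integrable_stepFun (d := d) hh (v := fun z => u z ^ 2)).2 (D.summable_sq hh)

theorem integral_sq (D : IsMeshDensity h p u) (hh : 0 < h) :
    ∫ x : Euc d, stepFun h u x ^ 2 = 1 := by
  refine (integral_stepFun (d := d) hh (D.summable_sq hh)).trans ?_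
  rw [← tsum_mul_left]
  simp_rw [← D.eq_mul_sq]
  exact (hasSum_toReal p).tsum_eq

theorem dirichletEnergy_eq (D : IsMeshDensity h p u) (hh : 0 < h) :
    dirichletEnergy p = h ^ 2 * ∑ i, meshSlope h u i ^ 2 := by
  have hv : ∀ z, √(p z).toReal = √(h ^ d) * u z := fun z => by
    rw [D.eq_mul_sq, Real.sqrt_mul (by positivity), Real.sqrt_sq (D.nonneg z)]
  have hs : Summable fun z => (√(p z).toReal) ^ 2 :=
    (hasSum_toReal p).summable.congr fun z => (Real.sq_sqrt ENNReal.toReal_nonneg).symm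
  rw [dirichletEnergy, tsum_latticeLaplacian_mul hs, Finset.mul_sum]
  refine Finset.sum_congr rfl fun i _ => ?_
  rw [sq_mul_meshSlope_sq hh u i (summable_sub_sq (D.summable_sq hh) _), ← tsum_mul_left]
  refine tsum_congr fun z => ?_
  rw [hv, hv, ← mul_sub, mul_pow, Real.sq_sqrt (by positivity)]

/-- The scaling identity for f has a linear defect t h^d w, which sums to t because p has mass one.
For integrability questions the defect is absorbed into the b-part. -/
theorem mul_extSum (D : IsMeshDensity h p u) (H : IsSplitDensity a b r C A) (hd : 1 ≤ d)
    (hr : r < 2 / (d : ℝ)) (hh : 0 < h) {c t : ℝ} (hc : c ≠ 0) {f : ℝ → ℝ}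
    (hf : ∀ w, 0 ≤ w → c * f (h ^ d * w) = h ^ (2 + d) * (a w - b w) + t * (h ^ d * w)) :
    (Integrable (fun x : Euc d => a (stepFun h u x ^ 2)) volume →
      (c : EReal) * extSum (fun z => f (p z).toReal) =
        ((h ^ 2 * ((∫ x : Euc d, a (stepFun h u x ^ 2)) - ∫ x : Euc d, b (stepFun h u x ^ 2)) + t :
          ℝ) : EReal)) ∧
    (¬ Integrable (fun x : Euc d => a (stepFun h u x ^ 2)) volume →
      (c : EReal) * extSum (fun z => f (p z).toReal) = ⊤) := by
  have hb := H.integrable_b_of_stepFun hd hr hh D.nonneg (D.integrable_sq hh) (D.integral_sq hh)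
  have hbs : Summable fun z => b (u z ^ 2) :=
    (integrable_stepFun (d := d) hh (v := fun z => b (u z ^ 2))).1 hb
  have hp := hasSum_toReal p
  have hb' : Integrable (fun z => h ^ (2 + d) * b (u z ^ 2) - t * (p z).toReal)
      (Measure.count : Measure (Fin d → ℤ)) := by
    rw [integrable_count_iff]
    exact ((hbs.mul_left _).sub (hp.summable.mul_left t)).norm
  have hf' : ∀ z, c * f (p z).toReal =
      h ^ (2 + d) * a (u z ^ 2) - (h ^ (2 + d) * b (u z ^ 2) - t * (p z).toReal) := fun z => by
    rw [D.eq_mul_sq, hf _ (sq_nonneg _)]; ring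
  have hpos : 0 < h ^ (2 + d) := by positivity
  have ha : Integrable (fun x : Euc d => a (stepFun h u x ^ 2)) volume ↔
      Summable fun z => a (u z ^ 2) :=
    integrable_stepFun (d := d) hh (v := fun z => a (u z ^ 2))
  have ha' : Integrable (fun z => h ^ (2 + d) * a (u z ^ 2))
      (Measure.count : Measure (Fin d → ℤ)) ↔ Summable fun z => a (u z ^ 2) := by
    rw [integrable_count_iff, summable_norm_iff, summable_mul_left_iff hpos.ne']
  rw [extSum_eq_extIntegral]
  constructor
  · intro hi
    rw [mul_extIntegral_eq hc hf' (ha'.2 (ha.1 hi)) hb']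
    congr 1
    have e1 : ∫ x : Euc d, a (stepFun h u x ^ 2) = h ^ d * ∑' z, a (u z ^ 2) :=
      integral_stepFun (d := d) hh (ha.1 hi)
    have e2 : ∫ x : Euc d, b (stepFun h u x ^ 2) = h ^ d * ∑' z, b (u z ^ 2) :=
      integral_stepFun (d := d) hh hbs
    rw [e1, e2, integral_countable (ha'.2 (ha.1 hi)), integral_countable hb']
    simp only [Measure.real, Measure.count_singleton, ENNReal.toReal_one, one_smul]
    rw [tsum_mul_left, (hbs.mul_left _).tsum_sub (hp.summable.mul_left t), tsum_mul_left,
      tsum_mul_left, hp.tsum_eq]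
    ring
  · intro hi
    exact mul_extIntegral_eq_top hc hf' (measurable_of_countable _).aestronglyMeasurable
      (fun z => mul_nonneg hpos.le (H.a_nonneg (sq_nonneg _)))
      (fun h' => hi (ha.2 (ha'.1 h'))) hb'

end IsMeshDensity

theorem exists_isMeshDensity {h : ℝ} (hh : 0 < h) (p : PMF (Fin d → ℤ)) :
    ∃ u, IsMeshDensity h p u := by
  refine ⟨fun z => √((p z).toReal / h ^ d), fun z => Real.sqrt_nonneg _, fun z => ?_⟩
  have : 0 < h ^ d := by positivity
  rw [Real.sq_sqrt (by positivity), mul_div_cancel₀ _ this.ne']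

theorem exists_pmf_isMeshDensity {h : ℝ} (hh : 0 < h) {u : (Fin d → ℤ) → ℝ} (hu : ∀ z, 0 ≤ u z)
    (hi : Integrable (fun x : Euc d => stepFun h u x ^ 2) volume)
    (h1 : ∫ x : Euc d, stepFun h u x ^ 2 = 1) : ∃ p, IsMeshDensity h p u := by
  have hs : Summable fun z => u z ^ 2 :=
    (integrable_stepFun (d := d) hh (v := fun z => u z ^ 2)).1 hi
  have h2 : h ^ d * ∑' z, u z ^ 2 = 1 := (integral_stepFun (d := d) hh hs).symm.trans h1
  have h0 : ∀ z, 0 ≤ h ^ d * u z ^ 2 := fun z => by positivity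
  have h3 : ∑' z, ENNReal.ofReal (h ^ d * u z ^ 2) = 1 := by
    rw [← ENNReal.ofReal_tsum_of_nonneg h0 (hs.mul_left _), tsum_mul_left, h2, ENNReal.ofReal_one]
  exact ⟨⟨fun z => ENNReal.ofReal (h ^ d * u z ^ 2), h3 ▸ ENNReal.summable.hasSum⟩, hu,
    fun z => ENNReal.toReal_ofReal (h0 z)⟩

theorem IsSplitDensity.iInf_pmf_eq (H : IsSplitDensity a b r C A) (hd : 1 ≤ d)
    (hr : r < 2 / (d : ℝ)) {h : ℝ} (hh : 0 < h) {c t : ℝ} (hc : c ≠ 0) {f : ℝ → ℝ}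
    (hf : ∀ w, 0 ≤ w → c * f (h ^ d * w) = h ^ (2 + d) * (a w - b w) + t * (h ^ d * w)) :
    ⨅ p : PMF (Fin d → ℤ), (dirichletEnergy p : EReal) +
      (c : EReal) * extSum (fun z => f (p z).toReal) =
    ((h ^ 2 * sInf (meshValues d a b h) + t : ℝ) : EReal) := by
  refine eq_coe_of_forall_le (H.meshValues_nonempty hh) (by positivity) ?_ ?_
  · rintro v ⟨u, hu, hi, h1, ha, rfl⟩
    obtain ⟨p, D⟩ := exists_pmf_isMeshDensity hh hu hi h1
    refine iInf_le_of_le p ?_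
    rw [(D.mul_extSum H hd hr hh hc hf).1 ha, D.dirichletEnergy_eq hh, ← EReal.coe_add, ← add_assoc,
      ← mul_add]
  · refine le_iInf fun p => ?_
    obtain ⟨u, D⟩ := exists_isMeshDensity hh p
    by_cases ha : Integrable (fun x : Euc d => a (stepFun h u x ^ 2)) volume
    · rw [(D.mul_extSum H hd hr hh hc hf).1 ha, D.dirichletEnergy_eq hh, ← EReal.coe_add,
        ← add_assoc, ← mul_add, EReal.coe_le_coe_iff]
      have := csInf_le (H.bddBelow_meshValues hd hr hh)
        ⟨u, D.nonneg, D.integrable_sq hh, D.integral_sq hh, ha, rfl⟩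
      gcongr
    · rw [(D.mul_extSum H hd hr hh hc hf).2 ha, EReal.coe_add_top]
      exact le_top

end Lattice

/-! ### Scaling identities for the four variational problems. -/

section Conclusion

variable {d : ℕ}

theorem exists_isSplitDensity_log (hd : 1 ≤ d) {ρ : ℝ} (hρ : 0 < ρ) :
    ∃ a b r C A, IsSplitDensity a b r C A ∧ r < 2 / (d : ℝ) ∧
      ∀ w, 0 ≤ w → -ρ * (w * Real.log w) = a w - b w := by
  have hd0 : (0 : ℝ) < d := by exact_mod_cast hd
  exact ⟨_, _, _, _, _, isSplitDensity_log hd hρ, by gcongr; norm_num, fun w _ => split_log⟩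

theorem exists_isSplitDensity_pow (hd : 1 ≤ d) {γ ρ : ℝ} (hρ : 0 < ρ) (hγ : 0 ≤ γ)
    (hγd : γ < 1 + 2 / (d : ℝ)) (hγ1 : γ ≠ 1) :
    ∃ a b r C A, IsSplitDensity a b r C A ∧ r < 2 / (d : ℝ) ∧
      ∀ w, 0 ≤ w → ρ / (1 - γ) * (pow0 w γ - w) = a w - b w := by
  have hd0 : (0 : ℝ) < d := by exact_mod_cast hd
  rcases hγ1.lt_or_gt with h | h
  · exact ⟨_, _, _, _, _, isSplitDensity_pow_lt_one hγ h (div_pos hρ (sub_pos.2 h)),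
      by positivity, fun w _ => split_pow_lt_one⟩
  · refine ⟨_, _, _, _, _, isSplitDensity_pow_gt_one h (div_pos hρ (sub_pos.2 h)),
      by linarith, fun w hw => ?_⟩
    have h1 : pow0 w γ = w ^ γ := by
      rcases hw.eq_or_lt with rfl | hw
      · rw [pow0_zero, Real.zero_rpow (by linarith)]
      · exact pow0_of_pos hw γ
    rw [h1, ← neg_sub γ 1, div_neg]
    ring

theorem IsSplitDensity.chiB_eq {a b : ℝ → ℝ} {r C A : ℝ} (H : IsSplitDensity a b r C A)
    (hd : 1 ≤ d) (hr : r < 2 / (d : ℝ)) {γ ρ : ℝ} (hρ : 0 < ρ) (hγ1 : γ ≠ 1)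
    (hab : ∀ w, 0 ≤ w → ρ / (1 - γ) * (pow0 w γ - w) = a w - b w) :
    chiB d γ ρ = ((sInf (contValues d a b) : ℝ) : EReal) :=
  H.iInf_isUnitH1_eq hd hr (div_ne_zero hρ.ne' (sub_ne_zero.2 hγ1.symm))
    (f := fun w => pow0 w γ - w) hab

theorem chiAB_eq_iInf (ρ : ℝ) :
    chiAB d ρ = ⨅ (g : EuclideanSpace ℝ (Fin d) → ℝ)
      (G : EuclideanSpace ℝ (Fin d) → EuclideanSpace ℝ (Fin d)) (_ : IsUnitH1 g G),
      ((∫ x, ‖G x‖ ^ 2 : ℝ) : EReal) +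
        ((-ρ : ℝ) : EReal) * extIntegral volume (fun x => g x ^ 2 * Real.log (g x ^ 2)) := by
  simp_rw [chiAB, sub_eq_add_neg, EReal.coe_neg, EReal.neg_mul]

theorem chiDE_eq_iInf (ρ : ℝ) :
    chiDE d ρ = ⨅ p : PMF (Fin d → ℤ), (dirichletEnergy p : EReal) +
      ((-ρ : ℝ) : EReal) * extSum (fun z => (p z).toReal * Real.log (p z).toReal) := by
  simp_rw [chiDE, sub_eq_add_neg, EReal.coe_neg, EReal.neg_mul]

theorem IsSplitDensity.chiAB_eq {a b : ℝ → ℝ} {r C A : ℝ} (H : IsSplitDensity a b r C A)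
    (hd : 1 ≤ d) (hr : r < 2 / (d : ℝ)) {ρ : ℝ} (hρ : 0 < ρ)
    (hab : ∀ w, 0 ≤ w → -ρ * (w * Real.log w) = a w - b w) :
    chiAB d ρ = ((sInf (contValues d a b) : ℝ) : EReal) := by
  rw [chiAB_eq_iInf]
  exact H.iInf_isUnitH1_eq hd hr (neg_ne_zero.2 hρ.ne') (f := fun w => w * Real.log w) hab

/-- From log (h^d w) = d log h + log w: the first term is linear in w and becomes the additive
constant. -/
theorem IsSplitDensity.chiDE_eq {a b : ℝ → ℝ} {r C A : ℝ} (H : IsSplitDensity a b r C A)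
    (hd : 1 ≤ d) (hr : r < 2 / (d : ℝ)) {ρ : ℝ} (hρ : 0 < ρ)
    (hab : ∀ w, 0 ≤ w → -ρ * (w * Real.log w) = a w - b w) {h : ℝ} (hh : 0 < h) :
    chiDE d (ρ * h ^ 2) =
      ((h ^ 2 * sInf (meshValues d a b h) + -(ρ * h ^ 2 * (d * Real.log h)) : ℝ) : EReal) := by
  rw [chiDE_eq_iInf]
  refine H.iInf_pmf_eq hd hr hh (neg_ne_zero.2 (by positivity)) (f := fun w => w * Real.log w) ?_
  intro w hw
  rw [← hab w hw]
  rcases hw.eq_or_lt with rfl | hw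
  · simp
  · rw [Real.log_mul (by positivity) hw.ne', Real.log_pow]
    ring

/-- The coupling is scaled so that the power term acquires the factor h^(2+d), matching the
Dirichlet energy. The linear term scales differently, and the mismatch is the additive constant. -/
theorem IsSplitDensity.chiDB_eq {a b : ℝ → ℝ} {r C A : ℝ} (H : IsSplitDensity a b r C A)
    (hd : 1 ≤ d) (hr : r < 2 / (d : ℝ)) {γ ρ : ℝ} (hρ : 0 < ρ) (hγ1 : γ ≠ 1)
    (hab : ∀ w, 0 ≤ w → ρ / (1 - γ) * (pow0 w γ - w) = a w - b w) {h : ℝ} (hh : 0 < h) :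
    chiDB d γ (ρ * h ^ (2 + d * (1 - γ))) =
      ((h ^ 2 * sInf (meshValues d a b h) + ρ / (1 - γ) * (h ^ 2 - h ^ (2 + d * (1 - γ))) : ℝ) :
        EReal) := by
  have hγ0 : 1 - γ ≠ 0 := sub_ne_zero.2 hγ1.symm
  refine H.iInf_pmf_eq hd hr hh (div_ne_zero (by positivity) hγ0) (f := fun w => pow0 w γ - w) ?_
  intro w hw
  rw [← hab w hw, pow0_mul (by positivity) hw]
  have h1 : h ^ (2 + d * (1 - γ)) * (h ^ d) ^ γ = h ^ (2 + d) := by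
    rw [← Real.rpow_natCast h d, ← Real.rpow_mul hh.le, ← Real.rpow_add hh,
      ← Real.rpow_natCast h (2 + d)]
    congr 1
    push_cast
    ring
  rw [pow_add] at h1 ⊢
  linear_combination ρ / (1 - γ) * pow0 w γ * h1

theorem tendsto_rpow_neg_nhdsGT_zero {s : ℝ} (hs : 0 < s) :
    Tendsto (fun κ : ℝ => κ ^ (-s)) atTop (𝓝[>] 0) :=
  tendsto_nhdsWithin_iff.2 ⟨tendsto_rpow_neg_atTop hs,
    (eventually_gt_atTop 0).mono fun _ hκ => Real.rpow_pos_of_pos hκ _⟩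

end Conclusion

end VarConv
end

theorem mainTheorem3 (d : ℕ) (hd : 1 ≤ d) (ρ : ℝ) (hρ : 0 < ρ) :
    ((VarConv.chiAB d ρ ≠ ⊥ ∧ VarConv.chiAB d ρ ≠ ⊤) ∧
      (∀ κ : ℝ, 0 < κ → VarConv.chiDE d (ρ / κ) ≠ ⊥ ∧ VarConv.chiDE d (ρ / κ) ≠ ⊤) ∧
      Tendsto
        (fun κ : ℝ => κ * (VarConv.chiDE d (ρ / κ)).toReal -
          ((VarConv.chiAB d ρ).toReal + ρ * ((d : ℝ) / 2) * Real.log κ))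
        atTop (𝓝 0)) ∧
    ∀ γ ν : ℝ, 0 ≤ γ → γ < 1 + 2 / (d : ℝ) → γ ≠ 1 →
      ν = (1 - γ) / (2 + (d : ℝ) * (1 - γ)) →
      (VarConv.chiB d γ ρ ≠ ⊥ ∧ VarConv.chiB d γ ρ ≠ ⊤) ∧
      (∀ κ : ℝ, 0 < κ → VarConv.chiDB d γ (ρ / κ) ≠ ⊥ ∧ VarConv.chiDB d γ (ρ / κ) ≠ ⊤) ∧
      Tendsto
        (fun κ : ℝ => κ ^ (1 - (d : ℝ) * ν) * (VarConv.chiDB d γ (ρ / κ)).toReal -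
          ((VarConv.chiB d γ ρ).toReal +
            ρ * ((1 - κ ^ (-((d : ℝ) * ν))) / (1 - γ))))
        atTop (𝓝 0) := by
  have hd0 : (0 : ℝ) < d := by exact_mod_cast hd
  constructor
  · obtain ⟨a, b, r, C, A, H, hr, hab⟩ := VarConv.exists_isSplitDensity_log hd hρ
    have hAB := H.chiAB_eq hd hr hρ hab
    have hκh : ∀ κ : ℝ, 0 < κ → κ * (κ ^ (-(1 / 2) : ℝ)) ^ 2 = 1 := fun κ hκ => by
      rw [← Real.rpow_natCast, ← Real.rpow_mul hκ.le]
      norm_num [Real.rpow_neg_one, hκ.ne']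
    have hDE := fun (κ : ℝ) (hκ : 0 < κ) =>
      H.chiDE_eq hd hr hρ hab (Real.rpow_pos_of_pos hκ (-(1 / 2)))
    have hρκ : ∀ κ : ℝ, 0 < κ → ρ / κ = ρ * (κ ^ (-(1 / 2) : ℝ)) ^ 2 := fun κ hκ => by
      rw [div_eq_iff hκ.ne', mul_assoc, mul_comm _ κ, hκh κ hκ, mul_one]
    refine ⟨?_, fun κ hκ => ?_, ?_⟩
    · rw [hAB]
      exact ⟨EReal.coe_ne_bot _, EReal.coe_ne_top _⟩
    · rw [hρκ κ hκ, hDE κ hκ]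
      exact ⟨EReal.coe_ne_bot _, EReal.coe_ne_top _⟩
    · have hlim := ((H.tendsto_sInf_meshValues hd hr).comp
        (VarConv.tendsto_rpow_neg_nhdsGT_zero one_half_pos)).sub_const
          (sInf (VarConv.contValues d a b))
      rw [sub_self] at hlim
      -- With h = κ^(-1/2) the constant -ρ d log h is exactly ρ (d/2) log κ, so the error is the
      -- difference of the two infima and nothing else.
      refine hlim.congr' ((eventually_gt_atTop 0).mono fun κ hκ => ?_)
      beta_reduce
      rw [hρκ κ hκ, hDE κ hκ, hAB, EReal.toReal_coe, EReal.toReal_coe, Real.log_rpow hκ,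
        Function.comp_apply]
      linear_combination (ρ * (d * (-(1 / 2) * Real.log κ)) - sInf (VarConv.meshValues d a b (κ ^ (-(1 / 2) : ℝ)))) * hκh κ hκ
  · rintro γ ν hγ hγd hγ1 rfl
    obtain ⟨a, b, r, C, A, H, hr, hab⟩ := VarConv.exists_isSplitDensity_pow hd hρ hγ hγd hγ1
    -- The condition γ < 1 + 2/d also makes the mesh κ^(-1/D) tend to zero.
    have hD : 0 < 2 + (d : ℝ) * (1 - γ) := by
      have h1 : γ - 1 < 2 / (d : ℝ) := by linarith
      rw [lt_div_iff₀ hd0] at h1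
      linarith
    set D : ℝ := 2 + (d : ℝ) * (1 - γ) with hDdef
    have hγ0 : 1 - γ ≠ 0 := sub_ne_zero.2 hγ1.symm
    have hB := H.chiB_eq hd hr hρ hγ1 hab
    have hDB := fun (κ : ℝ) (hκ : 0 < κ) =>
      H.chiDB_eq hd hr hρ hγ1 hab (Real.rpow_pos_of_pos hκ (-(1 / D)))
    rw [← hDdef] at hDB
    have hhD : ∀ κ : ℝ, 0 < κ → (κ ^ (-(1 / D))) ^ D = κ⁻¹ := fun κ hκ => by
      rw [← Real.rpow_mul hκ.le, neg_mul, one_div_mul_cancel hD.ne', Real.rpow_neg_one]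
    have hρκ : ∀ κ : ℝ, 0 < κ → ρ / κ = ρ * (κ ^ (-(1 / D))) ^ D := fun κ hκ => by
      rw [hhD κ hκ, div_eq_mul_inv]
    refine ⟨?_, fun κ hκ => ?_, ?_⟩
    · rw [hB]
      exact ⟨EReal.coe_ne_bot _, EReal.coe_ne_top _⟩
    · rw [hρκ κ hκ, hDB κ hκ]
      exact ⟨EReal.coe_ne_bot _, EReal.coe_ne_top _⟩
    · have hlim := ((H.tendsto_sInf_meshValues hd hr).comp
        (VarConv.tendsto_rpow_neg_nhdsGT_zero (one_div_pos.2 hD))).sub_const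
          (sInf (VarConv.contValues d a b))
      rw [sub_self] at hlim
      refine hlim.congr' ((eventually_gt_atTop 0).mono fun κ hκ => ?_)
      -- Here 1 - dν = 2/D, so the prefactor is exactly h^(-2).
      have h1 : κ ^ (1 - (d : ℝ) * ((1 - γ) / D)) * (κ ^ (-(1 / D))) ^ 2 = 1 := by
        rw [← Real.rpow_natCast, ← Real.rpow_mul hκ.le, ← Real.rpow_add hκ]
        refine (congrArg _ ?_).trans (Real.rpow_zero κ)
        push_cast
        field_simp
        rw [hDdef]
        ring
      have h2 : κ ^ (1 - (d : ℝ) * ((1 - γ) / D)) * (κ ^ (-(1 / D))) ^ D =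
          κ ^ (-((d : ℝ) * ((1 - γ) / D))) := by
        rw [hhD κ hκ, ← Real.rpow_neg_one, ← Real.rpow_add hκ]
        congr 1
        ring
      beta_reduce
      rw [hρκ κ hκ, hDB κ hκ, hB, EReal.toReal_coe, EReal.toReal_coe, Function.comp_apply]
      linear_combination (-(sInf (VarConv.meshValues d a b (κ ^ (-(1 / D)))) + ρ / (1 - γ))) * h1 +
        ρ / (1 - γ) * h2
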